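/- **Setting.** Let $\Omega\subset\mathbb R^n$ be open and bounded, $d$ a metric on $\Omega$, $B(x,r)=\{y\in\Omega: d(x,y)<r\}$, and assume that for every $x\in\Omega$ there is a positive increasing function $\alpha_x$ on $(0,\infty)$ with $\{z:|z-x|<\alpha_x(r)\}\subset B(x,r)$ for all $r>0$. Let $\eta>0$; call a ball $B(y,r)$ *admissible* if $y\in\Omega$ and $0<r<\eta\,\mathrm{dist}(y,\partial\Omega)$. Let $0<\theta<1$ and let $\delta_x(r)$ be a non doubling order of the balls: for each $x\in\Omega$ there is $C_x>1$ such that for every admissible $B(x,r)$ $$0<\delta_x(r)\le\theta r,\qquad \tfrac54\le\frac{|B(x,r+\delta_x(r))|}{|B(x,r)|}\le 2C_x .$$ Let $Q(x)$ be a symmetric nonnegative semidefinite, locally integrable matrix on $\Omega$, $A(x,z)$ a measurable symmetric nonnegative semidefinite matrix, and $0<k\le K$ with $k\,\xi^TQ(x)\xi\le\xi^TA(x,z)\xi\le K\,\xi^TQ(x)\xi$ for a.e. $x\in\Omega$ and all $z\in\mathbb R$, $\xi\in\mathbb R^n$; write $[\xi]_Q^2=\xi^TQ\xi$. Let $f\in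 L^\infty(\Omega)$. For open $U\subset\Omega$, $\mathcal W^{1,2}_Q(U)$ is the set of pairs $(w,\nabla w)$ that are limits in $L^2(U)\times\mathcal L^2(U,Q)$, where $\|\mathbf v\|^2_{\mathcal L^2(U,Q)}=\int_U[\mathbf v]_Q^2$, of pairs $(\varphi,\nabla\varphi)$ with $\varphi$ Lipschitz on $U$ and of finite norm $(\int_U\varphi^2+[\nabla\varphi]_Q^2)^{1/2}$; $(\mathcal W^{1,2}_Q)_0(U)$ is the closure of the pairs with $\varphi$ Lipschitz and compactly supported in $U$. *Sobolev inequality.* Let $\sigma>1$, $C_S>0$; for every admissible $B=B(y,r)$ and all $(w,\nabla w)\in(\mathcal W^{1,2}_Q)_0(B)$, with $S=|\{x\in B: w(x)\ne0\}|$, $$\Big(\tfrac1S\int_B|w|^{2\sigma}\Big)^{\frac1{2\sigma}}\le C_S\,r\Big(\tfrac1S\int_B[\nabla w]_Q^2\Big)^{\frac12}+C_S\Big(\tfrac1S\int_B|w|^2\Big)^{\frac12}.$$ *Accumulating cutoffs.* Let $0<\nu<1$, $C_0>0$; for every admissible $B(y,r)$ there are Lipschitz functions $\psi_j$, $0\le\psi_j\le1$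 ($j\ge1$), such that $E_j=\mathrm{supp}\,\psi_j$ satisfies $E_1\subset B(y,r)$, $B(y,\nu r)\subset\{\psi_j=1\}$, $E_{j+1}\Subset\{\psi_j=1\}$ (that is, the compact set $E_{j+1}$ is contained in $\{\psi_j=1\}$), $|E_j|\le C_0|E_{j+1}|$, and for a.e. $x\in B(y,r)$ $$[\nabla\psi_j]_Q\le\frac{C_0}{(1-\nu)\,\delta_y(\nu r)\,(1-\delta_y(\nu r)/r)^{j}} .$$ *Solutions.* $(u,\nabla u)\in\mathcal W^{1,2}_Q(\Omega)$ is a weak solution of $\nabla^TA(x,u)\nabla u=f$ if $-\int_\Omega(\nabla u)^TA(x,u)\nabla w=\int_\Omega fw$ for all $(w,\nabla w)\in(\mathcal W^{1,2}_Q)_0(\Omega)$ with $w\ge0$. A function $h$ is admissible for $v$ if on an interval $I$ containing the values of $v$ it is positive, monotone, $C^1$ and piecewise $C^2$, with $h'$, $h''$ and $th''(t)$ bounded on $I$. Let $\nabla_{reg}v$ equal $\nabla v$ at the points $x$ where $|\{v=v(x)\}|=0$, and $0$ elsewhere. $v\in W^{1,2}_Q(\Omega)$ is an $\mathcal A[v]$-weak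 subsolution if $-\int_\Omega(\nabla_{reg}v)^TA(x,v)\nabla w\ge\int_\Omega fw$, with absolutely convergent integrals, for all $w=\psi^2h(v)h'(v)$ with $\psi$ Lipschitz and compactly supported in $\Omega$, $h$ admissible for $v$ and $h'\ge0$, where $\nabla w=2\psi\,h(v)h'(v)\nabla\psi+\psi^2(h'(v)^2+h(v)h''(v))\nabla_{reg}v$. **Proposition (Moser iteration).** There is a constant $C_\sigma$, depending only on $\sigma$ and on the constants $C_S,C_0,k,K,\theta$ of the assumptions (not on $n$, $\Omega$, $d$, $Q$, $A$, $f$, $\delta$, $\eta$, $\nu$, $\gamma$, $u$, $y$, $r$), such that the following holds. Let $|\gamma|\le2$ and let $u\in W^{1,2}_Q(\Omega)$ satisfy one of (a) $u$ is a nonnegative weak solution of $\nabla^TA(x,u)\nabla u=f$ in $\Omega$; (b) $\gamma>\frac12$ and, for all $m>0$, $u+m$ is a positive $\mathcal A[u+m]$-weak subsolution of this equation in $\Omega$. Then for every admissible ball $B=B(y,r)$, with $\overline u=u+r^2\|f\|_{L^\infty(\Omega)}$, $$\operatorname*{ess\,sup}_{B(y,\nu r)}\overline u^{\,\gamma}\le\frac{C_\sigma}{(1-\nu)^{\tau}\,(\delta_y(\nu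 r)/r)^{\frac{\sigma}{\sigma-1}}}\Big(\frac1{|B|}\int_B\overline u^{\,2\gamma}\Big)^{\frac12},\qquad \tau=\max\Big\{\frac1{(\sigma-1)^2}+1,\ \frac{\sigma}{\sigma-1}\Big\}.$$ In particular $\tau=\frac1{(\sigma-1)^2}+1$ whenever $\sigma\le2$. Both sides may be $+\infty$; $0^\gamma=+\infty$ for $\gamma<0$ and $0^0=1$. -/

import Mathlib

open MeasureTheory Filter Topology Set
open scoped ENNReal

noncomputable section

namespace Degenerate

/-- Euclidean space `ℝⁿ`. -/
abbrev E (n : ℕ) := EuclideanSpace ℝ (Fin n)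

/-- Square matrices of size `n`. -/
abbrev Mat (n : ℕ) := Matrix (Fin n) (Fin n) ℝ

/-- The bilinear form `ξᵀ M ζ`. -/
def bil {n : ℕ} (M : Mat n) (ξ ζ : E n) : ℝ :=
  dotProduct (WithLp.ofLp ξ) (M.mulVec (WithLp.ofLp ζ))

/-- The quadratic form `[ξ]_M² = ξᵀ M ξ`. -/
def quad {n : ℕ} (M : Mat n) (ξ : E n) : ℝ := bil M ξ ξ

/-! ### Metric balls and the non doubling order -/

/-- `d` is a metric on the set `Ω`. -/
structure IsMetricOn {n : ℕ} (d : E n → E n → ℝ) (Ω : Set (E n)) : Prop where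
  nonneg : ∀ x ∈ Ω, ∀ y ∈ Ω, 0 ≤ d x y
  eq_zero_iff : ∀ x ∈ Ω, ∀ y ∈ Ω, d x y = 0 ↔ x = y
  symm : ∀ x ∈ Ω, ∀ y ∈ Ω, d x y = d y x
  triangle : ∀ x ∈ Ω, ∀ y ∈ Ω, ∀ z ∈ Ω, d x z ≤ d x y + d y z

/-- The metric ball `B(x, r) = {y ∈ Ω : d(x, y) < r}`. -/
def dball {n : ℕ} (d : E n → E n → ℝ) (Ω : Set (E n)) (x : E n) (r : ℝ) : Set (E n) :=
  {y | y ∈ Ω ∧ d x y < r}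

/-- `0 < r < η dist(y, ∂Ω)` with `y ∈ Ω`. -/
def Admits {n : ℕ} (Ω : Set (E n)) (η : ℝ) (y : E n) (r : ℝ) : Prop :=
  y ∈ Ω ∧ 0 < r ∧ r < η * Metric.infDist y (frontier Ω)

/-- Containment condition: every metric ball `B(x, r)` contains a Euclidean ball
`B_E(x, α_x(r))`, with `α_x` increasing and positive. -/
def Containment {n : ℕ} (d : E n → E n → ℝ) (Ω : Set (E n)) : Prop :=
  ∀ x ∈ Ω, ∃ α : ℝ → ℝ, MonotoneOn α (Ioi 0) ∧
    ∀ r, 0 < r → 0 < α r ∧ Metric.ball x (α r) ⊆ dball d Ω x r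

/-- The metric balls are non doubling of order `δ`:
`5/4 ≤ |B(x, r + δ_x(r))| / |B(x, r)| ≤ 2C` for `0 < r < η dist(x, ∂Ω)`, with `C > 1` depending
on `x`. Neither the minimality of `δ_x(r)` nor `δ_x(r)/r → 0` is asked for; only
`0 < δ_x(r) ≤ θ r`. -/
def NonDoublingOrder {n : ℕ} (d : E n → E n → ℝ) (Ω : Set (E n)) (η θ : ℝ)
    (δ : E n → ℝ → ℝ) : Prop :=
  ∀ x ∈ Ω, ∃ C : ℝ, 1 < C ∧ ∀ r, Admits Ω η x r →
    0 < δ x r ∧ δ x r ≤ θ * r ∧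
    ENNReal.ofReal (5 / 4) * volume (dball d Ω x r) ≤ volume (dball d Ω x (r + δ x r)) ∧
    volume (dball d Ω x (r + δ x r)) ≤ ENNReal.ofReal (2 * C) * volume (dball d Ω x r)

/-! ### Degenerate Sobolev spaces -/

/-- The Lipschitz functions on `U` with finite `W^{1,2}_Q(U)` norm. -/
def LipQ {n : ℕ} (Q : E n → Mat n) (U : Set (E n)) : Set (E n → ℝ) :=
  {φ | (∃ L, LipschitzOnWith L φ U) ∧
    ∫⁻ x in U, ENNReal.ofReal (φ x ^ 2 + quad (Q x) (gradient φ x)) < ∞}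

/-- The Lipschitz functions with compact support contained in `U`. -/
def LipC {n : ℕ} (U : Set (E n)) : Set (E n → ℝ) :=
  {φ | (∃ L, LipschitzWith L φ) ∧ HasCompactSupport φ ∧ tsupport φ ⊆ U}

/-- The pair `(w, g)` is the limit in `L²(U) × 𝓛²(U, Q)` of pairs `(φ, ∇φ)` with `φ ∈ S`. -/
def IsLimit {n : ℕ} (Q : E n → Mat n) (U : Set (E n)) (S : Set (E n → ℝ))
    (w : E n → ℝ) (g : E n → E n) : Prop :=
  AEStronglyMeasurable w (volume.restrict U) ∧ AEStronglyMeasurable g (volume.restrict U) ∧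
  ∃ φ : ℕ → E n → ℝ, (∀ k, φ k ∈ S) ∧
    Tendsto (fun k => ∫⁻ x in U, ENNReal.ofReal ((φ k x - w x) ^ 2)) atTop (𝓝 0) ∧
    Tendsto (fun k => ∫⁻ x in U, ENNReal.ofReal (quad (Q x) (gradient (φ k) x - g x)))
      atTop (𝓝 0)

/-- `(w, g) ∈ 𝒲^{1,2}_Q(U)`: the completion of `Lip(U)`, as pairs (function, gradient). -/
def MemW {n : ℕ} (Q : E n → Mat n) (U : Set (E n)) (w : E n → ℝ) (g : E n → E n) : Prop :=
  IsLimit Q U (LipQ Q U) w g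

/-- `(w, g) ∈ (𝒲^{1,2}_Q)₀(U)`: the closure of `Lip_c(U)` in `𝒲^{1,2}_Q(U)`. -/
def MemW0 {n : ℕ} (Q : E n → Mat n) (U : Set (E n)) (w : E n → ℝ) (g : E n → E n) : Prop :=
  IsLimit Q U (LipC U ∩ LipQ Q U) w g

/-- The regularized gradient: `∇u` cut off to zero where `u` takes a value that it takes on a
set of positive measure. -/
def regGrad {n : ℕ} (Ω : Set (E n)) (u : E n → ℝ) (g : E n → E n) : E n → E n :=
  indicator {x | volume (Ω ∩ {z | u z = u x}) = 0} g

/-! ### Weak solutions -/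

/-- `(u, g)` satisfies `-∫ (∇u)ᵀ A(x, u) ∇w = ∫ f w`, with absolutely convergent integrals, for
every test pair in `T`. -/
def SolvesOn {n : ℕ} (Ω : Set (E n)) (A : E n → ℝ → Mat n) (f : E n → ℝ)
    (T : Set ((E n → ℝ) × (E n → E n))) (u : E n → ℝ) (g : E n → E n) : Prop :=
  ∀ p ∈ T, IntegrableOn (fun x => bil (A x (u x)) (g x) (p.2 x)) Ω ∧
    IntegrableOn (fun x => f x * p.1 x) Ω ∧
    - ∫ x in Ω, bil (A x (u x)) (g x) (p.2 x) = ∫ x in Ω, f x * p.1 x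

/-- `(u, g)` satisfies `-∫ (∇u)ᵀ A(x, u) ∇w ≥ ∫ f w`, with absolutely convergent integrals, for
every test pair in `T`. -/
def SubsolvesOn {n : ℕ} (Ω : Set (E n)) (A : E n → ℝ → Mat n) (f : E n → ℝ)
    (T : Set ((E n → ℝ) × (E n → E n))) (u : E n → ℝ) (g : E n → E n) : Prop :=
  ∀ p ∈ T, IntegrableOn (fun x => bil (A x (u x)) (g x) (p.2 x)) Ω ∧
    IntegrableOn (fun x => f x * p.1 x) Ω ∧
    ∫ x in Ω, f x * p.1 x ≤ - ∫ x in Ω, bil (A x (u x)) (g x) (p.2 x)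

/-- The nonnegative elements of `(𝒲^{1,2}_Q)₀(Ω)`. -/
def nonnegTests {n : ℕ} (Q : E n → Mat n) (Ω : Set (E n)) :
    Set ((E n → ℝ) × (E n → E n)) :=
  {p | MemW0 Q Ω p.1 p.2 ∧ ∀ᵐ x ∂volume.restrict Ω, 0 ≤ p.1 x}

/-- `(u, g) ∈ 𝒲^{1,2}_Q(Ω)` is a weak solution of `∇ᵀ A(x, u) ∇u = f` in `Ω`. -/
def IsWeakSolution {n : ℕ} (Q : E n → Mat n) (Ω : Set (E n)) (A : E n → ℝ → Mat n)
    (f : E n → ℝ) (u : E n → ℝ) (g : E n → E n) : Prop :=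
  MemW Q Ω u g ∧ SolvesOn Ω A f (nonnegTests Q Ω) u g

/-- `h` is admissible on the interval `I`, with first derivative `h'` and piecewise second
derivative `h''`: `h` is positive, monotone, `C¹` and piecewise `C²` on `I` (with finitely many
break points `F`), and `|h'|, |h''|, |t h''| ≤ C` on `I`. -/
def Admissible (I : Set ℝ) (h h' h'' : ℝ → ℝ) : Prop :=
  I.OrdConnected ∧ (∀ t ∈ I, 0 < h t) ∧ (MonotoneOn h I ∨ AntitoneOn h I) ∧
  (∀ t ∈ I, HasDerivWithinAt h (h' t) I t) ∧ ContinuousOn h' I ∧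
  ∃ F : Finset ℝ,
    (∀ t ∈ I \ F, HasDerivWithinAt h' (h'' t) I t) ∧ ContinuousOn h'' (I \ F) ∧
    (∀ t ∈ I, t ∈ F → (∃ l, Tendsto h'' (𝓝[I ∩ Iio t] t) (𝓝 l)) ∧
      ∃ l, Tendsto h'' (𝓝[I ∩ Ioi t] t) (𝓝 l)) ∧
    ∃ C : ℝ, (∀ t ∈ I, |h' t| ≤ C) ∧ ∀ t ∈ I \ F, |h'' t| ≤ C ∧ |t * h'' t| ≤ C

/-- The test class `𝒜[u]` of the elements `ψ² h(u) h'(u)`, where `ψ` is Lipschitz with compact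
support in `Ω`, `h` is admissible for `u` and `h' ≥ 0`. The gradient is given by the product
rule and the chain rule, where `g` is the regularized gradient of `u`. -/
def classA {n : ℕ} (Ω : Set (E n)) (u : E n → ℝ) (g : E n → E n) :
    Set ((E n → ℝ) × (E n → E n)) :=
  {p | ∃ (ψ : E n → ℝ) (I : Set ℝ) (h h' h'' : ℝ → ℝ), ψ ∈ LipC Ω ∧ Admissible I h h' h'' ∧
    (∀ᵐ x ∂volume.restrict Ω, u x ∈ I) ∧ (∀ t ∈ I, 0 ≤ h' t) ∧
    p.1 = (fun x => ψ x ^ 2 * (h (u x) * h' (u x))) ∧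
    p.2 = (fun x => (2 * ψ x * (h (u x) * h' (u x))) • gradient ψ x +
      (ψ x ^ 2 * (h' (u x) ^ 2 + h (u x) * h'' (u x))) • g x)}

/-- `u` (with gradient `g`) is an `𝒜[u]`-weak subsolution of `∇ᵀ A(x, u) ∇u = f` in `Ω`; the
element `u` is represented by the pair of `u` and its regularized gradient. -/
def IsAWeakSubsolution {n : ℕ} (Q : E n → Mat n) (Ω : Set (E n)) (A : E n → ℝ → Mat n)
    (f : E n → ℝ) (u : E n → ℝ) (g : E n → E n) : Prop :=
  MemW Q Ω u g ∧
    SubsolvesOn Ω A f (classA Ω u (regGrad Ω u g)) u (regGrad Ω u g)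

/-! ### Structural assumptions -/

/-- The coefficients: `Q` and `A` are symmetric nonnegative semidefinite, `Q` is locally
integrable, `A` is measurable, and `k ξᵀQξ ≤ ξᵀA(x,z)ξ ≤ K ξᵀQξ`. -/
structure Structural {n : ℕ} (Ω : Set (E n)) (Q : E n → Mat n) (A : E n → ℝ → Mat n)
    (k K : ℝ) : Prop where
  locInt : ∀ i j, LocallyIntegrableOn (fun x => Q x i j) Ω
  psdQ : ∀ᵐ x ∂volume.restrict Ω, (Q x).PosSemidef
  measA : ∀ i j, Measurable (fun p : E n × ℝ => A p.1 p.2 i j)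
  psdA : ∀ᵐ x ∂volume.restrict Ω, ∀ z, (A x z).PosSemidef
  bounds : ∀ᵐ x ∂volume.restrict Ω, ∀ z, ∀ ξ : E n,
    k * quad (Q x) ξ ≤ quad (A x z) ξ ∧ quad (A x z) ξ ≤ K * quad (Q x) ξ

/-- The Sobolev inequality with averages over the support of `w`, on all metric balls. -/
def Sobolev {n : ℕ} (d : E n → E n → ℝ) (Ω : Set (E n)) (Q : E n → Mat n)
    (σ η C : ℝ) : Prop :=
  ∀ y r, Admits Ω η y r → ∀ w g, MemW0 Q (dball d Ω y r) w g →
    ((volume (dball d Ω y r ∩ {x | w x ≠ 0}))⁻¹ *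
        ∫⁻ x in dball d Ω y r, ENNReal.ofReal |w x| ^ (2 * σ)) ^ (1 / (2 * σ)) ≤
      ENNReal.ofReal (C * r) *
        ((volume (dball d Ω y r ∩ {x | w x ≠ 0}))⁻¹ *
          ∫⁻ x in dball d Ω y r, ENNReal.ofReal (quad (Q x) (g x))) ^ (1 / 2 : ℝ) +
      ENNReal.ofReal C *
        ((volume (dball d Ω y r ∩ {x | w x ≠ 0}))⁻¹ *
          ∫⁻ x in dball d Ω y r, ENNReal.ofReal |w x| ^ (2 : ℝ)) ^ (1 / 2 : ℝ)

/-- Existence of an accumulating sequence `ψ₁, ψ₂, …` of Lipschitz cutoff functions on every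
metric ball. The inclusion `supp ψ_{j+1} ⊆ {ψ_j = 1}` is automatically compact. -/
def Cutoffs {n : ℕ} (d : E n → E n → ℝ) (Ω : Set (E n)) (Q : E n → Mat n)
    (δ : E n → ℝ → ℝ) (ν η C : ℝ) : Prop :=
  ∀ y r, Admits Ω η y r → ∃ ψ : ℕ → E n → ℝ, tsupport (ψ 1) ⊆ dball d Ω y r ∧
    ∀ j, 1 ≤ j →
      (∃ L, LipschitzWith L (ψ j)) ∧ (∀ x, ψ j x ∈ Icc (0 : ℝ) 1) ∧
      dball d Ω y (ν * r) ⊆ {x | ψ j x = 1} ∧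
      tsupport (ψ (j + 1)) ⊆ {x | ψ j x = 1} ∧
      volume (tsupport (ψ j)) ≤ ENNReal.ofReal C * volume (tsupport (ψ (j + 1))) ∧
      ∀ᵐ x ∂volume.restrict (dball d Ω y r),
        √(quad (Q x) (gradient (ψ j) x)) ≤
          C / ((1 - ν) * δ y (ν * r) * (1 - δ y (ν * r) / r) ^ j)

end Degenerate

end

namespace Degenerate

variable {n : ℕ}

/-! ### The bilinear form of a matrix -/

/-! Fix an admissible ball `B` and put `v = u + r²‖f‖ + m` with `m > 0`. Then `v` is bounded below
by a positive constant and `|f| ≤ v / r²`, so the right hand side behaves like a zero order term.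
Testing with `χ² Φ(v)`, with `Φ` adapted to a profile `h`, gives Caccioppoli's inequality for `h(v)`
(`LocalData.caccioppoli`). Inserted into the Sobolev inequality for `χ h(v)` it gives a reverse
Hölder inequality (`LocalData.step`); with `h(t) = t^β` integrability rises from `2β` to `2σβ`.
Repeating this along `β, σβ, σ²β, …` bounds the supremum. The averages over the support of `w` in
the Sobolev inequality are first turned into averages over `B` by adding a tiny bump with large
support (`Sobolev.normalized`).

All integrals stay on the same ball. In place of shrinking supports, powers `ψ^κ` of one cutoff
serve: `[∇ψ^κ]_Q² ≤ κ² Γ ψ^(2κ-2)`, so the step maps the weight `ψ^(2κ-2)` to the weight with `σκ+1`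
in place of `κ` (`isCutoff_rpow`, `kap`). The step constants grow geometrically, which the iteration
tolerates (`iterate_gain`, `ae_le_of_gain`). A factor `P` in the gain enters the final constant as
`P^(σ/(σ-1))`; since `P` is of order `(r/((1-ν)δ))²`, the square root gives
`(r/((1-ν)δ))^(σ/(σ-1))`.

The gain is available for two ranges of `β`. For `β ≥ 1` subsolutions suffice; powers truncated to
linear growth are admissible, and Fatou removes the truncation (`LocalData.gainAt_of_one_le`). For
`β ≤ 1/4`, `β ≠ 0`, a solution is tested with multiples of `χ² v^(2β-1)`
(`LocalData.gainAt_of_le_quarter`). Negative exponents never leave the second range. For `1/4 ≤ β <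
1` the supremum bound at exponent `1` is interpolated with the integral of `v^(2β)`; the supremum
can be absorbed because it is finite, `v` being in `L²` (`ae_le_of_gain_of_lt_one`). For `0 < γ <
1/4` finitely many steps of the second kind climb to `1/4`, with a constant that stays bounded as `γ
→ 0` (`ae_le_of_gain_of_pos_of_lt_quarter`).

Subsolutions are tested through the regularized gradient, which is again a gradient of `v` in
`𝒲^{1,2}_Q` (`MemW.regGrad`). Finally `m → 0` (`ae_rpow_le_of_shift`), and `γ = 0` is trivial. -/

theorem bil_add_left (M : Mat n) (a b c : E n) : bil M (a + b) c = bil M a c + bil M b c := by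
  simp [bil, add_dotProduct]

theorem bil_add_right (M : Mat n) (a b c : E n) : bil M a (b + c) = bil M a b + bil M a c := by
  simp [bil, Matrix.mulVec_add, dotProduct_add]

theorem bil_smul_left (M : Mat n) (t : ℝ) (a b : E n) : bil M (t • a) b = t * bil M a b := by
  simp [bil, smul_dotProduct]

theorem bil_smul_right (M : Mat n) (t : ℝ) (a b : E n) : bil M a (t • b) = t * bil M a b := by
  simp [bil, Matrix.mulVec_smul, dotProduct_smul]

theorem bil_comm {M : Mat n} (hM : M.PosSemidef) (a b : E n) : bil M a b = bil M b a := by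
  have hT : M.transpose = M := by
    have := hM.1
    rwa [Matrix.IsHermitian, Matrix.conjTranspose_eq_transpose_of_trivial] at this
  unfold bil
  rw [Matrix.dotProduct_mulVec, ← Matrix.mulVec_transpose, hT, dotProduct_comm]

theorem quad_nonneg {M : Mat n} (hM : M.PosSemidef) (a : E n) : 0 ≤ quad M a := by
  have := hM.dotProduct_mulVec_nonneg (WithLp.ofLp a)
  simpa [quad, bil] using this

@[simp] theorem quad_zero (M : Mat n) : quad M 0 = 0 := by simp [quad, bil]

theorem quad_smul (M : Mat n) (t : ℝ) (a : E n) : quad M (t • a) = t ^ 2 * quad M a := by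
  simp only [quad, bil_smul_left, bil_smul_right]; ring

theorem quad_add {M : Mat n} (hM : M.PosSemidef) (a b : E n) :
    quad M (a + b) = quad M a + 2 * bil M a b + quad M b := by
  simp only [quad, bil_add_left, bil_add_right, bil_comm hM b a]; ring

theorem quad_add_le {M : Mat n} (hM : M.PosSemidef) (a b : E n) :
    quad M (a + b) ≤ 2 * quad M a + 2 * quad M b := by
  have h := quad_nonneg hM (a + (-1 : ℝ) • b)
  rw [quad_add hM, bil_smul_right, quad_smul] at h
  rw [quad_add hM]
  linarith

/-- Young's inequality for the bilinear form. -/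
theorem two_mul_abs_bil_le {M : Mat n} (hM : M.PosSemidef) (a b : E n) :
    2 * |bil M a b| ≤ quad M a + quad M b := by
  have h1 := quad_nonneg hM (a + (-1 : ℝ) • b)
  have h2 := quad_nonneg hM (a + b)
  rw [quad_add hM, bil_smul_right, quad_smul] at h1
  rw [quad_add hM] at h2
  rcases abs_cases (bil M a b) with h | h <;> rw [h.1] <;> linarith

theorem quad_neg (M : Mat n) (a : E n) : quad M (-a) = quad M a := by
  have := quad_smul M (-1) a
  simpa using this

theorem quad_sub_comm (M : Mat n) (a b : E n) : quad M (a - b) = quad M (b - a) := by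
  rw [← quad_neg, neg_sub]

theorem quad_eq_sum (M : Mat n) (a : E n) : quad M a = ∑ i, ∑ j, a i * (M i j * a j) := by
  simp [quad, bil, dotProduct, Matrix.mulVec, Finset.mul_sum]

theorem aemeasurable_quad {μ : Measure (E n)} {Q : E n → Mat n} {g : E n → E n}
    (hQ : ∀ i j, AEMeasurable (fun x => Q x i j) μ) (hg : AEStronglyMeasurable g μ) :
    AEMeasurable (fun x => quad (Q x) (g x)) μ := by
  simp only [quad_eq_sum]
  have hgi : ∀ i, AEMeasurable (fun x => g x i) μ := fun i =>
    ((EuclideanSpace.proj (𝕜 := ℝ) i).continuous.measurable).comp_aemeasurable hg.aemeasurable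
  refine Finset.aemeasurable_fun_sum _ fun i _ => Finset.aemeasurable_fun_sum _ fun j _ => ?_
  exact (hgi i).mul ((hQ i j).mul (hgi j))

theorem Structural.aemeasurable_Q {Ω : Set (E n)} {Q : E n → Mat n} {A : E n → ℝ → Mat n}
    {k K : ℝ} (h : Structural Ω Q A k K) (i j : Fin n) :
    AEMeasurable (fun x => Q x i j) (volume.restrict Ω) :=
  (h.locInt i j).aestronglyMeasurable.aemeasurable

/-! ### Gradients -/

theorem hasGradientAt_mul {φ ψ : E n → ℝ} {x a b : E n} (hφ : HasGradientAt φ a x)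
    (hψ : HasGradientAt ψ b x) :
    HasGradientAt (fun y => φ y * ψ y) (φ x • b + ψ x • a) x := by
  rw [hasGradientAt_iff_hasFDerivAt] at *
  rw [map_add, map_smul, map_smul]
  exact hφ.mul hψ

theorem hasGradientAt_comp {φ : E n → ℝ} {x a : E n} {F : ℝ → ℝ} {F' : ℝ}
    (hF : HasDerivAt F F' (φ x)) (hφ : HasGradientAt φ a x) :
    HasGradientAt (fun y => F (φ y)) (F' • a) x := by
  rw [hasGradientAt_iff_hasFDerivAt] at *
  rw [map_smul]
  exact hF.comp_hasFDerivAt x hφ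

theorem hasGradientAt_add {φ ψ : E n → ℝ} {x a b : E n} (hφ : HasGradientAt φ a x)
    (hψ : HasGradientAt ψ b x) : HasGradientAt (fun y => φ y + ψ y) (a + b) x := by
  rw [hasGradientAt_iff_hasFDerivAt] at *
  rw [map_add]
  exact hφ.add hψ

theorem ae_hasGradientAt {U : Set (E n)} (hU : IsOpen U) {φ : E n → ℝ} {L : NNReal}
    (h : LipschitzOnWith L φ U) :
    ∀ᵐ x ∂volume.restrict U, HasGradientAt φ (gradient φ x) x := by
  have := h.ae_differentiableWithinAt (μ := volume) hU.measurableSet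
  filter_upwards [this, ae_restrict_mem hU.measurableSet] with x hx hxU
  exact (hx.differentiableAt (hU.mem_nhds hxU)).hasGradientAt

theorem gradient_eq_zero_of_notMem_tsupport {φ : E n → ℝ} {x : E n} (hx : x ∉ tsupport φ) :
    gradient φ x = 0 := by
  have : φ =ᶠ[𝓝 x] fun _ => 0 := notMem_tsupport_iff_eventuallyEq.1 hx
  have h2 : fderiv ℝ φ x = 0 := by
    rw [this.fderiv_eq]; simp
  simp [gradient, h2]

/-! ### Lipschitz functions with compact support -/

/-- `F` may be unbounded, but it is bounded on the support of `ψ`. Splitting the difference as `F x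
(ψ x - ψ y) + ψ y (F x - F y)` needs a bound on `F` at one of the two points only, so a pair with
just one point in the support causes no trouble. -/
theorem LipschitzWith.mul_of_hasCompactSupport {ψ F : E n → ℝ} {L K : NNReal}
    (hψ : LipschitzWith L ψ) (hs : HasCompactSupport ψ) (hF : LipschitzWith K F) :
    ∃ C, LipschitzWith C fun x => ψ x * F x := by
  obtain ⟨M, hM⟩ := hs.isCompact.exists_bound_of_continuousOn hF.continuous.continuousOn
  obtain ⟨N, hN⟩ := hs.exists_bound_of_continuous hψ.continuous
  have hM0 : 0 ≤ max M 0 := le_max_right _ _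
  have hN0 : 0 ≤ N := (norm_nonneg _).trans (hN 0)
  have key : ∀ x y, x ∈ tsupport ψ → |ψ x * F x - ψ y * F y| ≤
      (max M 0 * L + N * K) * dist x y := by
    intro x y hx
    have h1 : |F x| ≤ max M 0 := (hM x hx).trans (le_max_left _ _)
    have h2 : |ψ y| ≤ N := hN y
    have h3 := hψ.dist_le_mul x y
    have h4 := hF.dist_le_mul x y
    rw [Real.dist_eq] at h3 h4
    calc |ψ x * F x - ψ y * F y| = |F x * (ψ x - ψ y) + ψ y * (F x - F y)| := by ring_nf
      _ ≤ |F x| * |ψ x - ψ y| + |ψ y| * |F x - F y| := by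
          rw [← abs_mul, ← abs_mul]; exact abs_add_le _ _
      _ ≤ max M 0 * (L * dist x y) + N * (K * dist x y) := by gcongr
      _ = _ := by ring
  refine ⟨⟨max M 0 * L + N * K, by positivity⟩, LipschitzWith.of_dist_le_mul fun x y => ?_⟩
  rw [Real.dist_eq]
  by_cases hx : x ∈ tsupport ψ
  · exact key x y hx
  by_cases hy : y ∈ tsupport ψ
  · rw [abs_sub_comm, dist_comm]; exact key y x hy
  · rw [image_eq_zero_of_notMem_tsupport hx, image_eq_zero_of_notMem_tsupport hy]
    rw [zero_mul, zero_mul, sub_zero, abs_zero]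
    exact mul_nonneg (NNReal.coe_nonneg _) dist_nonneg

theorem lipschitzWith_of_hasDerivAt {F F' : ℝ → ℝ} {C : ℝ} (hC : 0 ≤ C)
    (hF : ∀ t, HasDerivAt F (F' t) t) (hb : ∀ t, |F' t| ≤ C) :
    LipschitzWith ⟨C, hC⟩ F :=
  lipschitzWith_of_nnnorm_deriv_le (fun t => (hF t).differentiableAt) fun t => by
    rw [(hF t).deriv]; exact hb t

end Degenerate

namespace Degenerate

variable {n : ℕ}

theorem measurable_gradient (ψ : E n → ℝ) : Measurable (gradient ψ) := by
  unfold gradient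
  exact (InnerProductSpace.toDual ℝ (E n)).symm.continuous.measurable.comp (measurable_fderiv ℝ ψ)

theorem ofReal_le_two_mul_add {a b c : ℝ} (h : c ≤ 2 * a + 2 * b) (ha : 0 ≤ a) (hb : 0 ≤ b) :
    ENNReal.ofReal c ≤ 2 * ENNReal.ofReal a + 2 * ENNReal.ofReal b := by
  rw [show (2 : ℝ≥0∞) = ENNReal.ofReal 2 by simp, ← ENNReal.ofReal_mul (by simp),
    ← ENNReal.ofReal_mul (by simp), ← ENNReal.ofReal_add (by positivity) (by positivity)]
  exact ENNReal.ofReal_le_ofReal h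

/-! ### Limits in the degenerate Sobolev norm -/

theorem lintegral_sq_add_le {μ : Measure (E n)} {a b : E n → ℝ} (ha : AEMeasurable a μ) :
    ∫⁻ x, ENNReal.ofReal ((a x + b x) ^ 2) ∂μ ≤
      2 * ∫⁻ x, ENNReal.ofReal (a x ^ 2) ∂μ + 2 * ∫⁻ x, ENNReal.ofReal (b x ^ 2) ∂μ := by
  rw [← lintegral_const_mul' _ _ (by simp), ← lintegral_const_mul' _ _ (by simp),
    ← lintegral_add_left' (by fun_prop)]
  refine lintegral_mono fun x => ?_
  exact ofReal_le_two_mul_add (by nlinarith [sq_nonneg (a x - b x)]) (sq_nonneg _) (sq_nonneg _)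

theorem lintegral_quad_add_le {μ : Measure (E n)} {Q : E n → Mat n} {a b : E n → E n}
    (hQ : ∀ i j, AEMeasurable (fun x => Q x i j) μ) (hp : ∀ᵐ x ∂μ, (Q x).PosSemidef)
    (ha : AEStronglyMeasurable a μ) :
    ∫⁻ x, ENNReal.ofReal (quad (Q x) (a x + b x)) ∂μ ≤
      2 * ∫⁻ x, ENNReal.ofReal (quad (Q x) (a x)) ∂μ +
        2 * ∫⁻ x, ENNReal.ofReal (quad (Q x) (b x)) ∂μ := by
  rw [← lintegral_const_mul' _ _ (by simp), ← lintegral_const_mul' _ _ (by simp),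
    ← lintegral_add_left' ((aemeasurable_quad hQ ha).ennreal_ofReal.const_mul _)]
  refine lintegral_mono_ae ?_
  filter_upwards [hp] with x hx
  exact ofReal_le_two_mul_add (quad_add_le hx _ _) (quad_nonneg hx _) (quad_nonneg hx _)

section

variable {Q : E n → Mat n} {U : Set (E n)} {S : Set (E n → ℝ)} {w : E n → ℝ} {g : E n → E n}

theorem IsLimit.exists_le (h : IsLimit Q U S w g) {ε : ℝ≥0∞} (hε : ε ≠ 0) :
    ∃ φ ∈ S, ∫⁻ x in U, ENNReal.ofReal ((φ x - w x) ^ 2) ≤ ε ∧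
      ∫⁻ x in U, ENNReal.ofReal (quad (Q x) (gradient φ x - g x)) ≤ ε := by
  obtain ⟨-, -, φ, hS, h1, h2⟩ := h
  obtain ⟨k, hk1, hk2⟩ := ((h1.eventually (gt_mem_nhds hε.bot_lt)).and
    (h2.eventually (gt_mem_nhds hε.bot_lt))).exists
  exact ⟨φ k, hS k, hk1.le, hk2.le⟩

theorem IsLimit.of_forall_exists_le (hw : AEStronglyMeasurable w (volume.restrict U))
    (hg : AEStronglyMeasurable g (volume.restrict U))
    (h : ∀ ε : ℝ≥0∞, ε ≠ 0 → ∃ φ ∈ S, ∫⁻ x in U, ENNReal.ofReal ((φ x - w x) ^ 2) ≤ ε ∧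
      ∫⁻ x in U, ENNReal.ofReal (quad (Q x) (gradient φ x - g x)) ≤ ε) :
    IsLimit Q U S w g := by
  obtain ⟨e, -, he, he0⟩ := exists_seq_strictAnti_tendsto' (show (0 : ℝ≥0∞) < 1 by simp)
  choose φ hS h1 h2 using fun k => h (e k) (he k).1.ne'
  exact ⟨hw, hg, φ, hS,
    tendsto_of_tendsto_of_tendsto_of_le_of_le tendsto_const_nhds he0 (fun _ => bot_le) h1,
    tendsto_of_tendsto_of_tendsto_of_le_of_le tendsto_const_nhds he0 (fun _ => bot_le) h2⟩

/-- A closure is closed: an approximant of `W k` is an approximant of `w` once `k` is large. The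
budget `ε / 4` pays for the factor `2` in each squared triangle inequality. -/
theorem IsLimit.of_tendsto (hQ : ∀ i j, AEMeasurable (fun x => Q x i j) (volume.restrict U))
    (hp : ∀ᵐ x ∂volume.restrict U, (Q x).PosSemidef) {W : ℕ → E n → ℝ} {G : ℕ → E n → E n}
    (h : ∀ k, IsLimit Q U S (W k) (G k)) (hw : AEStronglyMeasurable w (volume.restrict U))
    (hg : AEStronglyMeasurable g (volume.restrict U))
    (h1 : Tendsto (fun k => ∫⁻ x in U, ENNReal.ofReal ((W k x - w x) ^ 2)) atTop (𝓝 0))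
    (h2 : Tendsto (fun k => ∫⁻ x in U, ENNReal.ofReal (quad (Q x) (G k x - g x))) atTop (𝓝 0)) :
    IsLimit Q U S w g := by
  refine IsLimit.of_forall_exists_le hw hg fun ε hε => ?_
  have hε4 : ε / 4 ≠ 0 := by simp [hε]
  obtain ⟨k, hk1, hk2⟩ := ((h1.eventually (gt_mem_nhds hε4.bot_lt)).and
    (h2.eventually (gt_mem_nhds hε4.bot_lt))).exists
  obtain ⟨φ, hφ, hφ1, hφ2⟩ := (h k).exists_le hε4
  have h4 : 2 * (ε / 4) + 2 * (ε / 4) = ε := by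
    rw [← two_mul, ← mul_assoc, show (2 : ℝ≥0∞) * 2 = 4 by norm_num, ENNReal.mul_div_cancel] <;> norm_num
  refine ⟨φ, hφ, ?_, ?_⟩
  · calc _ = ∫⁻ x in U, ENNReal.ofReal (((W k x - w x) + (φ x - W k x)) ^ 2) := by
          congr! 4; ring
      _ ≤ _ := lintegral_sq_add_le ((h k).1.sub hw).aemeasurable
      _ ≤ 2 * (ε / 4) + 2 * (ε / 4) := by gcongr
      _ = ε := h4
  · calc _ = ∫⁻ x in U, ENNReal.ofReal (quad (Q x) ((G k x - g x) + (gradient φ x - G k x))) := by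
          congr! 4; abel
      _ ≤ _ := lintegral_quad_add_le hQ hp ((h k).2.1.sub hg)
      _ ≤ 2 * (ε / 4) + 2 * (ε / 4) := by gcongr
      _ = ε := h4

end

/-! ### Norm bounds, product rule and chain rule in the completion. -/

section

variable {Q : E n → Mat n} {Ω U : Set (E n)} {u : E n → ℝ} {g : E n → E n}

theorem lintegral_sq_le_of_mem_LipQ {φ : E n → ℝ} (hφ : φ ∈ LipQ Q Ω)
    (hp : ∀ᵐ x ∂volume.restrict Ω, (Q x).PosSemidef) :
    ∫⁻ x in Ω, ENNReal.ofReal (φ x ^ 2) < ∞ ∧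
      ∫⁻ x in Ω, ENNReal.ofReal (quad (Q x) (gradient φ x)) < ∞ := by
  constructor
  · refine (lintegral_mono_ae ?_).trans_lt hφ.2
    filter_upwards [hp] with x hx
    exact ENNReal.ofReal_le_ofReal (le_add_of_nonneg_right (quad_nonneg hx _))
  · refine (lintegral_mono fun x => ?_).trans_lt hφ.2
    exact ENNReal.ofReal_le_ofReal (le_add_of_nonneg_left (sq_nonneg _))

theorem aestronglyMeasurable_of_mem_LipQ (hΩ : IsOpen Ω) {φ : E n → ℝ} (hφ : φ ∈ LipQ Q Ω) :
    AEStronglyMeasurable φ (volume.restrict Ω) := by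
  obtain ⟨L, hL⟩ := hφ.1
  exact hL.continuousOn.aestronglyMeasurable hΩ.measurableSet

theorem MemW.lintegral_sq_lt_top (h : MemW Q Ω u g) (hΩ : IsOpen Ω)
    (hp : ∀ᵐ x ∂volume.restrict Ω, (Q x).PosSemidef) :
    ∫⁻ x in Ω, ENNReal.ofReal (u x ^ 2) < ∞ := by
  obtain ⟨φ, hφ, h1, -⟩ := IsLimit.exists_le h one_ne_zero
  calc _ = ∫⁻ x in Ω, ENNReal.ofReal ((φ x + (u x - φ x)) ^ 2) := by congr! 4; ring
    _ ≤ 2 * (∫⁻ x in Ω, ENNReal.ofReal (φ x ^ 2)) +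
        2 * ∫⁻ x in Ω, ENNReal.ofReal ((u x - φ x) ^ 2) :=
      lintegral_sq_add_le (aestronglyMeasurable_of_mem_LipQ hΩ hφ).aemeasurable
    _ < ∞ := by
      simp_rw [sub_sq_comm (u _)]
      exact ENNReal.add_lt_top.2 ⟨ENNReal.mul_lt_top ENNReal.ofNat_lt_top
        (lintegral_sq_le_of_mem_LipQ hφ hp).1, ENNReal.mul_lt_top ENNReal.ofNat_lt_top
        (h1.trans_lt (by simp))⟩

theorem MemW.lintegral_quad_lt_top (h : MemW Q Ω u g)
    (hQ : ∀ i j, AEMeasurable (fun x => Q x i j) (volume.restrict Ω))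
    (hp : ∀ᵐ x ∂volume.restrict Ω, (Q x).PosSemidef) :
    ∫⁻ x in Ω, ENNReal.ofReal (quad (Q x) (g x)) < ∞ := by
  obtain ⟨φ, hφ, -, h1⟩ := IsLimit.exists_le h one_ne_zero
  calc _ = ∫⁻ x in Ω, ENNReal.ofReal (quad (Q x) (gradient φ x + (g x - gradient φ x))) := by
          congr! 4; abel
    _ ≤ 2 * (∫⁻ x in Ω, ENNReal.ofReal (quad (Q x) (gradient φ x))) +
        2 * ∫⁻ x in Ω, ENNReal.ofReal (quad (Q x) (g x - gradient φ x)) :=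
      lintegral_quad_add_le hQ hp (measurable_gradient φ).aestronglyMeasurable
    _ < ∞ := by
      simp_rw [quad_sub_comm _ (g _)]
      exact ENNReal.add_lt_top.2 ⟨ENNReal.mul_lt_top ENNReal.ofNat_lt_top
        (lintegral_sq_le_of_mem_LipQ hφ hp).2, ENNReal.mul_lt_top ENNReal.ofNat_lt_top
        (h1.trans_lt (by simp))⟩

/-- The approximating sequence may be taken to converge almost everywhere. -/
theorem MemW.exists_seq (h : MemW Q Ω u g) (hΩ : IsOpen Ω) :
    ∃ φ : ℕ → E n → ℝ, (∀ k, φ k ∈ LipQ Q Ω) ∧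
      Tendsto (fun k => ∫⁻ x in Ω, ENNReal.ofReal ((φ k x - u x) ^ 2)) atTop (𝓝 0) ∧
      Tendsto (fun k => ∫⁻ x in Ω, ENNReal.ofReal (quad (Q x) (gradient (φ k) x - g x)))
        atTop (𝓝 0) ∧
      ∀ᵐ x ∂volume.restrict Ω, Tendsto (fun k => φ k x) atTop (𝓝 (u x)) := by
  obtain ⟨hu, -, φ, hS, h1, h2⟩ := h
  have hm : TendstoInMeasure (volume.restrict Ω) φ atTop u := by
    refine tendstoInMeasure_of_tendsto_eLpNorm (p := 2) (by norm_num)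
      (fun k => aestronglyMeasurable_of_mem_LipQ hΩ (hS k)) hu ?_
    have h3 : ∀ k, eLpNorm (φ k - u) 2 (volume.restrict Ω) =
        (∫⁻ x in Ω, ENNReal.ofReal ((φ k x - u x) ^ 2)) ^ (1 / 2 : ℝ) := by
      intro k
      rw [eLpNorm_eq_lintegral_rpow_enorm_toReal (by norm_num) (by norm_num)]
      simp only [ENNReal.toReal_ofNat, Pi.sub_apply]
      congr! 3 with x
      rw [Real.enorm_eq_ofReal_abs, ENNReal.ofReal_rpow_of_nonneg (abs_nonneg _) (by norm_num)]
      norm_num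
    simp_rw [h3]
    have := (ENNReal.continuous_rpow_const (y := (1 / 2 : ℝ))).tendsto 0 |>.comp h1
    rw [ENNReal.zero_rpow_of_pos (by norm_num)] at this
    exact this
  obtain ⟨ns, hns, hae⟩ := hm.exists_seq_tendsto_ae
  exact ⟨fun k => φ (ns k), fun k => hS _, h1.comp hns.tendsto_atTop, h2.comp hns.tendsto_atTop,
    hae⟩

/-- The error in the product rule splits into three: the change of `F` against `∇ψ`, the error of
the approximating gradient against the bounded `F'`, and the change of `F'` against the fixed limit
gradient `g`. -/
theorem quad_gradient_mul_comp_sub_le {M : Mat n} (hM : M.PosSemidef) {a b p q s c : ℝ}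
    {C Γ : ℝ} {e d g : E n} (he : quad M e ≤ Γ) (hab : |a - b| ≤ C * |s|) (hp : |p| ≤ C)
    (hc : |c| ≤ 1) :
    quad M ((a • e + (c * p) • d) - (b • e + (c * q) • g)) ≤
      2 * (C ^ 2 * Γ * s ^ 2) + 2 * (2 * (C ^ 2 * quad M (d - g)) +
        2 * ((p - q) ^ 2 * quad M g)) := by
  have h1 : (a • e + (c * p) • d) - (b • e + (c * q) • g) =
      (a - b) • e + ((c * p) • (d - g) + (c * (p - q)) • g) := by module
  have hab2 : (a - b) ^ 2 ≤ C ^ 2 * s ^ 2 := by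
    rw [← sq_abs (a - b), ← sq_abs s, ← mul_pow]; gcongr
  have hc2 : c ^ 2 ≤ 1 := by rw [← sq_abs]; exact pow_le_one₀ (abs_nonneg _) hc
  have hp2 : p ^ 2 ≤ C ^ 2 := by rw [← sq_abs p]; gcongr
  have hΓ : 0 ≤ Γ := (quad_nonneg hM e).trans he
  have h2 := quad_nonneg hM (d - g)
  have h3 := quad_nonneg hM g
  rw [h1]
  refine (quad_add_le hM _ _).trans ?_
  refine add_le_add ?_ (mul_le_mul_of_nonneg_left ((quad_add_le hM _ _).trans
    (add_le_add ?_ ?_)) zero_le_two)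
  · rw [quad_smul]
    calc 2 * ((a - b) ^ 2 * quad M e) ≤ 2 * ((C ^ 2 * s ^ 2) * Γ) := by gcongr; exact quad_nonneg hM e
      _ = _ := by ring
  · rw [quad_smul, mul_pow]
    calc 2 * (c ^ 2 * p ^ 2 * quad M (d - g)) ≤ 2 * (1 * C ^ 2 * quad M (d - g)) := by gcongr
      _ = _ := by ring
  · rw [quad_smul, mul_pow]
    calc 2 * (c ^ 2 * (p - q) ^ 2 * quad M g) ≤ 2 * (1 * (p - q) ^ 2 * quad M g) := by gcongr
      _ = _ := by ring

theorem lintegral_combination {μ : Measure (E n)} {a b c : E n → ℝ≥0∞} {s t : ℝ≥0∞}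
    (ha : AEMeasurable a μ) (hb : AEMeasurable b μ) (hs : s ≠ ∞) (ht : t ≠ ∞) :
    ∫⁻ x, 2 * (s * a x) + 2 * (2 * (t * b x) + 2 * c x) ∂μ =
      2 * (s * ∫⁻ x, a x ∂μ) + 2 * (2 * (t * ∫⁻ x, b x ∂μ) + 2 * ∫⁻ x, c x ∂μ) := by
  rw [lintegral_add_left' ((ha.const_mul _).const_mul _), lintegral_const_mul' _ _ (by simp),
    lintegral_const_mul' _ _ hs, lintegral_const_mul' _ _ (by simp),
    lintegral_add_left' ((hb.const_mul _).const_mul _), lintegral_const_mul' _ _ (by simp),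
    lintegral_const_mul' _ _ ht, lintegral_const_mul' _ _ (by simp)]

theorem tendsto_const_mul_zero {c : ℝ≥0∞} (hc : c ≠ ∞) {e : ℕ → ℝ≥0∞}
    (h : Tendsto e atTop (𝓝 0)) : Tendsto (fun k => c * e k) atTop (𝓝 0) := by
  have := ENNReal.Tendsto.const_mul h (Or.inr hc)
  rwa [mul_zero] at this

set_option maxHeartbeats 1000000 in
/-- Product and chain rule in the degenerate Sobolev spaces. -/
theorem MemW.mul_comp (h : MemW Q Ω u g) (hΩ : IsOpen Ω) (hUΩ : U ⊆ Ω)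
    (hQ : ∀ i j, AEMeasurable (fun x => Q x i j) (volume.restrict Ω))
    (hp : ∀ᵐ x ∂volume.restrict Ω, (Q x).PosSemidef) {ψ : E n → ℝ} {L : NNReal}
    (hψ : LipschitzWith L ψ) (hψ1 : ∀ x, |ψ x| ≤ 1) {Γ : ℝ}
    (hΓ : ∀ᵐ x ∂volume.restrict Ω, quad (Q x) (gradient ψ x) ≤ Γ) {F F' : ℝ → ℝ} {C : ℝ}
    (hF : ∀ t, HasDerivAt F (F' t) t) (hF'c : Continuous F') (hb : ∀ t, |F' t| ≤ C)
    {S : Set (E n → ℝ)} (hS : ∀ φ ∈ LipQ Q Ω, (fun x => ψ x * F (φ x)) ∈ S) :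
    IsLimit Q U S (fun x => ψ x * F (u x))
      (fun x => F (u x) • gradient ψ x + (ψ x * F' (u x)) • g x) := by
  have hC : 0 ≤ C := (abs_nonneg _).trans (hb 0)
  have hFl := lipschitzWith_of_hasDerivAt hC hF hb
  have hFc : Continuous F := hFl.continuous
  have hUle : volume.restrict U ≤ volume.restrict Ω := Measure.restrict_mono hUΩ le_rfl
  have hFu : AEStronglyMeasurable (fun x => F (u x)) (volume.restrict Ω) :=
    hFc.comp_aestronglyMeasurable h.1
  have hF'u : AEStronglyMeasurable (fun x => F' (u x)) (volume.restrict Ω) :=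
    hF'c.comp_aestronglyMeasurable h.1
  have hψm : AEStronglyMeasurable ψ (volume.restrict Ω) := hψ.continuous.aestronglyMeasurable
  have hFd : ∀ s t, |F s - F t| ≤ C * |s - t| := fun s t => by
    have := hFl.dist_le_mul s t
    rwa [Real.dist_eq, Real.dist_eq] at this
  obtain ⟨φ, hφ, h1, h2, hae⟩ := h.exists_seq hΩ
  refine ⟨(hψm.mul hFu).mono_measure hUle, (((hFu.smul
    (measurable_gradient ψ).aestronglyMeasurable)).add ((hψm.mul hF'u).smul h.2.1)).mono_measure
    hUle, fun k x => ψ x * F (φ k x), fun k => hS _ (hφ k), ?_, ?_⟩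
  · have h3 : ∀ k, ∫⁻ x in U, ENNReal.ofReal ((ψ x * F (φ k x) - ψ x * F (u x)) ^ 2) ≤
        ENNReal.ofReal (C ^ 2) * ∫⁻ x in Ω, ENNReal.ofReal ((φ k x - u x) ^ 2) := by
      intro k
      rw [← lintegral_const_mul' _ _ (by finiteness)]
      refine (lintegral_mono' hUle le_rfl).trans (lintegral_mono fun x => ?_)
      rw [← ENNReal.ofReal_mul (sq_nonneg _), ← mul_sub]
      refine ENNReal.ofReal_le_ofReal ?_
      rw [← sq_abs, abs_mul, ← sq_abs (φ k x - u x), ← mul_pow]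
      refine pow_le_pow_left₀ (by positivity) ?_ 2
      calc |ψ x| * |F (φ k x) - F (u x)| ≤ 1 * (C * |φ k x - u x|) := by
            gcongr
            · exact hψ1 x
            · exact hFd _ _
        _ = _ := one_mul _
    refine tendsto_of_tendsto_of_tendsto_of_le_of_le tendsto_const_nhds ?_ (fun _ => bot_le) h3
    simpa using ENNReal.Tendsto.const_mul h1 (Or.inr (by finiteness))
  · have hg := h.lintegral_quad_lt_top hQ hp
    set e1 : ℕ → ℝ≥0∞ := fun k => ∫⁻ x in Ω, ENNReal.ofReal ((φ k x - u x) ^ 2) with he1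
    set e2 : ℕ → ℝ≥0∞ := fun k => ∫⁻ x in Ω,
      ENNReal.ofReal (quad (Q x) (gradient (φ k) x - g x)) with he2
    set e3 : ℕ → ℝ≥0∞ := fun k => ∫⁻ x in Ω,
      ENNReal.ofReal ((F' (φ k x) - F' (u x)) ^ 2 * quad (Q x) (g x)) with he3
    have hqg := aemeasurable_quad hQ h.2.1
    have hφm : ∀ k, AEStronglyMeasurable (φ k) (volume.restrict Ω) := fun k =>
      aestronglyMeasurable_of_mem_LipQ hΩ (hφ k)
    -- Since `F'` is merely continuous and bounded, `L²` convergence of `φ k` does not control this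
    -- term; almost everywhere convergence and domination by `(2C)² [g]_Q²` do.
    have h3 : Tendsto e3 atTop (𝓝 0) := by
      have := tendsto_lintegral_of_dominated_convergence' (μ := volume.restrict Ω)
        (F := fun k x => ENNReal.ofReal ((F' (φ k x) - F' (u x)) ^ 2 * quad (Q x) (g x)))
        (f := fun _ => 0) (fun x => ENNReal.ofReal ((2 * C) ^ 2) * ENNReal.ofReal (quad (Q x) (g x)))
        (fun k => ((((hF'c.comp_aestronglyMeasurable (hφm k)).sub hF'u).aemeasurable.pow_const
          2).mul hqg).ennreal_ofReal) ?_ ?_ ?_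
      · simpa using this
      · intro k
        filter_upwards [hp] with x hx
        rw [← ENNReal.ofReal_mul (sq_nonneg _)]
        refine ENNReal.ofReal_le_ofReal (mul_le_mul_of_nonneg_right ?_ (quad_nonneg hx _))
        rw [← sq_abs]
        gcongr
        calc |F' (φ k x) - F' (u x)| ≤ |F' (φ k x)| + |F' (u x)| := abs_sub _ _
          _ ≤ C + C := add_le_add (hb _) (hb _)
          _ = 2 * C := by ring
      · rw [lintegral_const_mul' _ _ (by finiteness)]
        exact (ENNReal.mul_lt_top (by finiteness) hg).ne
      · filter_upwards [hae] with x hx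
        have h4 : Tendsto (fun k => (F' (φ k x) - F' (u x)) ^ 2 * quad (Q x) (g x)) atTop
            (𝓝 ((F' (u x) - F' (u x)) ^ 2 * quad (Q x) (g x))) :=
          (((hF'c.tendsto _).comp hx).sub tendsto_const_nhds).pow 2 |>.mul tendsto_const_nhds
        simpa using ENNReal.tendsto_ofReal h4
    have h4 : ∀ k, ∫⁻ x in U, ENNReal.ofReal (quad (Q x) (gradient (fun x => ψ x * F (φ k x)) x -
        (F (u x) • gradient ψ x + (ψ x * F' (u x)) • g x))) ≤
        2 * (ENNReal.ofReal (C ^ 2 * Γ) * e1 k) + 2 * (2 * (ENNReal.ofReal (C ^ 2) * e2 k) +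
          2 * e3 k) := by
      intro k
      obtain ⟨K, hK⟩ := (hφ k).1
      have hm1 : AEMeasurable (fun x => ENNReal.ofReal ((φ k x - u x) ^ 2))
          (volume.restrict Ω) := (((hφm k).sub h.1).aemeasurable.pow_const 2).ennreal_ofReal
      have hm2 : AEMeasurable (fun x => ENNReal.ofReal (quad (Q x) (gradient (φ k) x - g x)))
          (volume.restrict Ω) := (aemeasurable_quad hQ
        ((measurable_gradient _).aestronglyMeasurable.sub h.2.1)).ennreal_ofReal
      rw [he1, he2, he3]
      dsimp only
      rw [← lintegral_combination hm1 hm2 ENNReal.ofReal_ne_top ENNReal.ofReal_ne_top]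
      refine (lintegral_mono' hUle le_rfl).trans (lintegral_mono_ae ?_)
      filter_upwards [hp, hΓ, ae_hasGradientAt hΩ hK,
        ae_hasGradientAt hΩ (hψ.lipschitzOnWith (s := Ω))] with x hx hxΓ hx1 hx2
      have hgr : gradient (fun x => ψ x * F (φ k x)) x =
          F (φ k x) • gradient ψ x + (ψ x * F' (φ k x)) • gradient (φ k) x := by
        rw [(hasGradientAt_mul hx2 (hasGradientAt_comp (hF (φ k x)) hx1)).gradient]
        module
      have hΓ0 : 0 ≤ Γ := (quad_nonneg hx _).trans hxΓ
      have hq1 := quad_nonneg hx (gradient (φ k) x - g x)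
      have hq2 := quad_nonneg hx (g x)
      rw [hgr, ← ENNReal.ofReal_mul (by positivity), ← ENNReal.ofReal_mul (by positivity)]
      refine (ENNReal.ofReal_le_ofReal (quad_gradient_mul_comp_sub_le hx hxΓ (hFd _ _) (hb _)
        (hψ1 x))).trans ?_
      refine (ofReal_le_two_mul_add le_rfl (by positivity) (by positivity)).trans ?_
      refine add_le_add le_rfl (mul_le_mul_right ?_ _)
      exact ofReal_le_two_mul_add le_rfl (by positivity) (by positivity)
    refine tendsto_of_tendsto_of_tendsto_of_le_of_le tendsto_const_nhds ?_ (fun _ => bot_le) h4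
    have t1 := tendsto_const_mul_zero (c := 2) (by finiteness)
      (tendsto_const_mul_zero (c := ENNReal.ofReal (C ^ 2 * Γ)) (by finiteness) h1)
    have t2 := tendsto_const_mul_zero (c := 2) (by finiteness)
      (tendsto_const_mul_zero (c := ENNReal.ofReal (C ^ 2)) (by finiteness) h2)
    have t3 := tendsto_const_mul_zero (c := 2) (by finiteness) h3
    have t4 := t2.add t3
    rw [add_zero] at t4
    have t5 := t1.add (tendsto_const_mul_zero (c := 2) (by finiteness) t4)
    rwa [add_zero] at t5

end
end Degenerate

namespace Degenerate

variable {n : ℕ} {Q : E n → Mat n} {Ω U : Set (E n)} {u : E n → ℝ} {g : E n → E n}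

theorem sq_add_quad_mul_comp_le {M : Mat n} (hM : M.PosSemidef) {a b c p C Γ t : ℝ} {e d : E n}
    (he : quad M e ≤ Γ) (ha : |a| ≤ |b| + C * |t|) (hp : |p| ≤ C) (hc : |c| ≤ 1) :
    (c * a) ^ 2 + quad M (a • e + (c * p) • d) ≤
      (1 + 2 * Γ) * (2 * b ^ 2) + (1 + 2 * Γ + 1) * (2 * C ^ 2) * (t ^ 2 + quad M d) := by
  have hΓ : 0 ≤ Γ := (quad_nonneg hM e).trans he
  have hC : 0 ≤ C := (abs_nonneg _).trans hp
  have hd := quad_nonneg hM d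
  have hc2 : c ^ 2 ≤ 1 := by rw [← sq_abs]; exact pow_le_one₀ (abs_nonneg _) hc
  have hp2 : p ^ 2 ≤ C ^ 2 := by rw [← sq_abs p]; gcongr
  have ha2 : a ^ 2 ≤ 2 * b ^ 2 + 2 * C ^ 2 * t ^ 2 := by
    rw [← sq_abs a, ← sq_abs b, ← sq_abs t]
    calc |a| ^ 2 ≤ (|b| + C * |t|) ^ 2 := by gcongr
      _ ≤ _ := by nlinarith [sq_nonneg (|b| - C * |t|)]
  have h1 := quad_add_le hM (a • e) ((c * p) • d)
  rw [quad_smul, quad_smul, mul_pow] at h1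
  have h2 : (c * a) ^ 2 ≤ a ^ 2 := by
    rw [mul_pow]; exact mul_le_of_le_one_left (sq_nonneg _) hc2
  have h3 : a ^ 2 * quad M e ≤ a ^ 2 * Γ := by gcongr
  have h4 : c ^ 2 * p ^ 2 * quad M d ≤ C ^ 2 * quad M d := by
    gcongr
    calc c ^ 2 * p ^ 2 ≤ 1 * C ^ 2 := by gcongr
      _ = _ := one_mul _
  have h5 : (1 + 2 * Γ) * a ^ 2 ≤ (1 + 2 * Γ) * (2 * b ^ 2 + 2 * C ^ 2 * t ^ 2) := by gcongr
  have h6 : 0 ≤ C ^ 2 * t ^ 2 := by positivity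
  have h7 : 0 ≤ Γ * (C ^ 2 * quad M d) := by positivity
  nlinarith

/-- `F` grows at most linearly, but `F 0` may be nonzero; its contribution is a constant, integrable
because `Ω` has finite volume. -/
theorem lintegral_mul_comp_lt_top (hΩ : IsOpen Ω) (hfin : volume Ω < ∞) (hUΩ : U ⊆ Ω)
    (hp : ∀ᵐ x ∂volume.restrict Ω, (Q x).PosSemidef) {ψ : E n → ℝ} {L : NNReal}
    (hψ : LipschitzWith L ψ) (hψ1 : ∀ x, |ψ x| ≤ 1) {Γ : ℝ}
    (hΓ : ∀ᵐ x ∂volume.restrict Ω, quad (Q x) (gradient ψ x) ≤ Γ) {F F' : ℝ → ℝ} {C : ℝ}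
    (hF : ∀ t, HasDerivAt F (F' t) t) (hb : ∀ t, |F' t| ≤ C) {φ : E n → ℝ} (hφ : φ ∈ LipQ Q Ω) :
    ∫⁻ x in U, ENNReal.ofReal ((ψ x * F (φ x)) ^ 2 +
      quad (Q x) (gradient (fun x => ψ x * F (φ x)) x)) < ∞ := by
  have hC : 0 ≤ C := (abs_nonneg _).trans (hb 0)
  have hFl := lipschitzWith_of_hasDerivAt hC hF hb
  obtain ⟨K, hK⟩ := hφ.1
  have hm : ∫⁻ x in U, ENNReal.ofReal ((ψ x * F (φ x)) ^ 2 +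
      quad (Q x) (gradient (fun x => ψ x * F (φ x)) x)) ≤
      ∫⁻ x in Ω, (ENNReal.ofReal ((1 + 2 * Γ) * (2 * F 0 ^ 2)) +
        ENNReal.ofReal ((1 + 2 * Γ + 1) * (2 * C ^ 2)) *
          ENNReal.ofReal (φ x ^ 2 + quad (Q x) (gradient φ x))) := by
    refine (lintegral_mono' (Measure.restrict_mono hUΩ le_rfl) le_rfl).trans
      (lintegral_mono_ae ?_)
    filter_upwards [hp, hΓ, ae_hasGradientAt hΩ hK,
      ae_hasGradientAt hΩ (hψ.lipschitzOnWith (s := Ω))] with x hx hxΓ hx1 hx2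
    have hgr : gradient (fun x => ψ x * F (φ x)) x =
        F (φ x) • gradient ψ x + (ψ x * F' (φ x)) • gradient φ x := by
      rw [(hasGradientAt_mul hx2 (hasGradientAt_comp (hF (φ x)) hx1)).gradient]
      module
    have hΓ0 : 0 ≤ Γ := (quad_nonneg hx _).trans hxΓ
    have hq := quad_nonneg hx (gradient φ x)
    rw [← ENNReal.ofReal_mul (by positivity), ← ENNReal.ofReal_add (by positivity) (by positivity),
      hgr]
    refine ENNReal.ofReal_le_ofReal (sq_add_quad_mul_comp_le hx hxΓ ?_ (hb _) (hψ1 x))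
    have h1 := hFl.dist_le_mul (φ x) 0
    rw [Real.dist_eq, Real.dist_eq, sub_zero] at h1
    have h2 := abs_sub_abs_le_abs_sub (F (φ x)) (F 0)
    change _ ≤ C * _ at h1
    linarith
  refine hm.trans_lt ?_
  rw [lintegral_add_left measurable_const, lintegral_const, lintegral_const_mul' _ _ (by finiteness),
    Measure.restrict_apply_univ]
  exact ENNReal.add_lt_top.2 ⟨ENNReal.mul_lt_top (by finiteness) hfin,
    ENNReal.mul_lt_top (by finiteness) hφ.2⟩

theorem quad_gradient_one (M : Mat n) (x : E n) : quad M (gradient (fun _ => (1 : ℝ)) x) = 0 := by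
  simp [gradient]

/-- Chain rule in `𝒲^{1,2}_Q(Ω)`. -/
theorem MemW.comp (h : MemW Q Ω u g) (hΩ : IsOpen Ω) (hfin : volume Ω < ∞)
    (hQ : ∀ i j, AEMeasurable (fun x => Q x i j) (volume.restrict Ω))
    (hp : ∀ᵐ x ∂volume.restrict Ω, (Q x).PosSemidef) {F F' : ℝ → ℝ} {C : ℝ}
    (hF : ∀ t, HasDerivAt F (F' t) t) (hF'c : Continuous F') (hb : ∀ t, |F' t| ≤ C) :
    MemW Q Ω (fun x => F (u x)) (fun x => F' (u x) • g x) := by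
  have hC : 0 ≤ C := (abs_nonneg _).trans (hb 0)
  have h1 : LipschitzWith 0 fun _ : E n => (1 : ℝ) := LipschitzWith.const 1
  have hΓ : ∀ᵐ x ∂volume.restrict Ω, quad (Q x) (gradient (fun _ => (1 : ℝ)) x) ≤ 0 :=
    ae_of_all _ fun x => (quad_gradient_one _ _).le
  have key := MemW.mul_comp (S := LipQ Q Ω) h hΩ subset_rfl hQ hp h1 (fun _ => by simp) hΓ hF
    hF'c hb fun φ hφ => ⟨?_, lintegral_mul_comp_lt_top hΩ hfin subset_rfl hp h1 (fun _ => by simp)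
      hΓ hF hb hφ⟩
  · unfold MemW
    simpa [gradient] using key
  · obtain ⟨K, hK⟩ := hφ.1
    refine ⟨⟨C, hC⟩ * K, ?_⟩
    · simp only [one_mul]
      exact (lipschitzWith_of_hasDerivAt hC hF hb).comp_lipschitzOnWith hK

/-- `φ` is Lipschitz on `Ω` only. Replacing it by a Lipschitz extension to the whole space leaves
the product unchanged, because `ψ` vanishes off `U ⊆ Ω`. -/
theorem mul_comp_mem_LipC (hUΩ : U ⊆ Ω) {ψ : E n → ℝ} (hψ : ψ ∈ LipC U) {F : ℝ → ℝ} {K : NNReal}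
    (hF : LipschitzWith K F) {φ : E n → ℝ} (hφ : φ ∈ LipQ Q Ω) :
    (fun x => ψ x * F (φ x)) ∈ LipC U := by
  obtain ⟨⟨L, hL⟩, hs, hsU⟩ := hψ
  obtain ⟨K', hK'⟩ := hφ.1
  obtain ⟨φ', hφ', heq⟩ := hK'.extend_real
  have h1 : (fun x => ψ x * F (φ x)) = fun x => ψ x * F (φ' x) := by
    funext x
    by_cases hx : x ∈ Ω
    · rw [heq hx]
    · rw [image_eq_zero_of_notMem_tsupport fun h => hx (hUΩ (hsU h)), zero_mul, zero_mul]
  refine ⟨?_, hs.mul_right, (tsupport_mul_subset_left).trans hsU⟩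
  rw [h1]
  exact LipschitzWith.mul_of_hasCompactSupport hL hs (hF.comp hφ')

/-- Product and chain rule: elements of `(𝒲^{1,2}_Q)₀(U)`. -/
theorem MemW.memW0_mul_comp (h : MemW Q Ω u g) (hΩ : IsOpen Ω) (hfin : volume Ω < ∞)
    (hUΩ : U ⊆ Ω) (hQ : ∀ i j, AEMeasurable (fun x => Q x i j) (volume.restrict Ω))
    (hp : ∀ᵐ x ∂volume.restrict Ω, (Q x).PosSemidef) {ψ : E n → ℝ} (hψ : ψ ∈ LipC U)
    (hψ1 : ∀ x, |ψ x| ≤ 1) {Γ : ℝ}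
    (hΓ : ∀ᵐ x ∂volume.restrict Ω, quad (Q x) (gradient ψ x) ≤ Γ) {F F' : ℝ → ℝ} {C : ℝ}
    (hF : ∀ t, HasDerivAt F (F' t) t) (hF'c : Continuous F') (hb : ∀ t, |F' t| ≤ C) :
    MemW0 Q U (fun x => ψ x * F (u x))
      (fun x => F (u x) • gradient ψ x + (ψ x * F' (u x)) • g x) := by
  have hC : 0 ≤ C := (abs_nonneg _).trans (hb 0)
  obtain ⟨L, hL⟩ := hψ.1
  refine h.mul_comp hΩ hUΩ hQ hp hL hψ1 hΓ hF hF'c hb fun φ hφ => ?_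
  have h1 := mul_comp_mem_LipC hUΩ hψ (lipschitzWith_of_hasDerivAt hC hF hb) hφ
  obtain ⟨K, hK⟩ := h1.1
  exact ⟨h1, ⟨K, hK.lipschitzOnWith⟩, lintegral_mul_comp_lt_top hΩ hfin hUΩ hp hL hψ1 hΓ hF hb hφ⟩

/-! ### The regularized gradient -/

/-- Gradients in the degenerate space are not assumed unique, so that `∇u` may be set to zero on a
level set has to be proved as membership of a new pair. The pair is reached through smooth functions
converging uniformly to the identity whose derivatives vanish at `c` and tend to `1` elsewhere. -/
theorem MemW.indicator_compl_singleton (h : MemW Q Ω u g) (hΩ : IsOpen Ω) (hfin : volume Ω < ∞)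
    (hQ : ∀ i j, AEMeasurable (fun x => Q x i j) (volume.restrict Ω))
    (hp : ∀ᵐ x ∂volume.restrict Ω, (Q x).PosSemidef) (c : ℝ) :
    MemW Q Ω u (indicator {x | u x ≠ c} g) := by
  -- The arctangent correction is `O(1/(j+1))` uniformly, yet has slope exactly `1` at `c`, so `F j
  -- → id` while `F' j → 1_{t ≠ c}` with `0 ≤ F' j ≤ 1`.
  set F : ℕ → ℝ → ℝ := fun j t => t - Real.arctan ((j + 1 : ℝ) * (t - c)) / (j + 1 : ℝ) with hF
  set F' : ℕ → ℝ → ℝ := fun j t => 1 - 1 / (1 + ((j + 1 : ℝ) * (t - c)) ^ 2) with hF'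
  have hder : ∀ j t, HasDerivAt (F j) (F' j t) t := by
    intro j t
    have hj : (j + 1 : ℝ) ≠ 0 := by positivity
    have h1 := (hasDerivAt_id t).sub ((((hasDerivAt_id t).sub_const c).const_mul
      (j + 1 : ℝ)).arctan.div_const (j + 1 : ℝ))
    refine h1.congr_deriv ?_
    simp only [hF', id]
    field_simp
  have hcont : ∀ j, Continuous (F' j) := fun j => by
    refine continuous_const.sub (continuous_const.div (by fun_prop) fun t => ?_)
    positivity
  have h01 : ∀ j t, 0 ≤ F' j t ∧ F' j t ≤ 1 := by
    intro j t
    have h1 : 1 / (1 + ((j + 1 : ℝ) * (t - c)) ^ 2) ≤ 1 := by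
      rw [div_le_one (by positivity)]; nlinarith [sq_nonneg ((j + 1 : ℝ) * (t - c))]
    have h2 : 0 ≤ 1 / (1 + ((j + 1 : ℝ) * (t - c)) ^ 2) := by positivity
    exact ⟨by simp only [hF']; linarith, by simp only [hF']; linarith⟩
  have hlim := tendsto_one_div_add_atTop_nhds_zero_nat (𝕜 := ℝ)
  have hmeas : NullMeasurableSet {x | u x ≠ c} (volume.restrict Ω) :=
    h.1.aemeasurable.nullMeasurable (measurableSet_singleton c).compl
  have hg := h.lintegral_quad_lt_top hQ hp
  have hind : AEStronglyMeasurable (indicator {x | u x ≠ c} g) (volume.restrict Ω) :=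
    h.2.1.indicator₀ hmeas
  refine IsLimit.of_tendsto hQ hp (W := fun j x => F j (u x)) (G := fun j x => F' j (u x) • g x)
    (fun j => h.comp hΩ hfin hQ hp (hder j) (hcont j) (C := 1) fun t => ?_) h.1
    hind ?_ ?_
  · rw [abs_of_nonneg (h01 j t).1]; exact (h01 j t).2
  · have h3 : ∀ j : ℕ, ∫⁻ x in Ω, ENNReal.ofReal ((F j (u x) - u x) ^ 2) ≤
        ENNReal.ofReal ((2 * (1 / ((j : ℝ) + 1))) ^ 2) * volume Ω := by
      intro j
      rw [← Measure.restrict_apply_univ Ω, ← lintegral_const]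
      refine lintegral_mono fun x => ENNReal.ofReal_le_ofReal ?_
      rw [← sq_abs]
      refine pow_le_pow_left₀ (abs_nonneg _) ?_ 2
      have h4 : |Real.arctan ((j + 1 : ℝ) * (u x - c))| ≤ 2 := by
        have := Real.arctan_lt_pi_div_two ((j + 1 : ℝ) * (u x - c))
        have := Real.neg_pi_div_two_lt_arctan ((j + 1 : ℝ) * (u x - c))
        have := Real.pi_lt_four
        rw [abs_le]; constructor <;> linarith
      simp only [hF]
      rw [sub_sub_cancel_left, abs_neg, abs_div, abs_of_pos (by positivity : (0 : ℝ) < j + 1),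
        mul_one_div]
      gcongr
    refine tendsto_of_tendsto_of_tendsto_of_le_of_le tendsto_const_nhds ?_ (fun _ => bot_le) h3
    have h5 : Tendsto (fun j : ℕ => ENNReal.ofReal ((2 * (1 / ((j : ℝ) + 1))) ^ 2)) atTop (𝓝 0) := by
      have := ENNReal.tendsto_ofReal ((hlim.const_mul 2).pow 2)
      simpa using this
    have h6 := ENNReal.Tendsto.mul_const h5 (Or.inr hfin.ne)
    rwa [zero_mul] at h6
  · have := tendsto_lintegral_of_dominated_convergence' (μ := volume.restrict Ω)
        (F := fun (j : ℕ) x => ENNReal.ofReal (quad (Q x) (F' j (u x) • g x -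
          indicator {x | u x ≠ c} g x)))
        (f := fun _ => 0) (fun x => ENNReal.ofReal (quad (Q x) (g x)))
        (fun k => (aemeasurable_quad hQ ((((hcont k).comp_aestronglyMeasurable h.1).smul
          h.2.1).sub hind)).ennreal_ofReal) ?_ hg.ne ?_
    · simpa using this
    · intro j
      filter_upwards [hp] with x hx
      refine ENNReal.ofReal_le_ofReal ?_
      have hq := quad_nonneg hx (g x)
      have h1 := h01 j (u x)
      by_cases hxc : u x = c
      · have h2 : x ∉ {x | u x ≠ c} := by simpa using hxc
        rw [indicator_of_notMem h2, sub_zero, quad_smul]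
        exact mul_le_of_le_one_left hq (pow_le_one₀ h1.1 h1.2)
      · have h2 : x ∈ {x | u x ≠ c} := hxc
        rw [indicator_of_mem h2, show F' j (u x) • g x - g x = (F' j (u x) - 1) • g x by module,
          quad_smul]
        refine mul_le_of_le_one_left hq ?_
        nlinarith
    · filter_upwards with x
      by_cases hxc : u x = c
      · have h2 : x ∉ {x | u x ≠ c} := by simpa using hxc
        have h3 : ∀ j, F' j (u x) = 0 := fun j => by simp [hF', hxc]
        simp [indicator_of_notMem h2, h3]
      · have h2 : x ∈ {x | u x ≠ c} := hxc
        have h3 : ∀ j, quad (Q x) (F' j (u x) • g x - indicator {x | u x ≠ c} g x) =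
            (1 / (1 + ((j + 1 : ℝ) * (u x - c)) ^ 2)) ^ 2 * quad (Q x) (g x) := by
          intro j
          rw [indicator_of_mem h2, show F' j (u x) • g x - g x = (F' j (u x) - 1) • g x by module,
            quad_smul]
          simp only [hF']; ring
        have hne : u x - c ≠ 0 := sub_ne_zero.2 hxc
        have h4 : Tendsto (fun j : ℕ => 1 / (1 + ((j + 1 : ℝ) * (u x - c)) ^ 2)) atTop (𝓝 0) := by
          refine (tendsto_const_nhds (x := (1 : ℝ))).div_atTop ?_
          refine tendsto_atTop_add_const_left _ _ ?_
          simp_rw [mul_pow]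
          refine Tendsto.atTop_mul_const (by positivity) ?_
          exact (tendsto_pow_atTop two_ne_zero).comp
            (tendsto_atTop_add_const_right _ _ tendsto_natCast_atTop_atTop)
        simp_rw [h3]
        have h5 := ENNReal.tendsto_ofReal ((h4.pow 2).mul_const (quad (Q x) (g x)))
        simpa using h5

theorem MemW.indicator_compl_finset (h : MemW Q Ω u g) (hΩ : IsOpen Ω) (hfin : volume Ω < ∞)
    (hQ : ∀ i j, AEMeasurable (fun x => Q x i j) (volume.restrict Ω))
    (hp : ∀ᵐ x ∂volume.restrict Ω, (Q x).PosSemidef) (s : Finset ℝ) :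
    MemW Q Ω u (indicator {x | u x ∉ s} g) := by
  classical
  induction s using Finset.induction_on with
  | empty => simpa using h
  | insert c s _ ih =>
    have := ih.indicator_compl_singleton hΩ hfin hQ hp c
    rw [indicator_indicator] at this
    convert this using 3
    ext x; simp

theorem MemW.indicator_compl_countable (h : MemW Q Ω u g) (hΩ : IsOpen Ω) (hfin : volume Ω < ∞)
    (hQ : ∀ i j, AEMeasurable (fun x => Q x i j) (volume.restrict Ω))
    (hp : ∀ᵐ x ∂volume.restrict Ω, (Q x).PosSemidef) {D : Set ℝ} (hD : D.Countable) :
    MemW Q Ω u (indicator {x | u x ∉ D} g) := by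
  classical
  rcases D.eq_empty_or_nonempty with rfl | hne
  · simpa using h
  obtain ⟨c, rfl⟩ := hD.exists_eq_range hne
  have hg := h.lintegral_quad_lt_top hQ hp
  have hmeas : NullMeasurableSet {x | u x ∉ range c} (volume.restrict Ω) :=
    h.1.aemeasurable.nullMeasurable (countable_range c).measurableSet.compl
  have hind := h.2.1.indicator₀ hmeas
  set s : ℕ → Finset ℝ := fun k => (Finset.range k).image c
  have hs := fun k => h.indicator_compl_finset hΩ hfin hQ hp (s k)
  refine IsLimit.of_tendsto hQ hp hs h.1 hind (by simp) ?_
  have := tendsto_lintegral_of_dominated_convergence' (μ := volume.restrict Ω)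
        (F := fun (j : ℕ) x => ENNReal.ofReal (quad (Q x) (indicator {x | u x ∉ s j} g x -
          indicator {x | u x ∉ range c} g x)))
        (f := fun _ => 0) (fun x => ENNReal.ofReal (quad (Q x) (g x)))
        (fun k => (aemeasurable_quad hQ ((hs k).2.1.sub hind)).ennreal_ofReal) ?_ hg.ne ?_
  · simpa using this
  · intro j
    filter_upwards [hp] with x hx
    refine ENNReal.ofReal_le_ofReal ?_
    have hq := quad_nonneg hx (g x)
    by_cases h1 : x ∈ {x | u x ∉ s j} <;> by_cases h2 : x ∈ {x | u x ∉ range c} <;>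
      simp only [indicator_of_mem, indicator_of_notMem, h1, h2, not_false_iff, sub_self, sub_zero,
        zero_sub, quad_neg, quad_zero, hq, le_refl]
  · filter_upwards with x
    refine tendsto_const_nhds.congr' ?_
    by_cases h2 : u x ∈ range c
    · obtain ⟨i, hi⟩ := h2
      filter_upwards [eventually_gt_atTop i] with j hj
      have h1 : x ∉ {x | u x ∉ s j} := by
        simpa [s] using ⟨i, hj, hi⟩
      have h2 : x ∉ {x | u x ∉ range c} := by simpa using ⟨i, hi⟩
      rw [indicator_of_notMem h1, indicator_of_notMem h2]; simp
    · filter_upwards with j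
      have h1 : x ∈ {x | u x ∉ s j} := by
        simp only [s, Finset.mem_image, mem_ofPred_eq]
        rintro ⟨i, -, hi⟩
        exact h2 ⟨i, hi⟩
      rw [indicator_of_mem h1, indicator_of_mem (show x ∈ {x | u x ∉ range c} from h2)]; simp

/-- In a finite measure space only countably many level sets have positive measure, so the
regularized gradient arises from `g` by removing countably many levels. -/
theorem MemW.regGrad (h : MemW Q Ω u g) (hΩ : IsOpen Ω) (hfin : volume Ω < ∞)
    (hQ : ∀ i j, AEMeasurable (fun x => Q x i j) (volume.restrict Ω))
    (hp : ∀ᵐ x ∂volume.restrict Ω, (Q x).PosSemidef) :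
    MemW Q Ω u (regGrad Ω u g) := by
  have hc : {t : ℝ | 0 < (volume.restrict Ω) {z | u z = t}}.Countable := by
    have : IsFiniteMeasure (volume.restrict Ω) := ⟨by simpa using hfin⟩
    exact Measure.countable_meas_level_set_pos₀ h.1.aemeasurable.nullMeasurable
  have := h.indicator_compl_countable hΩ hfin hQ hp hc
  convert this using 1
  unfold Degenerate.regGrad
  congr 1
  ext x
  have h1 : (volume.restrict Ω) {z | u z = u x} = volume (Ω ∩ {z | u z = u x}) := by
    rw [Measure.restrict_apply' hΩ.measurableSet, inter_comm]
  simp [h1]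

end Degenerate

namespace Degenerate

variable {n : ℕ} {Q : E n → Mat n} {Ω U : Set (E n)} {u : E n → ℝ} {g : E n → E n}

/-! ### Metric balls -/

theorem dball_subset {d : E n → E n → ℝ} {y : E n} {r : ℝ} : dball d Ω y r ⊆ Ω := fun _ h => h.1

theorem isOpen_dball {d : E n → E n → ℝ} (hd : IsMetricOn d Ω) (hc : Containment d Ω) {y : E n}
    (hy : y ∈ Ω) (r : ℝ) : IsOpen (dball d Ω y r) := by
  rw [Metric.isOpen_iff]
  intro z hz
  obtain ⟨α, -, hα⟩ := hc z hz.1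
  obtain ⟨h1, h2⟩ := hα (r - d y z) (sub_pos.2 hz.2)
  refine ⟨_, h1, fun x hx => ?_⟩
  obtain ⟨hx1, hx2⟩ := h2 hx
  exact ⟨hx1, (hd.triangle y hy z hz.1 x hx1).trans_lt (by linarith)⟩

theorem self_mem_dball {d : E n → E n → ℝ} (hd : IsMetricOn d Ω) {y : E n}
    (hy : y ∈ Ω) {r : ℝ} (hr : 0 < r) : y ∈ dball d Ω y r :=
  ⟨hy, by rwa [(hd.eq_zero_iff y hy y hy).2 rfl]⟩

/-- The distance to an empty set is `0` by convention, so admissibility of a positive radius forces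
a boundary point, which the open set `Ω` does not contain. -/
theorem Admits.compl_nonempty {η : ℝ} {y : E n} {r : ℝ} (h : Admits Ω η y r) (hΩ : IsOpen Ω) :
    Ωᶜ.Nonempty := by
  rcases (frontier Ω).eq_empty_or_nonempty with h0 | ⟨z, hz⟩
  · have := h.2.1.trans h.2.2
    simp [h0, Metric.infDist_empty] at this
  · exact ⟨z, by rw [hΩ.frontier_eq] at hz; exact hz.2⟩

/-! ### Small bump functions of large support -/

theorem quad_le_sum_mul_norm_sq (M : Mat n) (a : E n) :
    quad M a ≤ (∑ i, ∑ j, |M i j|) * ‖a‖ ^ 2 := by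
  rw [quad_eq_sum, Finset.sum_mul]
  refine Finset.sum_le_sum fun i _ => ?_
  rw [Finset.sum_mul]
  refine Finset.sum_le_sum fun j _ => ?_
  calc a i * (M i j * a j) ≤ |a i * (M i j * a j)| := le_abs_self _
    _ = |M i j| * (|a i| * |a j|) := by rw [abs_mul, abs_mul]; ring
    _ ≤ |M i j| * (‖a‖ * ‖a‖) := by
        gcongr
        · exact PiLp.norm_apply_le a i
        · exact PiLp.norm_apply_le a j
    _ = _ := by ring

theorem norm_gradient_le {φ : E n → ℝ} {L : NNReal} (h : LipschitzWith L φ) (x : E n) :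
    ‖gradient φ x‖ ≤ L := by
  rw [gradient, LinearIsometryEquiv.norm_map]
  exact norm_fderiv_le_of_lipschitz ℝ h

/-- An open set is exhausted from inside by the points at distance more than `1/(k+1)` from the
complement; continuity from below gives one that carries half the measure. -/
theorem exists_half_le_volume_infDist {B : Set (E n)} (hB : IsOpen B) (hBc : Bᶜ.Nonempty)
    (h0 : volume B ≠ 0) (hfin : volume B ≠ ∞) :
    ∃ t > 0, volume B ≤ 2 * volume (B ∩ {x | t < Metric.infDist x Bᶜ}) := by
  set S : ℕ → Set (E n) := fun k => B ∩ {x | 1 / ((k : ℝ) + 1) < Metric.infDist x Bᶜ}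
  have hmono : Monotone S := by
    intro i j hij x hx
    have h1 : (i : ℝ) ≤ j := by exact_mod_cast hij
    have h2 : 1 / ((i : ℝ) + 1) < Metric.infDist x Bᶜ := hx.2
    have h3 : 1 / ((j : ℝ) + 1) ≤ 1 / ((i : ℝ) + 1) := by gcongr
    exact ⟨hx.1, h3.trans_lt h2⟩
  have hU : ⋃ k, S k = B := by
    refine subset_antisymm (iUnion_subset fun k => inter_subset_left) fun x hx => ?_
    have hpos : 0 < Metric.infDist x Bᶜ :=
      (hB.isClosed_compl.notMem_iff_infDist_pos hBc).1 (by simpa using hx)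
    obtain ⟨k, hk⟩ := exists_nat_one_div_lt hpos
    exact mem_iUnion.2 ⟨k, hx, hk⟩
  have ht := tendsto_measure_iUnion_atTop (μ := volume) hmono
  rw [hU] at ht
  obtain ⟨k, hk⟩ := (ht.eventually (lt_mem_nhds (ENNReal.half_lt_self h0 hfin))).exists
  refine ⟨1 / ((k : ℝ) + 1), Nat.one_div_pos_of_nat, ?_⟩
  rw [mul_comm]
  exact ENNReal.div_le_iff_le_mul (by simp) (by simp) |>.1 hk.le

theorem exists_pos_ofReal_sq_mul_le {c e : ℝ≥0∞} (hc : c ≠ ∞) (he : e ≠ 0) :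
    ∃ ε : ℝ, 0 < ε ∧ ENNReal.ofReal (ε ^ 2) * c ≤ e := by
  have h1 : Tendsto (fun ε : ℝ => ENNReal.ofReal (ε ^ 2) * c) (𝓝[>] 0) (𝓝 0) := by
    have h2 : Tendsto (fun ε : ℝ => ENNReal.ofReal (ε ^ 2)) (𝓝 0) (𝓝 0) := by
      have := ENNReal.tendsto_ofReal ((tendsto_id (x := 𝓝 (0 : ℝ))).pow 2)
      simpa using this
    have h3 := ENNReal.Tendsto.mul_const h2 (Or.inr hc)
    rw [zero_mul] at h3
    exact h3.mono_left nhdsWithin_le_nhds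
  obtain ⟨ε, h2, h3⟩ := ((h1.eventually (gt_mem_nhds he.bot_lt)).and
    self_mem_nhdsWithin).exists
  exact ⟨ε, h3, h2.le⟩

/-- The bump is a small multiple of the truncated distance to the complement. Its support is a
compact subset of `B`, where `Q` is integrable, so its energy is `O(ε²)`, while its support still
fills half of `B`. -/
theorem exists_bump {B : Set (E n)} (hB : IsOpen B) (hBΩ : B ⊆ Ω) (hBb : Bornology.IsBounded B)
    (hBc : Bᶜ.Nonempty) (h0 : volume B ≠ 0) (hfin : volume B ≠ ∞)
    (hQ : ∀ i j, LocallyIntegrableOn (fun x => Q x i j) Ω) {e : ℝ≥0∞} (he : e ≠ 0) (he' : e ≠ ∞) :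
    ∃ ζ ∈ LipC B ∩ LipQ Q B, (∀ x, 0 ≤ ζ x) ∧ volume B ≤ 2 * volume (B ∩ {x | ζ x ≠ 0}) ∧
      ∫⁻ x in B, ENNReal.ofReal (ζ x ^ 2 + quad (Q x) (gradient ζ x)) ≤ e := by
  obtain ⟨t, ht, hvol⟩ := exists_half_le_volume_infDist hB hBc h0 hfin
  obtain ⟨z, hz⟩ := hBc
  obtain ⟨R, hR⟩ := hBb.subset_closedBall z
  set K : Set (E n) := {x | t ≤ Metric.infDist x Bᶜ} with hK
  have hKc : IsClosed K := isClosed_le continuous_const (Metric.continuous_infDist_pt _)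
  have hKB : K ⊆ B := by
    intro x hx
    by_contra hxB
    have : Metric.infDist x Bᶜ = 0 := Metric.infDist_zero_of_mem hxB
    rw [hK, mem_ofPred_eq, this] at hx
    linarith
  have hKcomp : IsCompact K := Metric.isCompact_of_isClosed_isBounded hKc (hBb.subset hKB)
  set N : E n → ℝ := fun x => R ^ 2 + ∑ i, ∑ j, |Q x i j| with hN
  have hNint : IntegrableOn N K := by
    refine (integrableOn_const hKcomp.measure_lt_top.ne).add ?_
    refine integrable_finsetSum _ fun i _ => integrable_finsetSum _ fun j _ => ?_
    exact ((hQ i j).integrableOn_compact_subset (hKB.trans hBΩ) hKcomp).abs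
  have hNfin : ∫⁻ x in K, ENNReal.ofReal (N x) ≠ ∞ := (Integrable.lintegral_lt_top hNint).ne
  obtain ⟨ε, hε, hεe⟩ := exists_pos_ofReal_sq_mul_le hNfin he
  set ζ : E n → ℝ := fun x => ε * max 0 (Metric.infDist x Bᶜ - t) with hζ
  have hLip : LipschitzWith (Real.toNNReal ε) ζ := by
    refine LipschitzWith.of_dist_le_mul fun x y => ?_
    rw [Real.coe_toNNReal _ hε.le, Real.dist_eq, hζ]
    dsimp only
    rw [← mul_sub, abs_mul, abs_of_pos hε]
    gcongr
    have h1 := abs_max_sub_max_le_abs (Metric.infDist x Bᶜ - t) (Metric.infDist y Bᶜ - t) 0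
    rw [max_comm, max_comm (Metric.infDist y Bᶜ - t), sub_sub_sub_cancel_right] at h1
    have h2 := (Metric.lipschitz_infDist_pt Bᶜ).dist_le_mul x y
    rw [Real.dist_eq] at h2
    simpa using h1.trans h2
  have hsupp : tsupport ζ ⊆ K := by
    refine closure_minimal (fun x hx => ?_) hKc
    by_contra hxK
    rw [hK, mem_ofPred_eq, not_le] at hxK
    refine hx ?_
    simp only [hζ]
    rw [max_eq_left (by linarith), mul_zero]
  have hcs : HasCompactSupport ζ := hKcomp.of_isClosed_subset (isClosed_tsupport _) hsupp
  have hle : ∫⁻ x in B, ENNReal.ofReal (ζ x ^ 2 + quad (Q x) (gradient ζ x)) ≤ e := by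
    refine le_trans ?_ hεe
    rw [← lintegral_const_mul' _ _ (by finiteness), ← inter_eq_self_of_subset_left hKB,
      ← setLIntegral_indicator hKc.measurableSet]
    refine setLIntegral_mono' hB.measurableSet fun x hx => ?_
    by_cases hxK : x ∈ K
    · rw [indicator_of_mem hxK, ← ENNReal.ofReal_mul (sq_nonneg _)]
      refine ENNReal.ofReal_le_ofReal ?_
      have h1 : ζ x ≤ ε * R := by
        simp only [hζ]
        gcongr
        have h2 : Metric.infDist x Bᶜ ≤ dist x z := Metric.infDist_le_dist_of_mem hz
        have h3 : dist x z ≤ R := hR hx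
        exact max_le (dist_nonneg.trans h3) (by linarith)
      have h0 : 0 ≤ ζ x := by simp only [hζ]; positivity
      have h2 := quad_le_sum_mul_norm_sq (Q x) (gradient ζ x)
      have h3 := norm_gradient_le hLip x
      rw [Real.coe_toNNReal _ hε.le] at h3
      have h4 : 0 ≤ ∑ i, ∑ j, |Q x i j| := by positivity
      calc ζ x ^ 2 + quad (Q x) (gradient ζ x) ≤
          (ε * R) ^ 2 + (∑ i, ∑ j, |Q x i j|) * ε ^ 2 := by
            refine add_le_add (pow_le_pow_left₀ h0 h1 2) (h2.trans ?_)
            gcongr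
        _ = ε ^ 2 * N x := by simp only [hN]; ring
    · rw [indicator_of_notMem hxK]
      have h1 : x ∉ tsupport ζ := fun h => hxK (hsupp h)
      rw [gradient_eq_zero_of_notMem_tsupport h1, image_eq_zero_of_notMem_tsupport h1]
      simp
  refine ⟨ζ, ⟨⟨⟨_, hLip⟩, hcs, hsupp.trans hKB⟩, ⟨_, hLip.lipschitzOnWith⟩, hle.trans_lt
    he'.lt_top⟩, fun x => by simp only [hζ]; positivity, hvol.trans ?_, hle⟩
  gcongr
  intro hx
  simp only [hζ]
  have : 0 < Metric.infDist x Bᶜ - t := sub_pos.2 hx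
  rw [max_eq_right this.le]
  positivity

theorem MemW0.add_of_mem (hU : IsOpen U)
    (hp : ∀ᵐ x ∂volume.restrict U, (Q x).PosSemidef)
    (hQ : ∀ i j, AEMeasurable (fun x => Q x i j) (volume.restrict U))
    {w : E n → ℝ} (h : MemW0 Q U w g) {ζ : E n → ℝ} (hζ : ζ ∈ LipC U ∩ LipQ Q U) :
    MemW0 Q U (fun x => w x + ζ x) (fun x => g x + gradient ζ x) := by
  obtain ⟨hw, hg, φ, hφ, h1, h2⟩ := h
  obtain ⟨⟨⟨L, hL⟩, hs, hsU⟩, -, hfin⟩ := hζ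
  have hgrad : ∀ k, ∀ᵐ x ∂volume.restrict U,
      gradient (fun x => φ k x + ζ x) x = gradient (φ k) x + gradient ζ x := by
    intro k
    obtain ⟨K, hK⟩ := (hφ k).1.1
    filter_upwards [ae_hasGradientAt hU (hK.lipschitzOnWith (s := U)),
      ae_hasGradientAt hU (hL.lipschitzOnWith (s := U))] with x hx1 hx2
    exact (hasGradientAt_add hx1 hx2).gradient
  refine ⟨hw.add hL.continuous.aestronglyMeasurable,
    hg.add (measurable_gradient ζ).aestronglyMeasurable, fun k x => φ k x + ζ x, fun k => ?_, ?_, ?_⟩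
  · obtain ⟨⟨⟨K, hK⟩, hks, hksU⟩, -, hkfin⟩ := hφ k
    refine ⟨⟨⟨_, hK.add hL⟩, hks.add hs, ?_⟩, ⟨_, (hK.add hL).lipschitzOnWith⟩, ?_⟩
    · exact (tsupport_add (φ k) ζ).trans (union_subset hksU hsU)
    · refine (lintegral_mono_ae (g := fun x => 2 * ENNReal.ofReal (φ k x ^ 2 +
        quad (Q x) (gradient (φ k) x)) + 2 * ENNReal.ofReal (ζ x ^ 2 +
        quad (Q x) (gradient ζ x))) ?_).trans_lt ?_
      · filter_upwards [hp, hgrad k] with x hx hx2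
        have q1 := quad_nonneg hx (gradient (φ k) x)
        have q2 := quad_nonneg hx (gradient ζ x)
        refine ofReal_le_two_mul_add ?_ (by positivity) (by positivity)
        rw [hx2]
        have := quad_add_le hx (gradient (φ k) x) (gradient ζ x)
        nlinarith [sq_nonneg (φ k x - ζ x)]
      · rw [lintegral_add_left', lintegral_const_mul' _ _ (by simp),
          lintegral_const_mul' _ _ (by simp)]
        · exact ENNReal.add_lt_top.2 ⟨ENNReal.mul_lt_top (by simp) hkfin,
            ENNReal.mul_lt_top (by simp) hfin⟩
        · exact (((hK.continuous.measurable.pow_const 2).aemeasurable.add (aemeasurable_quad hQ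
            (measurable_gradient _).aestronglyMeasurable)).ennreal_ofReal).const_mul _
  · simpa using h1
  · refine h2.congr fun k => lintegral_congr_ae ?_
    filter_upwards [hgrad k] with x hx
    rw [hx, add_sub_add_right_eq_sub]

/-! ### The Sobolev inequality with averages over the ball -/

theorem sobolev_rearrange {σ C r : ℝ} (hσ : 1 < σ) (hC : 0 ≤ C) (hr : 0 ≤ r) {p a b : ℝ≥0∞}
    (h : p ^ (1 / (2 * σ)) ≤ ENNReal.ofReal (C * r) * a ^ (1 / 2 : ℝ) +
      ENNReal.ofReal C * b ^ (1 / 2 : ℝ)) :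
    p ^ (1 / σ) ≤ ENNReal.ofReal (2 * C ^ 2) * (ENNReal.ofReal (r ^ 2) * a + b) := by
  have hsq : ∀ s : ℝ≥0∞, (s ^ (1 / 2 : ℝ)) ^ (2 : ℝ) = s := fun s => by
    rw [← ENNReal.rpow_mul]; norm_num
  have h1 : p ^ (1 / σ) = (p ^ (1 / (2 * σ))) ^ (2 : ℝ) := by
    rw [← ENNReal.rpow_mul]; congr 1; field_simp
  rw [h1]
  refine (ENNReal.rpow_le_rpow h zero_le_two).trans ?_
  refine (ENNReal.rpow_add_le_mul_rpow_add_rpow _ _ one_le_two).trans ?_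
  rw [ENNReal.mul_rpow_of_nonneg _ _ zero_le_two, ENNReal.mul_rpow_of_nonneg _ _ zero_le_two, hsq,
    hsq, ENNReal.ofReal_rpow_of_nonneg (by positivity) zero_le_two,
    ENNReal.ofReal_rpow_of_nonneg hC zero_le_two, ENNReal.ofReal_mul zero_le_two]
  have h2 : ENNReal.ofReal ((C * r) ^ (2 : ℝ)) = ENNReal.ofReal (C ^ 2) * ENNReal.ofReal (r ^ 2) := by
    rw [← ENNReal.ofReal_mul (sq_nonneg _)]; congr 1; norm_num; ring
  have h3 : (2 : ℝ≥0∞) ^ ((2 : ℝ) - 1) = ENNReal.ofReal 2 := by norm_num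
  rw [h2, h3, Real.rpow_two]
  apply le_of_eq; ring

/-- If `w` lives on a small set, averages over `{w ≠ 0}` cannot be compared with averages over `B`.
Adding a nonnegative bump `ζ` makes the set `{w + ζ ≠ 0}` at least half of `B`, and as `w ≥ 0` this
only increases the left side; the energy of `ζ` is absorbed by `∫ w²`. -/
theorem Sobolev.normalized {d : E n → E n → ℝ} {σ η C : ℝ} (hS : Sobolev d Ω Q σ η C)
    (hσ : 1 < σ) (hC : 0 ≤ C) (hΩ : IsOpen Ω) (hΩb : Bornology.IsBounded Ω)
    (hd : IsMetricOn d Ω) (hc : Containment d Ω)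
    (hloc : ∀ i j, LocallyIntegrableOn (fun x => Q x i j) Ω)
    (hp : ∀ᵐ x ∂volume.restrict Ω, (Q x).PosSemidef) {y : E n} {r : ℝ} (hy : Admits Ω η y r)
    {w : E n → ℝ} (h : MemW0 Q (dball d Ω y r) w g)
    (hw : ∀ᵐ x ∂volume.restrict (dball d Ω y r), 0 ≤ w x) :
    ((volume (dball d Ω y r))⁻¹ * ∫⁻ x in dball d Ω y r, ENNReal.ofReal (w x) ^ (2 * σ)) ^ (1 / σ) ≤
      ENNReal.ofReal (16 * C ^ 2) * ((volume (dball d Ω y r))⁻¹ *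
        (ENNReal.ofReal (r ^ 2) * (∫⁻ x in dball d Ω y r, ENNReal.ofReal (quad (Q x) (g x))) +
          ∫⁻ x in dball d Ω y r, ENNReal.ofReal (w x ^ 2))) := by
  have hB := isOpen_dball hd hc hy.1 r
  have hBΩ : dball d Ω y r ⊆ Ω := dball_subset
  have hyB := self_mem_dball hd hy.1 hy.2.1
  have hBb := hΩb.subset hBΩ
  have hBc := (hy.compl_nonempty hΩ).mono (compl_subset_compl.2 hBΩ)
  generalize hBdef : dball d Ω y r = B at *
  have hV0 : volume B ≠ 0 := (hB.measure_pos volume ⟨y, hyB⟩).ne'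
  have hVfin : volume B ≠ ∞ := hBb.measure_lt_top.ne
  have hle : volume.restrict B ≤ volume.restrict Ω := Measure.restrict_mono hBΩ le_rfl
  have hpB : ∀ᵐ x ∂volume.restrict B, (Q x).PosSemidef := ae_mono hle hp
  have hQB : ∀ i j, AEMeasurable (fun x => Q x i j) (volume.restrict B) := fun i j =>
    ((hloc i j).aestronglyMeasurable.aemeasurable).mono_measure hle
  set a := ∫⁻ x in B, ENNReal.ofReal (quad (Q x) (g x)) with ha
  set b := ∫⁻ x in B, ENNReal.ofReal (w x ^ 2) with hb
  have hwm : AEMeasurable w (volume.restrict B) := h.1.aemeasurable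
  -- If `∫ w² = 0` nothing is left to absorb a bump, but then `w = 0` almost everywhere and the left
  -- side vanishes.
  by_cases hb0 : b = 0
  · have h0 : ∀ᵐ x ∂volume.restrict B, ENNReal.ofReal (w x) ^ (2 * σ) = 0 := by
      rw [hb, lintegral_eq_zero_iff' (by fun_prop)] at hb0
      filter_upwards [hb0, hw] with x hx hx2
      have h1 : w x ^ 2 ≤ 0 := by simpa using hx
      have h2 : w x = 0 := by nlinarith [sq_nonneg (w x)]
      rw [h2, ENNReal.ofReal_zero, ENNReal.zero_rpow_of_pos (by linarith)]
    rw [lintegral_congr_ae h0, lintegral_zero, mul_zero, ENNReal.zero_rpow_of_pos (by positivity)]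
    exact bot_le
  have hr0 : 0 ≤ r := hy.2.1.le
  -- The bump may cost at most `b = ∫ w²` in total, so it merely doubles the right side: `2C² · 4 ·
  -- 2 = 16C²`.
  obtain ⟨e, he0, hetop, heb⟩ : ∃ e : ℝ≥0∞, e ≠ 0 ∧ e ≠ ∞ ∧ ENNReal.ofReal (r ^ 2) * e + e ≤ b := by
    obtain ⟨ε, hε, h1⟩ := exists_pos_ofReal_sq_mul_le (c := ENNReal.ofReal (r ^ 2) + 1) (e := b)
      (by finiteness) hb0
    refine ⟨ENNReal.ofReal (ε ^ 2), by simpa using hε.ne', by finiteness, le_trans (le_of_eq ?_) h1⟩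
    ring
  obtain ⟨ζ, hζ, hζ0, hζV, hζe⟩ := exists_bump hB hBΩ hBb hBc hV0 hVfin hloc he0 hetop
  have hmem := h.add_of_mem hB hpB hQB hζ
  obtain ⟨e1, e2⟩ := lintegral_sq_le_of_mem_LipQ (Ω := B) hζ.2 hpB
  have key := hS y r hy _ _ (by rw [hBdef]; exact hmem)
  rw [hBdef] at key
  set S := volume (B ∩ {x | w x + ζ x ≠ 0}) with hSdef
  have hSV : S ≤ volume B := measure_mono inter_subset_left
  have hVS : volume B ≤ 2 * S := by
    refine hζV.trans (mul_le_mul_right ?_ 2)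
    have : (volume.restrict B) {x | ζ x ≠ 0} ≤ (volume.restrict B) {x | w x + ζ x ≠ 0} := by
      refine measure_mono_ae ?_
      filter_upwards [hw] with x hx hx2
      have h1 : 0 < ζ x := (hζ0 x).lt_of_ne' hx2
      exact (by positivity : 0 < w x + ζ x).ne'
    rwa [Measure.restrict_apply' hB.measurableSet, Measure.restrict_apply' hB.measurableSet,
      inter_comm, inter_comm _ B] at this
  have hinv : S⁻¹ ≤ 2 * (volume B)⁻¹ := by
    have := ENNReal.inv_le_inv.2 hVS
    rw [ENNReal.mul_inv (by simp) (by simp)] at this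
    calc S⁻¹ = 2 * (2⁻¹ * S⁻¹) := by
          rw [← mul_assoc, ENNReal.mul_inv_cancel (by simp) (by simp), one_mul]
      _ ≤ _ := by gcongr
  have key2 := sobolev_rearrange hσ hC hr0 key
  have ha' : ∫⁻ x in B, ENNReal.ofReal (quad (Q x) (g x + gradient ζ x)) ≤ 2 * a + 2 * e := by
    refine (lintegral_quad_add_le hQB hpB h.2.1).trans ?_
    gcongr
    refine (lintegral_mono fun x => ?_).trans hζe
    exact ENNReal.ofReal_le_ofReal (le_add_of_nonneg_left (sq_nonneg _))
  have hb' : ∫⁻ x in B, ENNReal.ofReal |w x + ζ x| ^ (2 : ℝ) ≤ 2 * b + 2 * e := by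
    have h1 : ∀ x, ENNReal.ofReal |w x + ζ x| ^ (2 : ℝ) = ENNReal.ofReal ((w x + ζ x) ^ 2) := by
      intro x
      rw [ENNReal.ofReal_rpow_of_nonneg (abs_nonneg _) zero_le_two, Real.rpow_two, sq_abs]
    simp_rw [h1]
    refine (lintegral_sq_add_le hwm).trans ?_
    gcongr
    refine (lintegral_mono_ae ?_).trans hζe
    filter_upwards [hpB] with x hx
    exact ENNReal.ofReal_le_ofReal (le_add_of_nonneg_right (quad_nonneg hx _))
  calc _ ≤ (S⁻¹ * ∫⁻ x in B, ENNReal.ofReal |w x + ζ x| ^ (2 * σ)) ^ (1 / σ) := by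
        refine ENNReal.rpow_le_rpow (mul_le_mul' (ENNReal.inv_le_inv.2 hSV)
          (lintegral_mono_ae ?_)) (by positivity)
        filter_upwards [hw] with x hx
        refine ENNReal.rpow_le_rpow (ENNReal.ofReal_le_ofReal ?_) (by linarith)
        exact (le_add_of_nonneg_right (hζ0 x)).trans (le_abs_self _)
    _ ≤ ENNReal.ofReal (2 * C ^ 2) * (ENNReal.ofReal (r ^ 2) * (2 * (volume B)⁻¹ * (2 * a + 2 * e))
        + 2 * (volume B)⁻¹ * (2 * b + 2 * e)) := by
        refine key2.trans ?_
        gcongr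
    _ = ENNReal.ofReal (2 * C ^ 2) * (4 * ((volume B)⁻¹ * (ENNReal.ofReal (r ^ 2) * a + b +
        (ENNReal.ofReal (r ^ 2) * e + e)))) := by ring
    _ ≤ ENNReal.ofReal (2 * C ^ 2) * (4 * ((volume B)⁻¹ * (2 * (ENNReal.ofReal (r ^ 2) * a + b)))) := by
        gcongr ENNReal.ofReal (2 * C ^ 2) * (4 * ((volume B)⁻¹ * ?_))
        rw [two_mul]
        exact add_le_add le_rfl (heb.trans le_add_self)
    _ = _ := by
        rw [show 16 * C ^ 2 = 8 * (2 * C ^ 2) by ring, ENNReal.ofReal_mul (by norm_num)]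
        norm_num
        ring

end Degenerate

/-! ### Caccioppoli's inequality and the reverse Hölder step. -/

namespace Degenerate

variable {n : ℕ} {Q : E n → Mat n} {Ω U : Set (E n)} {u : E n → ℝ} {g : E n → E n}

/-- A `C¹` function on a half line with bounded derivative extends to the line. -/
theorem exists_extension {m C : ℝ} {h h' : ℝ → ℝ} (hd : ∀ t, m ≤ t → HasDerivAt h (h' t) t)
    (hc : ContinuousOn h' (Ici m)) (hb : ∀ t, m ≤ t → |h' t| ≤ C) :
    ∃ F F' : ℝ → ℝ, (∀ t, HasDerivAt F (F' t) t) ∧ Continuous F' ∧ (∀ t, |F' t| ≤ C) ∧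
      ∀ t, m ≤ t → F t = h t ∧ F' t = h' t := by
  have hcont : Continuous fun t => h' (max t m) :=
    hc.comp_continuous (by fun_prop) fun t => mem_Ici.2 (le_max_right _ _)
  refine ⟨fun t => h m + ∫ s in m..t, h' (max s m), fun t => h' (max t m), fun t => ?_, hcont,
    fun t => hb _ (le_max_right _ _), fun t ht => ⟨?_, by simp only [max_eq_left ht]⟩⟩
  · exact (intervalIntegral.integral_hasDerivAt_right (hcont.intervalIntegrable _ _)
      (hcont.stronglyMeasurableAtFilter _ _) hcont.continuousAt).const_add _
  · have h1 : ∀ s ∈ uIcc m t, HasDerivAt h (h' (max s m)) s := by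
      intro s hs
      rw [uIcc_of_le ht] at hs
      rw [max_eq_left hs.1]
      exact hd s hs.1
    have := intervalIntegral.integral_eq_sub_of_hasDerivAt h1 (hcont.intervalIntegrable _ _)
    simp only [this]; ring

/-- The data of the local estimates on a metric ball: a positive element `v` of `𝒲^{1,2}_Q(Ω)`
with gradient `G`, the matrix `M` of the equation frozen at the solution, and a right hand side
controlled by `v`. -/
structure LocalData (σ k K C η : ℝ) (d : E n → E n → ℝ) (Ω : Set (E n)) (Q : E n → Mat n)
    (y : E n) (r : ℝ) (M : E n → Mat n) (f v : E n → ℝ) (G : E n → E n) (m : ℝ) : Prop where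
  one_lt : 1 < σ
  k_pos : 0 < k
  K_nonneg : 0 ≤ K
  C_nonneg : 0 ≤ C
  isOpen : IsOpen Ω
  bounded : Bornology.IsBounded Ω
  metric : IsMetricOn d Ω
  containment : Containment d Ω
  locInt : ∀ i j, LocallyIntegrableOn (fun x => Q x i j) Ω
  psdQ : ∀ᵐ x ∂volume.restrict Ω, (Q x).PosSemidef
  sobolev : Sobolev d Ω Q σ η C
  admits : Admits Ω η y r
  psdM : ∀ᵐ x ∂volume.restrict Ω, (M x).PosSemidef
  bounds : ∀ᵐ x ∂volume.restrict Ω, ∀ ξ : E n,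
    k * quad (Q x) ξ ≤ quad (M x) ξ ∧ quad (M x) ξ ≤ K * quad (Q x) ξ
  memW : MemW Q Ω v G
  m_pos : 0 < m
  le_v : ∀ᵐ x ∂volume.restrict Ω, m ≤ v x
  abs_f_le : ∀ᵐ x ∂volume.restrict Ω, |f x| ≤ v x / r ^ 2

/-- The inequality obtained by testing with `χ² Φ(v)`: for `s = 1` that of a subsolution, for
`s = -1` that of a supersolution. -/
def EnergyIneq (Ω : Set (E n)) (M : E n → Mat n) (f v : E n → ℝ) (G : E n → E n) (s : ℝ)
    (χ : E n → ℝ) (Φ Φ' : ℝ → ℝ) : Prop :=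
  IntegrableOn (fun x => bil (M x) (G x)
    ((2 * χ x * Φ (v x)) • gradient χ x + (χ x ^ 2 * Φ' (v x)) • G x)) Ω ∧
  IntegrableOn (fun x => f x * (χ x ^ 2 * Φ (v x))) Ω ∧
  0 ≤ -s * ((∫ x in Ω, bil (M x) (G x)
    ((2 * χ x * Φ (v x)) • gradient χ x + (χ x ^ 2 * Φ' (v x)) • G x)) +
    ∫ x in Ω, f x * (χ x ^ 2 * Φ (v x)))

/-- A nonnegative Lipschitz cutoff function `χ ≤ 1` supported in `B`, with
`[∇χ]_Q² ≤ Γ ω` and `χ² ≤ ω ≤ 1`. -/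
structure IsCutoff (Q : E n → Mat n) (B : Set (E n)) (χ ω : E n → ℝ) (Γ : ℝ) : Prop where
  mem : χ ∈ LipC B
  nonneg : ∀ x, 0 ≤ χ x
  le_one : ∀ x, χ x ≤ 1
  grad : ∀ᵐ x ∂volume.restrict B, quad (Q x) (gradient χ x) ≤ Γ * ω x
  sq_le : ∀ x, χ x ^ 2 ≤ ω x
  omega_le : ∀ x, ω x ≤ 1
  Γ_nonneg : 0 ≤ Γ

theorem IsCutoff.quad_le {B : Set (E n)} {χ ω : E n → ℝ} {Γ : ℝ} (h : IsCutoff Q B χ ω Γ)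
    (hB : MeasurableSet B) : ∀ᵐ x ∂volume.restrict Ω, quad (Q x) (gradient χ x) ≤ Γ := by
  have h1 := (ae_restrict_iff' hB).1 h.grad
  refine ae_restrict_of_ae ?_
  filter_upwards [h1] with x hx
  by_cases hxB : x ∈ B
  · exact (hx hxB).trans (mul_le_of_le_one_right h.Γ_nonneg (h.omega_le x))
  · rw [gradient_eq_zero_of_notMem_tsupport fun h2 => hxB (h.mem.2.2 h2), quad_zero]
    exact h.Γ_nonneg

/-- This is the pointwise form of Caccioppoli's inequality. The sign `s` makes the `Φ'` term
coercive, at least `c² h'² [G]_M²`; Young's inequality gives up half of that to the cross term, and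
`v |h'| ≤ b h` turns the `f` term into one of order zero. -/
theorem neg_mul_energy_le {M N : Mat n} (hM : M.PosSemidef) {k K : ℝ} {G e : E n}
    (hb : ∀ ξ : E n, k * quad N ξ ≤ quad M ξ ∧ quad M ξ ≤ K * quad N ξ)
    {s c Φ Φ' h h' b v f ρ : ℝ} (hs : |s| = 1) (hc : 0 ≤ c) (hΦ : 0 ≤ Φ) (hh : 0 ≤ h) (hρ : 0 ≤ ρ)
    (hΦh : Φ ≤ h * |h'|) (hΦ' : h' ^ 2 ≤ s * Φ') (hv : v * |h'| ≤ b * h) (hf : |f| ≤ v * ρ) :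
    -s * (bil M G ((2 * c * Φ) • e + (c ^ 2 * Φ') • G) + f * (c ^ 2 * Φ)) ≤
      (2 * K * (h ^ 2 * quad N e) + b * ρ * (c ^ 2 * h ^ 2)) - k / 2 * (c ^ 2 * h' ^ 2 * quad N G) := by
  -- The weight `2h` on `e` makes the cross term cost exactly half of the coercive term.
  have h1 := two_mul_abs_bil_le hM ((c * h') • G) ((2 * h) • e)
  rw [bil_smul_left, bil_smul_right, quad_smul, quad_smul, abs_mul, abs_mul c,
    abs_mul (2 * h),
    abs_of_nonneg hc, abs_of_nonneg (by positivity : 0 ≤ 2 * h)] at h1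
  rw [bil_add_right, bil_smul_right, bil_smul_right]
  have hqG := quad_nonneg hM G
  have h2 : (c ^ 2 * h' ^ 2) * quad M G ≤ c ^ 2 * (s * Φ') * quad M G := by gcongr
  have h3 : -s * (2 * c * Φ * bil M G e) ≤ 2 * c * (h * |h'|) * |bil M G e| := by
    calc -s * (2 * c * Φ * bil M G e) ≤ |(-s) * (2 * c * Φ * bil M G e)| := le_abs_self _
      _ = 2 * c * Φ * |bil M G e| := by
          rw [abs_mul, abs_neg, hs, one_mul, abs_mul, abs_of_nonneg (by positivity)]
      _ ≤ _ := by gcongr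
  have h4 : -s * (f * (c ^ 2 * Φ)) ≤ b * ρ * (c ^ 2 * h ^ 2) := by
    calc -s * (f * (c ^ 2 * Φ)) ≤ |(-s) * (f * (c ^ 2 * Φ))| := le_abs_self _
      _ = |f| * (c ^ 2 * Φ) := by
          rw [abs_mul, abs_neg, hs, one_mul, abs_mul, abs_of_nonneg (by positivity : 0 ≤ c ^ 2 * Φ)]
      _ ≤ (v * ρ) * (c ^ 2 * (h * |h'|)) := by
          have : 0 ≤ v * ρ := (abs_nonneg _).trans hf
          gcongr
      _ = (v * |h'|) * (ρ * c ^ 2 * h) := by ring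
      _ ≤ (b * h) * (ρ * c ^ 2 * h) := by gcongr
      _ = _ := by ring
  have h5 : k * quad N G * (c ^ 2 * h' ^ 2) ≤ quad M G * (c ^ 2 * h' ^ 2) := by
    gcongr; exact (hb G).1
  have h6 : quad M e * h ^ 2 ≤ K * quad N e * h ^ 2 := by
    gcongr; exact (hb e).2
  have h7 : bil M G G = quad M G := rfl
  rw [h7]
  nlinarith

theorem integrable_of_lintegral_ofReal_lt_top {μ : Measure (E n)} {F : E n → ℝ}
    (hm : AEMeasurable F μ) (h0 : ∀ᵐ x ∂μ, 0 ≤ F x) (h : ∫⁻ x, ENNReal.ofReal (F x) ∂μ < ∞) :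
    Integrable F μ :=
  ⟨hm.aestronglyMeasurable, (hasFiniteIntegral_iff_ofReal h0).2 h⟩

section

variable {σ k K C η r m : ℝ} {d : E n → E n → ℝ} {y : E n} {M : E n → Mat n} {f v : E n → ℝ}
  {G : E n → E n} {χ ω : E n → ℝ} {Γ : ℝ} {h h' Φ Φ' : ℝ → ℝ} {s b Λ : ℝ}

theorem LocalData.aemeasurable_Q (H : LocalData σ k K C η d Ω Q y r M f v G m) (i j : Fin n) :
    AEMeasurable (fun x => Q x i j) (volume.restrict Ω) :=
  (H.locInt i j).aestronglyMeasurable.aemeasurable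

theorem LocalData.isOpen_ball (H : LocalData σ k K C η d Ω Q y r M f v G m) :
    IsOpen (dball d Ω y r) := isOpen_dball H.metric H.containment H.admits.1 r

theorem LocalData.restrict_le (_ : LocalData σ k K C η d Ω Q y r M f v G m) :
    volume.restrict (dball d Ω y r) ≤ volume.restrict Ω :=
  Measure.restrict_mono dball_subset le_rfl

/-- Caccioppoli's inequality. -/
theorem LocalData.caccioppoli (H : LocalData σ k K C η d Ω Q y r M f v G m)
    (hχ : IsCutoff Q (dball d Ω y r) χ ω Γ)
    (hd : ∀ t, HasDerivAt h (h' t) t) (hc : Continuous h')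
    (hb : ∀ t, |h' t| ≤ Λ) (hpos : ∀ t, m ≤ t → 0 ≤ h t) (hs : |s| = 1)
    (hΦ0 : ∀ t, m ≤ t → 0 ≤ Φ t) (hΦ : ∀ t, m ≤ t → Φ t ≤ h t * |h' t|)
    (hΦ' : ∀ t, m ≤ t → h' t ^ 2 ≤ s * Φ' t) (hb0 : 0 ≤ b)
    (hth : ∀ t, m ≤ t → t * |h' t| ≤ b * h t)
    (hE : EnergyIneq Ω M f v G s χ Φ Φ') :
    ENNReal.ofReal (k / 2) * ∫⁻ x in dball d Ω y r,
      ENNReal.ofReal (χ x ^ 2 * h' (v x) ^ 2 * quad (Q x) (G x)) ≤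
    ENNReal.ofReal (2 * K * Γ + b * (1 / r ^ 2)) * ∫⁻ x in dball d Ω y r,
      ENNReal.ofReal (ω x * h (v x) ^ 2) := by
  set B := dball d Ω y r with hBdef
  have hBm : MeasurableSet B := H.isOpen_ball.measurableSet
  have hle := H.restrict_le
  have hΛ : 0 ≤ Λ := (abs_nonneg _).trans (hb 0)
  have hhc : Continuous h := (lipschitzWith_of_hasDerivAt hΛ hd hb).continuous
  have hK := H.K_nonneg
  have hk := H.k_pos
  have hΓ := hχ.Γ_nonneg
  obtain ⟨L, hL⟩ := hχ.mem.1
  have hzero : ∀ x, x ∉ B → χ x = 0 ∧ gradient χ x = 0 := fun x hx => by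
    have : x ∉ tsupport χ := fun h2 => hx (hχ.mem.2.2 h2)
    exact ⟨image_eq_zero_of_notMem_tsupport this, gradient_eq_zero_of_notMem_tsupport this⟩
  obtain ⟨hE1, hE2, hE3⟩ := hE
  -- The energy inequality lives on `Ω`; both integrands vanish off `B`, since `χ` and its gradient
  -- do.
  have hI1 := setIntegral_eq_of_subset_of_forall_sdiff_eq_zero (μ := volume)
    (f := fun x => bil (M x) (G x) ((2 * χ x * Φ (v x)) • gradient χ x +
      (χ x ^ 2 * Φ' (v x)) • G x)) H.isOpen.measurableSet (dball_subset : B ⊆ Ω)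
    fun x hx => by simp [hzero x hx.2, bil]
  have hI2 := setIntegral_eq_of_subset_of_forall_sdiff_eq_zero (μ := volume)
    (f := fun x => f x * (χ x ^ 2 * Φ (v x))) H.isOpen.measurableSet (dball_subset : B ⊆ Ω)
    fun x hx => by simp [hzero x hx.2]
  rw [hI1, hI2,
    ← integral_add (hE1.mono_set dball_subset) (hE2.mono_set dball_subset),
    ← integral_const_mul] at hE3
  have hvm : AEMeasurable v (volume.restrict B) := H.memW.1.aemeasurable.mono_measure hle
  have hqm : AEMeasurable (fun x => quad (Q x) (G x)) (volume.restrict B) :=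
    (aemeasurable_quad H.aemeasurable_Q H.memW.2.1).mono_measure hle
  have hqm2 : AEMeasurable (fun x => quad (Q x) (gradient χ x)) (volume.restrict B) :=
    (aemeasurable_quad H.aemeasurable_Q (measurable_gradient χ).aestronglyMeasurable).mono_measure
      hle
  have hpB : ∀ᵐ x ∂volume.restrict B, (Q x).PosSemidef := ae_mono hle H.psdQ
  have hχm : AEMeasurable χ (volume.restrict B) := hL.continuous.aemeasurable
  have hqi : IntegrableOn (fun x => quad (Q x) (G x)) B := by
    refine integrable_of_lintegral_ofReal_lt_top hqm ?_ ((lintegral_mono' hle le_rfl).trans_lt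
      (H.memW.lintegral_quad_lt_top H.aemeasurable_Q H.psdQ))
    filter_upwards [hpB] with x hx using quad_nonneg hx _
  have hvi : IntegrableOn (fun x => v x ^ 2) B := by
    refine integrable_of_lintegral_ofReal_lt_top (hvm.pow_const 2)
      (ae_of_all _ fun x => sq_nonneg _) ((lintegral_mono' hle le_rfl).trans_lt
      (H.memW.lintegral_sq_lt_top H.isOpen H.psdQ))
  have hBfin : volume B < ∞ := (H.bounded.subset dball_subset).measure_lt_top
  have hχ2 : ∀ x, χ x ^ 2 ≤ 1 := fun x => (hχ.sq_le x).trans (hχ.omega_le x)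
  have hLi : IntegrableOn (fun x => k / 2 * (χ x ^ 2 * h' (v x) ^ 2 * quad (Q x) (G x))) B := by
    refine Integrable.mono' (hqi.const_mul (k / 2 * Λ ^ 2))
      ((((hχm.pow_const 2).mul ((hc.measurable.comp_aemeasurable hvm).pow_const 2)).mul
        hqm).const_mul _).aestronglyMeasurable ?_
    filter_upwards [hpB] with x hx
    have hq := quad_nonneg hx (G x)
    rw [Real.norm_of_nonneg (by positivity), mul_assoc (k / 2)]
    gcongr
    calc χ x ^ 2 * h' (v x) ^ 2 ≤ 1 * Λ ^ 2 := by
          refine mul_le_mul (hχ2 x) ?_ (sq_nonneg _) zero_le_one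
          rw [sq_le_sq, abs_of_nonneg hΛ]
          exact hb _
      _ = Λ ^ 2 := one_mul _
  have hRle : ∀ᵐ x ∂volume.restrict B, 2 * K * (h (v x) ^ 2 * quad (Q x) (gradient χ x)) +
      b * (1 / r ^ 2) * (χ x ^ 2 * h (v x) ^ 2) ≤
        (2 * K * Γ + b * (1 / r ^ 2)) * (ω x * h (v x) ^ 2) := by
    filter_upwards [hχ.grad] with x hx
    have h1 : χ x ^ 2 * h (v x) ^ 2 ≤ ω x * h (v x) ^ 2 := by gcongr; exact hχ.sq_le x
    have h2 : h (v x) ^ 2 * quad (Q x) (gradient χ x) ≤ h (v x) ^ 2 * (Γ * ω x) := by gcongr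
    calc _ ≤ 2 * K * (h (v x) ^ 2 * (Γ * ω x)) + b * (1 / r ^ 2) * (ω x * h (v x) ^ 2) := by
          gcongr
      _ = _ := by ring
  have hR0 : ∀ᵐ x ∂volume.restrict B, 0 ≤ 2 * K * (h (v x) ^ 2 * quad (Q x) (gradient χ x)) +
      b * (1 / r ^ 2) * (χ x ^ 2 * h (v x) ^ 2) := by
    filter_upwards [hpB] with x hx
    have hq := quad_nonneg hx (gradient χ x)
    positivity
  -- A bounded `h'` gives `h` linear growth, so `v ∈ L²` makes `h(v)²` integrable. Finiteness of
  -- both parts is needed to separate the integral of the difference.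
  have hRi : IntegrableOn (fun x => 2 * K * (h (v x) ^ 2 * quad (Q x) (gradient χ x)) +
      b * (1 / r ^ 2) * (χ x ^ 2 * h (v x) ^ 2)) B := by
    have hi : IntegrableOn (fun x => (2 * K * Γ + b * (1 / r ^ 2)) *
        (2 * h 0 ^ 2 + 2 * Λ ^ 2 * v x ^ 2)) B :=
      ((integrableOn_const hBfin.ne).add (hvi.const_mul _)).const_mul _
    have hhm : AEMeasurable (fun x => h (v x) ^ 2) (volume.restrict B) :=
      (hhc.measurable.comp_aemeasurable hvm).pow_const 2
    refine Integrable.mono' hi ((((hhm.mul hqm2).const_mul _).add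
      (((hχm.pow_const 2).mul hhm).const_mul _)).aestronglyMeasurable) ?_
    filter_upwards [hRle, hR0] with x hx hx0
    rw [Real.norm_of_nonneg hx0]
    refine hx.trans ?_
    gcongr
    have h1 := (lipschitzWith_of_hasDerivAt hΛ hd hb).dist_le_mul (v x) 0
    rw [Real.dist_eq, Real.dist_eq, sub_zero] at h1
    change _ ≤ Λ * _ at h1
    have h2 : h (v x) ^ 2 ≤ 2 * h 0 ^ 2 + 2 * Λ ^ 2 * v x ^ 2 := by
      have h3 : (h (v x) - h 0) ^ 2 ≤ Λ ^ 2 * v x ^ 2 := by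
        rw [← sq_abs, ← sq_abs (v x), ← mul_pow]; gcongr
      nlinarith [sq_nonneg (h (v x) - 2 * h 0)]
    exact (mul_le_of_le_one_left (sq_nonneg _) (hχ.omega_le x)).trans h2
  have hmono : ∫ x in B, -s * (bil (M x) (G x) ((2 * χ x * Φ (v x)) • gradient χ x +
      (χ x ^ 2 * Φ' (v x)) • G x) + f x * (χ x ^ 2 * Φ (v x))) ≤
      ∫ x in B, ((2 * K * (h (v x) ^ 2 * quad (Q x) (gradient χ x)) +
      b * (1 / r ^ 2) * (χ x ^ 2 * h (v x) ^ 2)) -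
      k / 2 * (χ x ^ 2 * h' (v x) ^ 2 * quad (Q x) (G x))) := by
    refine integral_mono_ae (((hE1.mono_set dball_subset).add
      (hE2.mono_set dball_subset)).const_mul _) (hRi.sub hLi) ?_
    filter_upwards [ae_mono hle H.psdM, ae_mono hle H.bounds, ae_mono hle H.le_v,
      ae_mono hle H.abs_f_le] with x hx1 hx2 hx3 hx4
    exact neg_mul_energy_le hx1 hx2 hs (hχ.nonneg x) (hΦ0 _ hx3) (hpos _ hx3) (by positivity)
      (hΦ _ hx3) (hΦ' _ hx3) (hth _ hx3) (by rwa [mul_one_div])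
  rw [integral_sub hRi hLi] at hmono
  have hfinal := hE3.trans hmono
  rw [sub_nonneg] at hfinal
  rw [← lintegral_const_mul' _ _ (by finiteness), ← lintegral_const_mul' _ _ (by finiteness)]
  calc _ = ∫⁻ x in B, ENNReal.ofReal (k / 2 * (χ x ^ 2 * h' (v x) ^ 2 * quad (Q x) (G x))) := by
        simp_rw [ENNReal.ofReal_mul (by positivity : 0 ≤ k / 2)]
    _ = ENNReal.ofReal (∫ x in B, k / 2 * (χ x ^ 2 * h' (v x) ^ 2 * quad (Q x) (G x))) := by
        refine (ofReal_integral_eq_lintegral_ofReal hLi ?_).symm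
        filter_upwards [hpB] with x hx
        have hq := quad_nonneg hx (G x)
        simp only [Pi.zero_apply]; positivity
    _ ≤ _ := ENNReal.ofReal_le_ofReal hfinal
    _ = _ := ofReal_integral_eq_lintegral_ofReal hRi hR0
    _ ≤ _ := by
        refine lintegral_mono_ae ?_
        filter_upwards [hRle] with x hx
        rw [← ENNReal.ofReal_mul (by positivity)]
        exact ENNReal.ofReal_le_ofReal hx

/-- The reverse Hölder type estimate for `h(v)`. -/
theorem LocalData.step (H : LocalData σ k K C η d Ω Q y r M f v G m)
    (hχ : IsCutoff Q (dball d Ω y r) χ ω Γ)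
    (hd : ∀ t, m ≤ t → HasDerivAt h (h' t) t) (hc : ContinuousOn h' (Ici m))
    (hb : ∀ t, m ≤ t → |h' t| ≤ Λ) (hpos : ∀ t, m ≤ t → 0 ≤ h t) (hs : |s| = 1)
    (hΦ0 : ∀ t, m ≤ t → 0 ≤ Φ t) (hΦ : ∀ t, m ≤ t → Φ t ≤ h t * |h' t|)
    (hΦ' : ∀ t, m ≤ t → h' t ^ 2 ≤ s * Φ' t) (hb0 : 0 ≤ b)
    (hth : ∀ t, m ≤ t → t * |h' t| ≤ b * h t)
    (hE : EnergyIneq Ω M f v G s χ Φ Φ') :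
    ((volume (dball d Ω y r))⁻¹ *
        ∫⁻ x in dball d Ω y r, ENNReal.ofReal (χ x * h (v x)) ^ (2 * σ)) ^ (1 / σ) ≤
      ENNReal.ofReal (16 * C ^ 2 * ((2 + 8 * (K / k)) * (r ^ 2 * Γ) + 4 * (b / k) + 1)) *
        ((volume (dball d Ω y r))⁻¹ *
          ∫⁻ x in dball d Ω y r, ENNReal.ofReal (ω x * h (v x) ^ 2)) := by
  obtain ⟨F, F', hF, hF'c, hF'b, hFeq⟩ := exists_extension hd hc hb
  have hle := H.restrict_le
  have hvB := ae_mono hle H.le_v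
  have hK := H.K_nonneg
  have hk := H.k_pos
  have hΓ := hχ.Γ_nonneg
  have hr := H.admits.2.1
  have hΛ : 0 ≤ Λ := (abs_nonneg _).trans (hF'b 0)
  have hBm := H.isOpen_ball.measurableSet
  have hfin : volume Ω < ∞ := H.bounded.measure_lt_top
  have hcacc := H.caccioppoli hχ hF hF'c hF'b (fun t ht => by rw [(hFeq t ht).1]; exact hpos t ht)
    hs hΦ0 (fun t ht => by rw [(hFeq t ht).1, (hFeq t ht).2]; exact hΦ t ht)
    (fun t ht => by rw [(hFeq t ht).2]; exact hΦ' t ht) hb0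
    (fun t ht => by rw [(hFeq t ht).1, (hFeq t ht).2]; exact hth t ht) hE
  have hmem := H.memW.memW0_mul_comp H.isOpen hfin (U := dball d Ω y r) dball_subset
    H.aemeasurable_Q H.psdQ hχ.mem (fun x => by
      rw [abs_of_nonneg (hχ.nonneg x)]; exact hχ.le_one x) (hχ.quad_le hBm) hF hF'c hF'b
  have hsob := H.sobolev.normalized H.one_lt H.C_nonneg H.isOpen H.bounded H.metric H.containment
    H.locInt H.psdQ H.admits hmem (by
      filter_upwards [hvB] with x hx
      rw [(hFeq _ hx).1]
      exact mul_nonneg (hχ.nonneg x) (hpos _ hx))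
  set B := dball d Ω y r with hBdef
  have hpB : ∀ᵐ x ∂volume.restrict B, (Q x).PosSemidef := ae_mono hle H.psdQ
  have hI : ∫⁻ x in B, ENNReal.ofReal (ω x * F (v x) ^ 2) =
      ∫⁻ x in B, ENNReal.ofReal (ω x * h (v x) ^ 2) := by
    refine lintegral_congr_ae ?_
    filter_upwards [hvB] with x hx
    rw [(hFeq _ hx).1]
  have hJ : ∫⁻ x in B, ENNReal.ofReal (χ x * F (v x)) ^ (2 * σ) =
      ∫⁻ x in B, ENNReal.ofReal (χ x * h (v x)) ^ (2 * σ) := by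
    refine lintegral_congr_ae ?_
    filter_upwards [hvB] with x hx
    rw [(hFeq _ hx).1]
  rw [hJ] at hsob
  rw [hI] at hcacc
  set I := ∫⁻ x in B, ENNReal.ofReal (ω x * h (v x) ^ 2) with hIdef
  set D := ∫⁻ x in B, ENNReal.ofReal (χ x ^ 2 * F' (v x) ^ 2 * quad (Q x) (G x)) with hD
  have hsq : ∫⁻ x in B, ENNReal.ofReal ((χ x * F (v x)) ^ 2) ≤ I := by
    rw [← hI]
    refine lintegral_mono fun x => ENNReal.ofReal_le_ofReal ?_
    rw [mul_pow]
    gcongr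
    exact hχ.sq_le x
  have hgr : ∫⁻ x in B, ENNReal.ofReal (quad (Q x) (F (v x) • gradient χ x +
      (χ x * F' (v x)) • G x)) ≤ 2 * (ENNReal.ofReal Γ * I) + 2 * D := by
    have hFm : AEStronglyMeasurable (fun x => F (v x)) (volume.restrict B) :=
      (lipschitzWith_of_hasDerivAt hΛ hF hF'b).continuous.comp_aestronglyMeasurable
        (H.memW.1.mono_measure hle)
    refine (lintegral_quad_add_le (fun i j => (H.aemeasurable_Q i j).mono_measure hle) hpB
      (hFm.smul (measurable_gradient χ).aestronglyMeasurable)).trans ?_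
    gcongr
    · rw [← hI, ← lintegral_const_mul' _ _ (by finiteness)]
      refine lintegral_mono_ae ?_
      filter_upwards [hχ.grad] with x hx
      change ENNReal.ofReal (quad (Q x) (F (v x) • gradient χ x)) ≤ _
      rw [← ENNReal.ofReal_mul hΓ, quad_smul]
      refine ENNReal.ofReal_le_ofReal ?_
      calc _ ≤ F (v x) ^ 2 * (Γ * ω x) := by gcongr
        _ = _ := by ring
    · refine lintegral_mono fun x => ENNReal.ofReal_le_ofReal ?_
      rw [quad_smul, mul_pow]
  -- Caccioppoli's inequality divided by `k / 2`; the factor `r²` of the Sobolev inequality later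
  -- cancels the `1 / r²` coming from `f`.
  have hD' : D ≤ ENNReal.ofReal (2 / k * (2 * K * Γ + b * (1 / r ^ 2))) * I := by
    rw [ENNReal.ofReal_mul (by positivity), mul_assoc]
    calc D = ENNReal.ofReal (2 / k) * (ENNReal.ofReal (k / 2) * D) := by
          rw [← mul_assoc, ← ENNReal.ofReal_mul (by positivity), div_mul_div_cancel₀ hk.ne',
            div_self two_ne_zero, ENNReal.ofReal_one, one_mul]
      _ ≤ _ := by gcongr
  have hconst : ENNReal.ofReal (16 * C ^ 2) * (ENNReal.ofReal (r ^ 2) * (2 * ENNReal.ofReal Γ +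
      2 * ENNReal.ofReal (2 / k * (2 * K * Γ + b * (1 / r ^ 2)))) + 1) =
      ENNReal.ofReal (16 * C ^ 2 * ((2 + 8 * (K / k)) * (r ^ 2 * Γ) + 4 * (b / k) + 1)) := by
    have h2 : (2 : ℝ≥0∞) = ENNReal.ofReal 2 := by simp
    have h1 : (1 : ℝ≥0∞) = ENNReal.ofReal 1 := by simp
    rw [h2, h1, ← ENNReal.ofReal_mul zero_le_two, ← ENNReal.ofReal_mul zero_le_two,
      ← ENNReal.ofReal_add (by positivity) (by positivity), ← ENNReal.ofReal_mul (by positivity),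
      ← ENNReal.ofReal_add (by positivity) (by positivity), ← ENNReal.ofReal_mul (by positivity)]
    congr 1
    field_simp
    ring
  refine hsob.trans ?_
  calc _ ≤ ENNReal.ofReal (16 * C ^ 2) * ((volume B)⁻¹ * (ENNReal.ofReal (r ^ 2) *
        (2 * (ENNReal.ofReal Γ * I) +
          2 * (ENNReal.ofReal (2 / k * (2 * K * Γ + b * (1 / r ^ 2))) * I)) + I)) := by
        gcongr
        exact hgr.trans (by gcongr)
    _ = ENNReal.ofReal (16 * C ^ 2) * (ENNReal.ofReal (r ^ 2) * (2 * ENNReal.ofReal Γ +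
          2 * ENNReal.ofReal (2 / k * (2 * K * Γ + b * (1 / r ^ 2)))) + 1) *
          ((volume B)⁻¹ * I) := by ring
    _ = _ := by
        rw [hconst]

end

end Degenerate

namespace Degenerate

variable {n : ℕ} {Q : E n → Mat n} {Ω U : Set (E n)} {u : E n → ℝ} {g : E n → E n}

/-! ### Truncated powers -/

/-- The power `t ^ β`, modified to grow linearly at infinity. -/
noncomputable def tpow (β ε t : ℝ) : ℝ := t ^ β * (1 + ε * t) ^ (1 - β)

/-- The first derivative of `tpow`. -/
noncomputable def tpow' (β ε t : ℝ) : ℝ := tpow β ε t / t * (1 + (β - 1) / (1 + ε * t))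

/-- The second derivative of `tpow`. -/
noncomputable def tpow'' (β ε t : ℝ) : ℝ :=
  tpow β ε t / t ^ 2 * (((β - 1) / (1 + ε * t)) ^ 2 + (β - 1) / (1 + ε * t) / (1 + ε * t))

section

variable {β ε t : ℝ}

theorem tpow_pos (hε : 0 ≤ ε) (ht : 0 < t) : 0 < tpow β ε t := by unfold tpow; positivity

theorem hasDerivAt_tpow (hε : 0 ≤ ε) (ht : 0 < t) :
    HasDerivAt (tpow β ε) (tpow' β ε t) t := by
  have h0 : (0 : ℝ) < 1 + ε * t := by positivity
  have h1 := (Real.hasDerivAt_rpow_const (x := t) (p := β) (Or.inl ht.ne'))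
  have h2 := (((hasDerivAt_id t).const_mul ε).const_add 1).rpow_const (p := 1 - β) (Or.inl h0.ne')
  refine (h1.mul h2).congr_deriv ?_
  simp only [tpow', tpow, id]
  rw [Real.rpow_sub ht, Real.rpow_one, Real.rpow_sub h0, Real.rpow_sub h0, Real.rpow_sub h0]
  simp only [Real.rpow_one]
  field_simp
  ring

theorem hasDerivAt_tpow' (hε : 0 ≤ ε) (ht : 0 < t) :
    HasDerivAt (tpow' β ε) (tpow'' β ε t) t := by
  have h0 : (0 : ℝ) < 1 + ε * t := by positivity
  have h1 := ((hasDerivAt_tpow (β := β) hε ht).div (hasDerivAt_id t) ht.ne').mul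
    (((hasDerivAt_const t (β - 1)).div (((hasDerivAt_id t).const_mul ε).const_add 1)
      h0.ne').const_add 1)
  refine h1.congr_deriv ?_
  simp only [tpow', tpow'', id, Pi.div_apply]
  field_simp
  ring

/-- With `ρ = (β-1)/(1+εt)` the logarithmic derivative of `h = tpow β ε` satisfies `t h'/h = 1 + ρ`.
The bounds `0 ≤ ρ ≤ β - 1` yield monotonicity, convexity and `t h' ≤ β h`, the last with a constant
independent of `ε`. -/
theorem tpow_ratio_mem (hβ : 1 ≤ β) (hε : 0 ≤ ε) (ht : 0 < t) :
    0 ≤ (β - 1) / (1 + ε * t) ∧ (β - 1) / (1 + ε * t) ≤ β - 1 := by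
  have h0 : (1 : ℝ) ≤ 1 + ε * t := by nlinarith [mul_nonneg hε ht.le]
  exact ⟨div_nonneg (by linarith) (by linarith), div_le_self (by linarith) h0⟩

/-- Here `tpow β ε t = (t/(1+εt))^(β-1) t`, and the base is at most `1/ε`. -/
theorem tpow_le_mul (hβ : 1 ≤ β) (hε : 0 < ε) (ht : 0 < t) :
    tpow β ε t ≤ (1 / ε) ^ (β - 1) * t := by
  have h0 : (0 : ℝ) < 1 + ε * t := by positivity
  have h1 : tpow β ε t = (t / (1 + ε * t)) ^ (β - 1) * t := by
    unfold tpow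
    rw [Real.div_rpow ht.le h0.le, show (1 - β) = -(β - 1) by ring, Real.rpow_neg h0.le,
      Real.rpow_sub_one ht.ne']
    field_simp
  rw [h1]
  refine mul_le_mul_of_nonneg_right (Real.rpow_le_rpow (by positivity) ?_ (by linarith)) ht.le
  rw [div_le_div_iff₀ h0 hε]
  linarith

theorem tpow'_nonneg (hβ : 1 ≤ β) (hε : 0 ≤ ε) (ht : 0 < t) : 0 ≤ tpow' β ε t := by
  have := (tpow_ratio_mem hβ hε ht).1
  have := tpow_pos (β := β) hε ht
  unfold tpow'; positivity

theorem mul_tpow'_le (hβ : 1 ≤ β) (hε : 0 ≤ ε) (ht : 0 < t) :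
    t * tpow' β ε t ≤ β * tpow β ε t := by
  have h1 := (tpow_ratio_mem hβ hε ht).2
  have h2 := tpow_pos (β := β) hε ht
  have h3 : t * tpow' β ε t = (1 + (β - 1) / (1 + ε * t)) * tpow β ε t := by
    unfold tpow'; field_simp
  rw [h3]
  gcongr
  linarith

theorem tpow'_le (hβ : 1 ≤ β) (hε : 0 < ε) (ht : 0 < t) :
    tpow' β ε t ≤ β * (1 / ε) ^ (β - 1) := by
  have h1 := mul_tpow'_le hβ hε.le ht
  have h2 := tpow_le_mul hβ hε ht
  have h3 : t * tpow' β ε t ≤ t * (β * (1 / ε) ^ (β - 1)) :=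
    h1.trans (by nlinarith)
  exact le_of_mul_le_mul_left h3 ht

theorem tpow''_nonneg (hβ : 1 ≤ β) (hε : 0 ≤ ε) (ht : 0 < t) : 0 ≤ tpow'' β ε t := by
  have := (tpow_ratio_mem hβ hε ht).1
  have := tpow_pos (β := β) hε ht
  unfold tpow''; positivity

theorem mul_tpow''_le (hβ : 1 ≤ β) (hε : 0 < ε) (ht : 0 < t) :
    t * tpow'' β ε t ≤ β ^ 2 * (1 / ε) ^ (β - 1) := by
  obtain ⟨h1, h1'⟩ := tpow_ratio_mem hβ hε.le ht
  have h2 := tpow_le_mul hβ hε ht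
  have h0 : (1 : ℝ) ≤ 1 + ε * t := by nlinarith [mul_nonneg hε.le ht.le]
  have h3 := tpow_pos (β := β) hε.le ht
  have h4 : (β - 1) / (1 + ε * t) / (1 + ε * t) ≤ β - 1 :=
    (div_le_self h1 h0).trans h1'
  have h5 : ((β - 1) / (1 + ε * t)) ^ 2 + (β - 1) / (1 + ε * t) / (1 + ε * t) ≤ β ^ 2 := by
    have : ((β - 1) / (1 + ε * t)) ^ 2 ≤ (β - 1) ^ 2 := by gcongr
    nlinarith
  have h6 : tpow β ε t / t ≤ (1 / ε) ^ (β - 1) := by rwa [div_le_iff₀ ht]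
  calc t * tpow'' β ε t = tpow β ε t / t *
        (((β - 1) / (1 + ε * t)) ^ 2 + (β - 1) / (1 + ε * t) / (1 + ε * t)) := by
        unfold tpow''; field_simp
    _ ≤ (1 / ε) ^ (β - 1) * β ^ 2 := by gcongr
    _ = _ := mul_comm _ _

theorem tpow_le_rpow (hβ : 1 ≤ β) (hε : 0 ≤ ε) (ht : 0 < t) : tpow β ε t ≤ t ^ β := by
  have h0 : (1 : ℝ) ≤ 1 + ε * t := by nlinarith [mul_nonneg hε ht.le]
  unfold tpow
  exact mul_le_of_le_one_right (by positivity) (Real.rpow_le_one_of_one_le_of_nonpos h0 (by linarith))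

theorem tendsto_tpow (β t : ℝ) :
    Tendsto (fun j : ℕ => tpow β (1 / ((j : ℝ) + 1)) t) atTop (𝓝 (t ^ β)) := by
  have h1 := (tendsto_one_div_add_atTop_nhds_zero_nat (𝕜 := ℝ)).mul_const t |>.const_add 1
  rw [zero_mul, add_zero] at h1
  have h2 := (h1.rpow_const (p := 1 - β) (Or.inl one_ne_zero)).const_mul (t ^ β)
  rw [Real.one_rpow, mul_one] at h2
  exact h2

/-- Linear growth bounds `h'` and `t h''`; the bound on `h''` itself uses that `t` stays above `m`.
-/
theorem admissible_tpow (hβ : 1 ≤ β) (hε : 0 < ε) {m : ℝ} (hm : 0 < m) :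
    Admissible (Ici m) (tpow β ε) (tpow' β ε) (tpow'' β ε) := by
  have hpos : ∀ t ∈ Ici m, 0 < t := fun t ht => hm.trans_le ht
  have hc : 0 ≤ (1 / ε) ^ (β - 1) := by positivity
  refine ⟨ordConnected_Ici, fun t ht => tpow_pos hε.le (hpos t ht), Or.inl ?_,
    fun t ht => (hasDerivAt_tpow hε.le (hpos t ht)).hasDerivWithinAt,
    fun t ht => (hasDerivAt_tpow' hε.le (hpos t ht)).continuousAt.continuousWithinAt, ∅,
    fun t ht => (hasDerivAt_tpow' hε.le (hpos t ht.1)).hasDerivWithinAt, ?_, by simp,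
    max (β * (1 / ε) ^ (β - 1)) (max (β ^ 2 * (1 / ε) ^ (β - 1) / m) (β ^ 2 * (1 / ε) ^ (β - 1))),
    fun t ht => ?_, fun t ht => ?_⟩
  · refine monotoneOn_of_deriv_nonneg (convex_Ici m)
      (fun t ht => (hasDerivAt_tpow hε.le (hpos t ht)).continuousAt.continuousWithinAt)
      (fun t ht => (hasDerivAt_tpow hε.le
        (hpos t (interior_subset ht))).differentiableAt.differentiableWithinAt) fun t ht => ?_
    rw [(hasDerivAt_tpow hε.le (hpos t (interior_subset ht))).deriv]
    exact tpow'_nonneg hβ hε.le (hpos t (interior_subset ht))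
  · intro t ht
    have ht0 : 0 < t := hpos t ht.1
    have h0 : (1 : ℝ) + ε * t ≠ 0 := by positivity
    have h1 : ContinuousAt (tpow β ε) t := (hasDerivAt_tpow hε.le ht0).continuousAt
    have h2 : ContinuousAt (fun t => (β - 1) / (1 + ε * t)) t :=
      ContinuousAt.div (by fun_prop) (by fun_prop) h0
    have h3 : ContinuousAt (tpow'' β ε) t :=
      (h1.div (by fun_prop) (by positivity)).mul ((h2.pow 2).add (h2.div (by fun_prop) h0))
    exact h3.continuousWithinAt
  · have h1 := tpow'_le hβ hε (hpos t ht)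
    rw [abs_of_nonneg (tpow'_nonneg hβ hε.le (hpos t ht))]
    exact h1.trans (le_max_left _ _)
  · have ht0 := hpos t ht.1
    have hmt : m ≤ t := ht.1
    have h1 := mul_tpow''_le hβ hε ht0
    have h2 := tpow''_nonneg hβ hε.le ht0
    rw [abs_of_nonneg h2, abs_of_nonneg (mul_nonneg ht0.le h2)]
    refine ⟨le_trans ?_ ((le_max_left _ _).trans (le_max_right _ _)),
      h1.trans ((le_max_right _ _).trans (le_max_right _ _))⟩
    rw [le_div_iff₀ hm]
    nlinarith

end

/-! ### The energy inequalities for solutions and subsolutions -/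

section

variable {M : E n → Mat n} {f v : E n → ℝ} {G : E n → E n} {B : Set (E n)} {m : ℝ}

/-- The inequalities obtained by testing with `χ² h(v) h'(v)`, where `h` is a truncated power
with exponent `β ≥ 1`. -/
def SubEnergy (Q : E n → Mat n) (Ω B : Set (E n)) (M : E n → Mat n) (f v : E n → ℝ)
    (G : E n → E n) : Prop :=
  ∀ (χ ω : E n → ℝ) (Γ : ℝ), IsCutoff Q B χ ω Γ → ∀ β ε : ℝ, 1 ≤ β → 0 < ε →
    EnergyIneq Ω M f v G 1 χ (fun t => tpow β ε t * tpow' β ε t)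
      (fun t => tpow' β ε t ^ 2 + tpow β ε t * tpow'' β ε t)

/-- The inequalities obtained by testing with `χ² v^(2β-1)`, where `β ≤ 1/4`. -/
def SuperEnergy (Q : E n → Mat n) (Ω B : Set (E n)) (M : E n → Mat n) (f v : E n → ℝ)
    (G : E n → E n) : Prop :=
  ∀ (χ ω : E n → ℝ) (Γ : ℝ), IsCutoff Q B χ ω Γ → ∀ β : ℝ, β ≤ 1 / 4 → β ≠ 0 →
    EnergyIneq Ω M f v G (-1) χ (fun t => β ^ 2 / (1 - 2 * β) * t ^ (2 * β - 1))
      (fun t => -(β ^ 2 * t ^ (2 * β - 2)))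

/-- The class `𝒜[v]` consists of precisely such tests: the derivative of `h h'` is `h'² + h h''`. -/
theorem SubsolvesOn.subEnergy {A : E n → ℝ → Mat n}
    (h : SubsolvesOn Ω A f (classA Ω v G) v G) (hBΩ : B ⊆ Ω) (hm : 0 < m)
    (hv : ∀ᵐ x ∂volume.restrict Ω, m ≤ v x) :
    SubEnergy Q Ω B (fun x => A x (v x)) f v G := by
  intro χ ω Γ hχ β ε hβ hε
  obtain ⟨h1, h2, h3⟩ := h (_, _) ⟨χ, Ici m, tpow β ε, tpow' β ε, tpow'' β ε,
    ⟨hχ.mem.1, hχ.mem.2.1, hχ.mem.2.2.trans hBΩ⟩, admissible_tpow hβ hε hm, hv,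
    fun t ht => tpow'_nonneg hβ hε.le (hm.trans_le ht), rfl, rfl⟩
  refine ⟨h1, h2, ?_⟩
  linarith

/-- Equality holds for every nonnegative test, so either sign `s` is allowed. The gradient of `v` is
that of `u`, while the matrix stays frozen at `u`; a shift of the solution therefore does not affect
the coefficients. -/
theorem SolvesOn.energyIneq {A : E n → ℝ → Mat n}
    (h : SolvesOn Ω A f (nonnegTests Q Ω) u G) (hΩ : IsOpen Ω) (hfin : volume Ω < ∞)
    (hQ : ∀ i j, AEMeasurable (fun x => Q x i j) (volume.restrict Ω))
    (hp : ∀ᵐ x ∂volume.restrict Ω, (Q x).PosSemidef) (hB : MeasurableSet B) (hBΩ : B ⊆ Ω)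
    (hmem : MemW Q Ω v G) (hv : ∀ᵐ x ∂volume.restrict Ω, m ≤ v x)
    {χ ω : E n → ℝ} {Γ : ℝ} (hχ : IsCutoff Q B χ ω Γ) {Φ Φ' : ℝ → ℝ} {C : ℝ}
    (hd : ∀ t, m ≤ t → HasDerivAt Φ (Φ' t) t) (hc : ContinuousOn Φ' (Ici m))
    (hb : ∀ t, m ≤ t → |Φ' t| ≤ C) (h0 : ∀ t, m ≤ t → 0 ≤ Φ t) (s : ℝ) :
    EnergyIneq Ω (fun x => A x (u x)) f v G s χ Φ Φ' := by
  obtain ⟨F, F', hF, hF'c, hF'b, hFeq⟩ := exists_extension hd hc hb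
  obtain ⟨L, hL⟩ := hχ.mem.1
  have hχ1 : ∀ x, |χ x| ≤ 1 := fun x => by rw [abs_of_nonneg (hχ.nonneg x)]; exact hχ.le_one x
  -- The test `χ² Φ(v)` is obtained from the product rule with the cutoff `χ · χ`.
  have hmem2 : (fun x => χ x * χ x) ∈ LipC Ω :=
    ⟨LipschitzWith.mul_of_hasCompactSupport hL hχ.mem.2.1 hL, hχ.mem.2.1.mul_right,
      tsupport_mul_subset_left.trans (hχ.mem.2.2.trans hBΩ)⟩
  have hgrad : ∀ᵐ x ∂volume.restrict Ω,
      gradient (fun x => χ x * χ x) x = (2 * χ x) • gradient χ x := by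
    filter_upwards [ae_hasGradientAt hΩ (hL.lipschitzOnWith (s := Ω))] with x hx
    rw [(hasGradientAt_mul hx hx).gradient]; module
  have hΓ4 : ∀ᵐ x ∂volume.restrict Ω, quad (Q x) (gradient (fun x => χ x * χ x) x) ≤ 4 * Γ := by
    filter_upwards [hgrad, hχ.quad_le hB, hp] with x hx hx2 hx3
    rw [hx, quad_smul, mul_pow]
    have h1 := quad_nonneg hx3 (gradient χ x)
    have h2 : χ x ^ 2 ≤ 1 := pow_le_one₀ (hχ.nonneg x) (hχ.le_one x)
    nlinarith
  have hW := hmem.memW0_mul_comp hΩ hfin subset_rfl hQ hp hmem2 (fun x => by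
    rw [abs_mul]; exact mul_le_one₀ (hχ1 x) (abs_nonneg _) (hχ1 x)) hΓ4 hF hF'c hF'b
  obtain ⟨h1, h2, h3⟩ := h (_, _) ⟨hW, by
    filter_upwards [hv] with x hx
    rw [(hFeq _ hx).1]
    exact mul_nonneg (mul_self_nonneg _) (h0 _ hx)⟩
  have e1 : (fun x => bil (A x (u x)) (G x) (F (v x) • gradient (fun x => χ x * χ x) x +
      (χ x * χ x * F' (v x)) • G x)) =ᵐ[volume.restrict Ω] fun x => bil (A x (u x)) (G x)
      ((2 * χ x * Φ (v x)) • gradient χ x + (χ x ^ 2 * Φ' (v x)) • G x) := by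
    filter_upwards [hgrad, hv] with x hx hx2
    rw [hx, (hFeq _ hx2).1, (hFeq _ hx2).2, smul_smul]
    congr 3 <;> ring
  have e2 : (fun x => f x * (χ x * χ x * F (v x))) =ᵐ[volume.restrict Ω]
      fun x => f x * (χ x ^ 2 * Φ (v x)) := by
    filter_upwards [hv] with x hx
    rw [(hFeq _ hx).1, sq]
  refine ⟨h1.congr e1, h2.congr e2, ?_⟩
  rw [← integral_congr_ae e1, ← integral_congr_ae e2]
  dsimp only at h3
  rw [← h3, add_neg_cancel, mul_zero]

/-- The factor `β²/(1-2β)` is chosen so that the derivative of the test profile is exactly `-(h')²`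
for `h(t) = t^β`. That derivative is bounded on `[m, ∞)` because `2β - 2 < 0`, so no truncation is
needed. -/
theorem SolvesOn.superEnergy {A : E n → ℝ → Mat n}
    (h : SolvesOn Ω A f (nonnegTests Q Ω) u G) (hΩ : IsOpen Ω) (hfin : volume Ω < ∞)
    (hQ : ∀ i j, AEMeasurable (fun x => Q x i j) (volume.restrict Ω))
    (hp : ∀ᵐ x ∂volume.restrict Ω, (Q x).PosSemidef) (hB : MeasurableSet B) (hBΩ : B ⊆ Ω)
    (hmem : MemW Q Ω v G) (hm : 0 < m) (hv : ∀ᵐ x ∂volume.restrict Ω, m ≤ v x) :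
    SuperEnergy Q Ω B (fun x => A x (u x)) f v G := by
  intro χ ω Γ hχ β hβ hβ0
  have h12 : 0 < 1 - 2 * β := by linarith
  refine h.energyIneq hΩ hfin hQ hp hB hBΩ hmem hv hχ (C := β ^ 2 * m ^ (2 * β - 2))
    (fun t ht => ?_) ?_ (fun t ht => ?_) (fun t ht => ?_) (-1)
  · have ht0 : 0 < t := hm.trans_le ht
    refine ((Real.hasDerivAt_rpow_const (Or.inl ht0.ne')).const_mul _).congr_deriv ?_
    have h12' := h12.ne'
    rw [show 2 * β - 1 - 1 = 2 * β - 2 by ring, show 2 * β - 1 = -(1 - 2 * β) by ring,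
      ← mul_assoc, mul_neg, div_mul_cancel₀ _ h12', neg_mul]
  · refine (continuousOn_const.mul (ContinuousOn.rpow_const continuousOn_id fun t ht =>
      Or.inl ?_)).neg
    exact (hm.trans_le ht).ne'
  · have ht0 : 0 < t := hm.trans_le ht
    rw [abs_neg, abs_of_nonneg (by positivity)]
    gcongr ?_ * ?_
    exact Real.rpow_le_rpow_of_nonpos hm ht (by linarith)
  · have ht0 : 0 < t := hm.trans_le ht
    positivity

theorem SolvesOn.subEnergy {A : E n → ℝ → Mat n}
    (h : SolvesOn Ω A f (nonnegTests Q Ω) u G) (hΩ : IsOpen Ω) (hfin : volume Ω < ∞)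
    (hQ : ∀ i j, AEMeasurable (fun x => Q x i j) (volume.restrict Ω))
    (hp : ∀ᵐ x ∂volume.restrict Ω, (Q x).PosSemidef) (hB : MeasurableSet B) (hBΩ : B ⊆ Ω)
    (hmem : MemW Q Ω v G) (hm : 0 < m) (hv : ∀ᵐ x ∂volume.restrict Ω, m ≤ v x) :
    SubEnergy Q Ω B (fun x => A x (u x)) f v G := by
  intro χ ω Γ hχ β ε hβ hε
  have hpos : ∀ t, m ≤ t → 0 < t := fun t ht => hm.trans_le ht
  set c := (1 / ε) ^ (β - 1) with hc
  have hc0 : 0 ≤ c := by positivity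
  refine h.energyIneq hΩ hfin hQ hp hB hBΩ hmem hv hχ (C := (β * c) ^ 2 + c * (β ^ 2 * c))
    (fun t ht => ?_) ?_ (fun t ht => ?_) (fun t ht => ?_) 1
  · refine ((hasDerivAt_tpow hε.le (hpos t ht)).mul
      (hasDerivAt_tpow' hε.le (hpos t ht))).congr_deriv ?_
    ring
  · intro t ht
    have ht0 := hpos t ht
    have h0 : (1 : ℝ) + ε * t ≠ 0 := by positivity
    have h1 : ContinuousAt (tpow β ε) t := (hasDerivAt_tpow hε.le ht0).continuousAt
    have h1' : ContinuousAt (tpow' β ε) t := (hasDerivAt_tpow' hε.le ht0).continuousAt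
    have h2 : ContinuousAt (fun t => (β - 1) / (1 + ε * t)) t :=
      ContinuousAt.div (by fun_prop) (by fun_prop) h0
    have h3 : ContinuousAt (tpow'' β ε) t :=
      (h1.div (by fun_prop) (by positivity)).mul ((h2.pow 2).add (h2.div (by fun_prop) h0))
    exact ((h1'.pow 2).add (h1.mul h3)).continuousWithinAt
  · have ht0 := hpos t ht
    have h1 := tpow'_nonneg hβ hε.le ht0
    have h2 := tpow''_nonneg hβ hε.le ht0
    have h3 := tpow_pos (β := β) hε.le ht0
    rw [abs_of_nonneg (by positivity)]
    have h4 := tpow'_le hβ hε ht0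
    have h5 := mul_tpow''_le hβ hε ht0
    have h6 := tpow_le_mul hβ hε ht0
    refine add_le_add (pow_le_pow_left₀ h1 h4 2) ?_
    calc tpow β ε t * tpow'' β ε t ≤ (c * t) * tpow'' β ε t := by gcongr
      _ = c * (t * tpow'' β ε t) := by ring
      _ ≤ _ := by gcongr
  · exact mul_nonneg (tpow_pos hε.le (hpos t ht)).le (tpow'_nonneg hβ hε.le (hpos t ht))

end

end Degenerate

namespace Degenerate

/-! ### Moser iteration in a finite measure space -/

/-- By Chebyshev's inequality `{F ≥ e}` with `e > D` has measure at most `V (D/e)^(q k)`, which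
tends to zero as the exponents grow. -/
theorem ae_le_of_lintegral_rpow_le {α : Type*} [MeasurableSpace α] {μ : Measure α} {F : α → ℝ≥0∞}
    (hF : AEMeasurable F μ) {D V : ℝ≥0∞} (hV : V ≠ ∞) {q : ℕ → ℝ} (hq0 : ∀ k, 0 < q k)
    (hq : Tendsto q atTop atTop) (h : ∀ k, ∫⁻ x, F x ^ q k ∂μ ≤ V * D ^ q k) :
    ∀ᵐ x ∂μ, F x ≤ D := by
  by_cases hD : D = ∞
  · simp [hD]
  have key : ∀ j : ℕ, ∀ᵐ x ∂μ, F x ≤ D + ((j : ℝ≥0∞) + 1)⁻¹ := by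
    intro j
    set e : ℝ≥0∞ := D + ((j : ℝ≥0∞) + 1)⁻¹ with he
    have hj : ((j : ℝ≥0∞) + 1)⁻¹ ≠ 0 := by
      rw [ENNReal.inv_ne_zero]; finiteness
    have hDe : D < e := ENNReal.lt_add_right hD hj
    have he0 : e ≠ 0 := (bot_le.trans_lt hDe).ne'
    have hetop : e ≠ ∞ := by
      refine ENNReal.add_ne_top.2 ⟨hD, ?_⟩
      rw [ENNReal.inv_ne_top]; positivity
    have hlt : D / e < 1 := by
      rw [ENNReal.div_lt_iff (Or.inl he0) (Or.inl hetop), one_mul]; exact hDe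
    have hle : ∀ k, μ {x | e ≤ F x} ≤ V * (D / e) ^ q k := by
      intro k
      have h1 := mul_meas_ge_le_lintegral₀ (hF.pow_const (q k)) (e ^ q k)
      have h2 : {x | e ^ q k ≤ F x ^ q k} = {x | e ≤ F x} := by
        ext x; exact ENNReal.rpow_le_rpow_iff (hq0 k)
      rw [h2] at h1
      have he1 : e ^ q k ≠ 0 := by
        rw [Ne, ENNReal.rpow_eq_zero_iff]; simp [he0, hetop]
      have he2 : e ^ q k ≠ ∞ := ENNReal.rpow_ne_top_of_nonneg (hq0 k).le hetop
      rw [ENNReal.div_rpow_of_nonneg _ _ (hq0 k).le, ← mul_div_assoc,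
        ENNReal.le_div_iff_mul_le (Or.inl he1) (Or.inl he2), mul_comm]
      exact h1.trans (h k)
    have hlim : Tendsto (fun k => V * (D / e) ^ q k) atTop (𝓝 0) := by
      have h1 : Tendsto (fun k => (D / e) ^ q k) atTop (𝓝 0) :=
        (ENNReal.tendsto_rpow_atTop_of_base_lt_one hlt).comp hq
      have h2 := ENNReal.Tendsto.const_mul h1 (Or.inr hV)
      rwa [mul_zero] at h2
    have h0 : μ {x | e ≤ F x} = 0 := le_antisymm (ge_of_tendsto' hlim hle) bot_le
    have h3 : ∀ᵐ x ∂μ, ¬ e ≤ F x := by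
      rw [ae_iff]; simpa using h0
    filter_upwards [h3] with x hx using (not_le.1 hx).le
  filter_upwards [ae_all_iff.2 key] with x hx
  have hlim : Tendsto (fun j : ℕ => D + ((j : ℝ≥0∞) + 1)⁻¹) atTop (𝓝 (D + 0)) := by
    refine tendsto_const_nhds.add ?_
    have h1 := (tendsto_add_atTop_iff_nat (f := fun j : ℕ => ((j : ℝ≥0∞))⁻¹) 1).2
      ENNReal.tendsto_inv_nat_nhds_zero
    simpa using h1
  rw [add_zero] at hlim
  exact ge_of_tendsto' hlim hx

variable {α : Type*} [MeasurableSpace α] {μ : Measure α} {σ P : ℝ} {ψ v : α → ℝ}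

/-- The normalized weighted integral of `v ^ (2 β)` with weight `ψ ^ (2 κ - 2)`. -/
noncomputable def wint (μ : Measure α) (ψ v : α → ℝ) (κ β : ℝ) : ℝ≥0∞ :=
  (μ univ)⁻¹ * ∫⁻ x, ENNReal.ofReal (ψ x ^ (2 * κ - 2) * v x ^ (2 * β)) ∂μ

/-- The gain of integrability at the exponent `β`. -/
def GainAt (μ : Measure α) (σ P : ℝ) (ψ v : α → ℝ) (β : ℝ) : Prop :=
  ∀ κ, 1 ≤ κ → wint μ ψ v (σ * κ + 1) (σ * β) ≤
    (ENNReal.ofReal (P * κ ^ 2 * (1 + |β|)) * wint μ ψ v κ β) ^ σ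

/-- The setting of the iteration. -/
structure IterData (μ : Measure α) (σ P : ℝ) (ψ v : α → ℝ) : Prop where
  one_lt : 1 < σ
  one_le : 1 ≤ P
  ne_zero : μ univ ≠ 0
  ne_top : μ univ ≠ ∞
  meas_ψ : AEMeasurable ψ μ
  meas_v : AEMeasurable v μ
  nonneg : ∀ x, 0 ≤ ψ x
  le_one : ∀ x, ψ x ≤ 1
  pos : ∀ᵐ x ∂μ, 0 < v x
  sq_lt : ∫⁻ x, ENNReal.ofReal (v x ^ 2) ∂μ < ∞

/-- The exponents of the cutoff function along the iteration. -/
noncomputable def kap (σ κ : ℝ) (i : ℕ) : ℝ := σ ^ i * κ + (σ ^ i - 1) / (σ - 1)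

theorem kap_zero (σ κ : ℝ) : kap σ κ 0 = κ := by simp [kap]

/-- This recursion reflects `(ψ^κ)^(2σ) = ψ^(2(σκ+1)-2)`: the weight `ψ^(2κ-2)` returns in the same
form after each step. -/
theorem kap_succ (hσ : 1 < σ) (κ : ℝ) (i : ℕ) : kap σ κ (i + 1) = σ * kap σ κ i + 1 := by
  have : σ - 1 ≠ 0 := by linarith
  unfold kap
  field_simp
  ring

theorem one_le_kap (hσ : 1 < σ) {κ : ℝ} (hκ : 1 ≤ κ) (i : ℕ) : 1 ≤ kap σ κ i := by
  have h1 : 1 ≤ σ ^ i := one_le_pow₀ hσ.le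
  have h2 : 0 ≤ (σ ^ i - 1) / (σ - 1) := div_nonneg (by linarith) (by linarith)
  unfold kap
  nlinarith

theorem kap_le (hσ : 1 < σ) {κ : ℝ} (hκ : 1 ≤ κ) (i : ℕ) :
    kap σ κ i ≤ σ ^ i * (σ / (σ - 1) * κ) := by
  have h0 : 0 < σ - 1 := by linarith
  have h1 : 1 ≤ σ ^ i := one_le_pow₀ hσ.le
  have h2 : σ / (σ - 1) = 1 + 1 / (σ - 1) := by field_simp; ring
  have h3 : (σ ^ i - 1) / (σ - 1) ≤ σ ^ i * (1 / (σ - 1)) * κ := by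
    rw [div_eq_mul_one_div]
    have h4 : 0 < 1 / (σ - 1) := by positivity
    calc (σ ^ i - 1) * (1 / (σ - 1)) ≤ σ ^ i * (1 / (σ - 1)) := by gcongr; linarith
      _ ≤ _ := le_mul_of_one_le_right (by positivity) hκ
  unfold kap
  rw [h2]
  linarith

/-- The constant of the iteration. -/
noncomputable def iterConst (σ P κ β : ℝ) : ℝ :=
  (P * ((σ / (σ - 1) * κ) ^ 2 * (1 + |β|))) ^ (σ / (σ - 1)) *
    (σ ^ 3) ^ (σ / (σ - 1) / (σ - 1))

/-- The infinite product of step constants is replaced by an invariant. The exponents `a = σ/(σ-1)`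
and `c = a/(σ-1)` solve `aσ = a + σ` and `cσ = a + c`, so multiplying by `(p q^k)^σ` and moving `k`
to `k + 1` is the same as raising to the power `σ`. -/
theorem iterate_identity {p q a σ c : ℝ} (hp0 : 0 < p) (hq0 : 0 < q) (haσ : a * σ = a + σ)
    (hcσ : c * σ = a + c) (k : ℕ) :
    p ^ a * q ^ c * q ^ (a * ((k + 1 : ℕ) : ℝ)) * (p * q ^ k) ^ σ =
      (p ^ a * q ^ c * q ^ (a * (k : ℝ))) ^ σ := by
  rw [Real.mul_rpow (by positivity) (by positivity),
    Real.mul_rpow (by positivity) (by positivity),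
    Real.mul_rpow (by positivity) (by positivity), ← Real.rpow_mul hp0.le,
    ← Real.rpow_mul hq0.le, ← Real.rpow_natCast q k, ← Real.rpow_mul hq0.le,
    ← Real.rpow_mul hq0.le, haσ, hcσ, Real.rpow_add hp0, Real.rpow_add hq0,
    show a * (k : ℝ) * σ = (k : ℝ) * (a * σ) by ring, haσ]
  push_cast
  rw [mul_add a, mul_one, Real.rpow_add hq0, mul_add (k : ℝ), Real.rpow_add hq0,
    mul_comm (k : ℝ) a]
  ring

/-- The surplus factor on the left makes the induction close exactly. It is also what later pays for
a change of method after `k` steps. -/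
theorem iterate_gain (H : IterData μ σ P ψ v) {κ β : ℝ} (hκ : 1 ≤ κ) (k : ℕ)
    (h : ∀ i < k, GainAt μ σ P ψ v (σ ^ i * β)) :
    ENNReal.ofReal (iterConst σ P κ β * (σ ^ 3) ^ (σ / (σ - 1) * k)) *
      wint μ ψ v (kap σ κ k) (σ ^ k * β) ≤
      (ENNReal.ofReal (iterConst σ P κ β) * wint μ ψ v κ β) ^ (σ ^ k) := by
  have hσ := H.one_lt
  have hσ0 : 0 < σ := by linarith
  have hσ1 : 0 < σ - 1 := by linarith
  have hP := H.one_le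
  set a := σ / (σ - 1) with ha
  have ha0 : 0 < a := by positivity
  have haσ : a * σ = a + σ := by rw [ha]; field_simp; ring
  set p := P * ((a * κ) ^ 2 * (1 + |β|)) with hp
  have hp0 : 0 < p := by positivity
  have hq0 : 0 < σ ^ 3 := by positivity
  have hcσ : a / (σ - 1) * σ = a + a / (σ - 1) := by field_simp; ring
  have hit : iterConst σ P κ β = p ^ a * (σ ^ 3) ^ (a / (σ - 1)) := rfl
  have hit0 : 0 < iterConst σ P κ β := by rw [hit]; positivity
  induction k with
  | zero => simp [kap_zero]
  | succ k ih =>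
    have ih := ih fun i hi => h i (by omega)
    have hg := h k (by omega) (kap σ κ k) (one_le_kap hσ hκ k)
    -- Two powers of `σ^k` come from the cutoff exponent and one from `β`, hence the base `σ³`.
    have hk : P * kap σ κ k ^ 2 * (1 + |σ ^ k * β|) ≤ p * (σ ^ 3) ^ k := by
      have h1 := kap_le hσ hκ k
      have h2 := one_le_kap hσ hκ k
      have h3 : (1 : ℝ) ≤ σ ^ k := one_le_pow₀ hσ.le
      have h4 : 1 + |σ ^ k * β| ≤ σ ^ k * (1 + |β|) := by
        rw [abs_mul, abs_of_pos (by positivity)]; nlinarith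
      calc P * kap σ κ k ^ 2 * (1 + |σ ^ k * β|) ≤
            P * (σ ^ k * (a * κ)) ^ 2 * (σ ^ k * (1 + |β|)) := by gcongr
        _ = p * (σ ^ 3) ^ k := by rw [hp]; ring
    rw [kap_succ hσ, pow_succ' σ k, mul_assoc σ, mul_comm σ (σ ^ k), ENNReal.rpow_mul]
    refine le_trans ?_ (ENNReal.rpow_le_rpow ih hσ0.le)
    calc _ ≤ ENNReal.ofReal (iterConst σ P κ β * (σ ^ 3) ^ (a * ((k + 1 : ℕ) : ℝ))) *
          (ENNReal.ofReal (p * (σ ^ 3) ^ k) * wint μ ψ v (kap σ κ k) (σ ^ k * β)) ^ σ := by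
          gcongr
          exact hg.trans (ENNReal.rpow_le_rpow (by gcongr) hσ0.le)
      _ = _ := by
          rw [ENNReal.mul_rpow_of_nonneg _ _ hσ0.le, ENNReal.mul_rpow_of_nonneg _ _ hσ0.le,
            ← mul_assoc, ENNReal.ofReal_rpow_of_nonneg (by positivity) hσ0.le,
            ENNReal.ofReal_rpow_of_nonneg (by positivity) hσ0.le,
            ← ENNReal.ofReal_mul (by positivity), hit,
            iterate_identity hp0 hq0 haσ hcσ k]

theorem one_le_iterConst (hσ : 1 < σ) (hP : 1 ≤ P) {κ : ℝ} (hκ : 1 ≤ κ) (β : ℝ) :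
    1 ≤ iterConst σ P κ β := by
  have hσ1 : 0 < σ - 1 := by linarith
  have ha : 1 ≤ σ / (σ - 1) := by rw [one_le_div hσ1]; linarith
  unfold iterConst
  have h1 : 1 ≤ σ / (σ - 1) * κ := one_le_mul_of_one_le_of_one_le ha hκ
  have h2 : (1 : ℝ) ≤ 1 + |β| := by linarith [abs_nonneg β]
  refine one_le_mul_of_one_le_of_one_le (Real.one_le_rpow ?_ (by linarith))
    (Real.one_le_rpow (one_le_pow₀ hσ.le) (by positivity))
  exact one_le_mul_of_one_le_of_one_le hP
    (one_le_mul_of_one_le_of_one_le (one_le_pow₀ h1) h2)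

/-- The weight exponents divided by `σ^k` approach `2κ + 2/(σ-1)` from below, so since `ψ ≤ 1` the
limiting weight raised to `σ^k` is dominated by each weight of the iteration. -/
theorem ae_le_of_gain (H : IterData μ σ P ψ v) {κ β : ℝ} (hκ : 1 ≤ κ)
    (h : ∀ i : ℕ, GainAt μ σ P ψ v (σ ^ i * β)) :
    ∀ᵐ x ∂μ, ENNReal.ofReal (ψ x ^ (2 * κ + 2 / (σ - 1)) * v x ^ (2 * β)) ≤
      ENNReal.ofReal (iterConst σ P κ β) * wint μ ψ v κ β := by
  have hσ := H.one_lt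
  have hσ0 : 0 < σ := by linarith
  have hσ1 : 0 < σ - 1 := by linarith
  have hc := one_le_iterConst hσ H.one_le hκ β
  refine ae_le_of_lintegral_rpow_le (((H.meas_ψ.pow_const _).mul
    (H.meas_v.pow_const _)).ennreal_ofReal) H.ne_top (q := fun k : ℕ => σ ^ k)
    (fun k => by positivity) (tendsto_pow_atTop_atTop_of_one_lt hσ) fun k => ?_
  have h1 := iterate_gain H hκ k fun i _ => h i
  have h2 : wint μ ψ v (kap σ κ k) (σ ^ k * β) ≤
      (ENNReal.ofReal (iterConst σ P κ β) * wint μ ψ v κ β) ^ (σ ^ k) := by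
    refine le_trans (le_mul_of_one_le_left' ?_) h1
    rw [ENNReal.one_le_ofReal]
    refine one_le_mul_of_one_le_of_one_le hc (Real.one_le_rpow (one_le_pow₀ hσ.le) ?_)
    positivity
  calc _ ≤ ∫⁻ x, ENNReal.ofReal (ψ x ^ (2 * kap σ κ k - 2) * v x ^ (2 * (σ ^ k * β))) ∂μ := by
        refine lintegral_mono_ae ?_
        filter_upwards [H.pos] with x hx
        have hψ := H.nonneg x
        have hσk : (0 : ℝ) ≤ σ ^ k := by positivity
        simp only [Pi.mul_apply]
        rw [ENNReal.ofReal_rpow_of_nonneg (by positivity) hσk,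
          Real.mul_rpow (by positivity) (by positivity), ← Real.rpow_mul hψ, ← Real.rpow_mul hx.le]
        refine ENNReal.ofReal_le_ofReal ?_
        rw [show 2 * β * σ ^ k = 2 * (σ ^ k * β) by ring]
        refine mul_le_mul_of_nonneg_right ?_ (by positivity)
        refine Real.rpow_le_rpow_of_exponent_ge' hψ (H.le_one x) ?_ ?_
        · linarith [one_le_kap hσ hκ k]
        · have : (σ ^ k - 1) / (σ - 1) ≤ σ ^ k / (σ - 1) := by gcongr; linarith
          have e : (2 * κ + 2 / (σ - 1)) * σ ^ k = 2 * (σ ^ k * κ) + 2 * (σ ^ k / (σ - 1)) := by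
            ring
          rw [e]
          unfold kap
          linarith
    _ = μ univ * wint μ ψ v (kap σ κ k) (σ ^ k * β) := by
        unfold wint
        rw [← mul_assoc (μ univ), ENNReal.mul_inv_cancel H.ne_zero H.ne_top, one_mul]
    _ ≤ _ := by gcongr

/-- Let `N` be the supremum of `ψ^b v²`. The bound at exponent `1` gives `N ≤ c ∫ (weight) v²`, and
`v² = v^(2(1-β)) v^(2β)` bounds the integral by `N^(1-β)` times the one with `v^(2β)`. Dividing by
`N^(1-β)` gives the claim where `ψ = 1`. -/
theorem ae_le_of_gain_of_lt_one (H : IterData μ σ P ψ v) {κ β : ℝ} (hκ : 1 ≤ κ) (hβ : 1 / 4 ≤ β)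
    (hβ1 : β < 1) (h : ∀ β, 1 ≤ β → GainAt μ σ P ψ v β) :
    ∀ᵐ x ∂μ, ψ x = 1 → ENNReal.ofReal (v x ^ (2 * β)) ≤
      ENNReal.ofReal (iterConst σ P ((5 + 4 * (σ / (σ - 1))) * κ) 1) * wint μ ψ v κ β := by
  have hσ := H.one_lt
  have hσ1 : 0 < σ - 1 := by linarith
  set a := σ / (σ - 1) with ha
  have ha1 : 1 ≤ a := by rw [ha, one_le_div hσ1]; linarith
  have ha2 : 1 / (σ - 1) = a - 1 := by rw [ha]; field_simp; ring
  have hβ0 : 0 < β := by linarith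
  -- This value solves `2κ0 - 2 = b(1-β) + 2κ - 2` together with `2κ0 + 2/(σ-1) = b`, so the cutoff
  -- weights match exactly in the interpolation. The bound `β ≥ 1/4` keeps `b`, and hence `κ0`,
  -- under control.
  set b := (2 * a + 2 * κ - 2) / β with hb
  have hbβ : b * β = 2 * a + 2 * κ - 2 := div_mul_cancel₀ _ hβ0.ne'
  have hb2 : 2 * a + 2 * κ - 2 ≤ b := by
    rw [hb, le_div_iff₀ hβ0]; nlinarith
  have hb3 : b ≤ 4 * (2 * a + 2 * κ - 2) := by
    rw [hb, div_le_iff₀ hβ0]; nlinarith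
  set κ0 := 1 + b / 2 - a with hκ0
  have hκ01 : 1 ≤ κ0 := by linarith
  have hκ02 : κ0 ≤ (5 + 4 * a) * κ := by nlinarith
  have hexp : 2 * κ0 + 2 / (σ - 1) = b := by
    rw [show 2 / (σ - 1) = 2 * (1 / (σ - 1)) by ring, ha2, hκ0]; ring
  have hsup := ae_le_of_gain H (β := 1) hκ01 fun i => by
    rw [mul_one]; exact h _ (one_le_pow₀ hσ.le)
  rw [hexp, mul_one] at hsup
  set F : α → ℝ≥0∞ := fun x => ENNReal.ofReal (ψ x ^ b * v x ^ (2 : ℝ)) with hF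
  set N := essSup F μ with hN
  have hFN : ∀ᵐ x ∂μ, F x ≤ N := ae_le_essSup
  have hN1 : N ≤ ENNReal.ofReal (iterConst σ P κ0 1) * wint μ ψ v κ0 1 :=
    essSup_le_of_ae_le _ hsup
  have hwfin : wint μ ψ v κ0 1 < ∞ := by
    unfold wint
    refine ENNReal.mul_lt_top (ENNReal.inv_lt_top.2 (pos_iff_ne_zero.2 H.ne_zero))
      (lt_of_le_of_lt (lintegral_mono fun x => ENNReal.ofReal_le_ofReal ?_) H.sq_lt)
    rw [mul_one, Real.rpow_two]
    exact mul_le_of_le_one_left (sq_nonneg _)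
      (Real.rpow_le_one (H.nonneg x) (H.le_one x) (by linarith))
  -- Finiteness of the supremum comes from `v ∈ L²` and permits the division by `N^(1-β)`.
  have hNtop : N ≠ ∞ := (hN1.trans_lt (ENNReal.mul_lt_top (by finiteness) hwfin)).ne
  have hw : wint μ ψ v κ0 1 ≤ N ^ (1 - β) * wint μ ψ v κ β := by
    unfold wint
    rw [mul_left_comm, ← lintegral_const_mul' _ _
      (ENNReal.rpow_ne_top_of_nonneg (by linarith) hNtop)]
    refine mul_le_mul_right (lintegral_mono_ae ?_) _
    filter_upwards [hFN, H.pos] with x hx hv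
    have hψ := H.nonneg x
    have h1 : ψ x ^ (2 * κ0 - 2) * v x ^ (2 * (1 : ℝ)) =
        (ψ x ^ b * v x ^ (2 : ℝ)) ^ (1 - β) * (ψ x ^ (2 * κ - 2) * v x ^ (2 * β)) := by
      rw [Real.mul_rpow (by positivity) (by positivity), ← Real.rpow_mul hψ, ← Real.rpow_mul hv.le]
      have e1 : ψ x ^ (2 * κ0 - 2) = ψ x ^ (b * (1 - β)) * ψ x ^ (2 * κ - 2) := by
        rw [← Real.rpow_add_of_nonneg hψ (by nlinarith) (by linarith)]
        congr 1; rw [hκ0]; linarith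
      have e2 : v x ^ (2 * (1 : ℝ)) = v x ^ (2 * (1 - β)) * v x ^ (2 * β) := by
        rw [← Real.rpow_add hv]; congr 1; ring
      rw [e1, e2]; ring
    rw [h1, ENNReal.ofReal_mul (by positivity), ← ENNReal.ofReal_rpow_of_nonneg (by positivity)
      (by linarith)]
    gcongr
  have hNβ : N ^ β ≤ ENNReal.ofReal (iterConst σ P κ0 1) * wint μ ψ v κ β := by
    by_cases hN0 : N = 0
    · rw [hN0, ENNReal.zero_rpow_of_pos hβ0]; exact bot_le
    have h1 : N ^ (1 - β) * N ^ β ≤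
        N ^ (1 - β) * (ENNReal.ofReal (iterConst σ P κ0 1) * wint μ ψ v κ β) := by
      rw [← ENNReal.rpow_add _ _ hN0 hNtop, sub_add_cancel, ENNReal.rpow_one, mul_left_comm]
      exact hN1.trans (by gcongr)
    refine (ENNReal.mul_le_mul_iff_right ?_ ?_).1 h1
    · rw [Ne, ENNReal.rpow_eq_zero_iff]; simp [hN0, hNtop]
    · exact ENNReal.rpow_ne_top_of_nonneg (by linarith) hNtop
  have hconst : iterConst σ P κ0 1 ≤ iterConst σ P ((5 + 4 * a) * κ) 1 := by
    unfold iterConst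
    have := H.one_le
    gcongr
  filter_upwards [hFN, H.pos] with x hx hv hψ1
  calc ENNReal.ofReal (v x ^ (2 * β)) = F x ^ β := by
        simp only [hF]
        rw [hψ1, Real.one_rpow, one_mul, ENNReal.ofReal_rpow_of_nonneg (by positivity) hβ0.le,
          ← Real.rpow_mul hv.le]
    _ ≤ N ^ β := ENNReal.rpow_le_rpow hx hβ0.le
    _ ≤ _ := hNβ.trans (by gcongr)

end Degenerate

/-! ### The supremum bound with one constant for all exponents `0 < |γ| ≤ 2`. -/

namespace Degenerate

variable {α : Type*} [MeasurableSpace α] {μ : Measure α} {σ P : ℝ} {ψ v : α → ℝ}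

theorem iterConst_mono (hσ : 1 < σ) (hP : 0 ≤ P) {κ κ' β β' : ℝ} (hκ : 0 ≤ κ) (hκκ : κ ≤ κ')
    (hβ : |β| ≤ |β'|) : iterConst σ P κ β ≤ iterConst σ P κ' β' := by
  have hσ1 : 0 < σ - 1 := by linarith
  unfold iterConst
  gcongr

theorem ae_le_of_gain_of_quarter_le (H : IterData μ σ P ψ v) {κ β : ℝ} (hκ : 1 ≤ κ)
    (hβ : 1 / 4 ≤ β) (h : ∀ β, 1 ≤ β → GainAt μ σ P ψ v β) :
    ∀ᵐ x ∂μ, ψ x = 1 → ENNReal.ofReal (v x ^ (2 * β)) ≤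
      ENNReal.ofReal (iterConst σ P ((5 + 4 * (σ / (σ - 1))) * κ) (1 + β)) * wint μ ψ v κ β := by
  have hσ := H.one_lt
  have hσ1 : 0 < σ - 1 := by linarith
  have ha : 0 < σ / (σ - 1) := by positivity
  have hP : 0 ≤ P := by linarith [H.one_le]
  rcases lt_or_ge β 1 with hβ1 | hβ1
  · filter_upwards [ae_le_of_gain_of_lt_one H hκ hβ hβ1 h] with x hx hψ
    refine (hx hψ).trans ?_
    gcongr
    refine iterConst_mono hσ hP (by positivity) le_rfl ?_
    rw [abs_one, abs_of_nonneg (by linarith)]; linarith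
  · filter_upwards [ae_le_of_gain H hκ fun i => h (σ ^ i * β)
      (one_le_mul_of_one_le_of_one_le (one_le_pow₀ hσ.le) hβ1)] with x hx hψ
    rw [hψ, Real.one_rpow, one_mul] at hx
    refine hx.trans ?_
    gcongr
    refine iterConst_mono hσ hP (by linarith) ?_ ?_
    · nlinarith
    · rw [abs_of_nonneg (by linarith), abs_of_nonneg (by linarith)]; linarith

/-- The constant of the local boundedness estimate. -/
noncomputable def moserConst (σ P : ℝ) : ℝ :=
  iterConst σ P ((5 + 4 * (σ / (σ - 1))) * (σ / (σ - 1))) (5 + 3 * σ)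

/-- The step constant enters as a pure power, which is the source of the exponent `σ/(σ-1)` of the
geometric factor. -/
theorem moserConst_eq (hσ : 1 < σ) (hP : 0 ≤ P) :
    moserConst σ P = P ^ (σ / (σ - 1)) * moserConst σ 1 := by
  have hσ1 : 0 < σ - 1 := by linarith
  unfold moserConst iterConst
  rw [Real.mul_rpow hP (by positivity), one_mul, mul_assoc]

/-- After `k` steps the exponent has passed `1/4` and the interpolated bound applies; a `σ^k`-th
root returns to `γ`. The constant of the second phase grows with `k`, but no faster than the surplus
factor of `iterate_gain`, so the result is uniform in `γ`. -/
theorem ae_le_of_gain_of_pos_of_lt_quarter (H : IterData μ σ P ψ v) {γ : ℝ} (hγ0 : 0 < γ)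
    (hγ : γ < 1 / 4) (h : ∀ β, 1 ≤ β → GainAt μ σ P ψ v β)
    (h' : ∀ β, 0 < β → β ≤ 1 / 4 → GainAt μ σ P ψ v β) :
    ∀ᵐ x ∂μ, ψ x = 1 → ENNReal.ofReal (v x ^ (2 * γ)) ≤
      ENNReal.ofReal (moserConst σ P) * wint μ ψ v 1 γ := by
  have hσ := H.one_lt
  have hσ0 : 0 < σ := by linarith
  have hσ1 : 0 < σ - 1 := by linarith
  have hP : 0 < P := by linarith [H.one_le]
  set a := σ / (σ - 1) with ha
  have ha1 : 1 ≤ a := by rw [ha, one_le_div hσ1]; linarith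
  have ha0 : 0 < a := by linarith
  have hex : ∃ k : ℕ, 1 / 4 ≤ σ ^ k * γ := by
    obtain ⟨k, hk⟩ := pow_unbounded_of_one_lt (1 / 4 / γ) hσ
    exact ⟨k, by rw [div_lt_iff₀ hγ0] at hk; exact hk.le⟩
  classical
  -- Minimality of `k` keeps the steps before it within `β ≤ 1/4` and caps the exponent reached by
  -- `σ`.
  set k := Nat.find hex with hk
  have hk1 : 1 / 4 ≤ σ ^ k * γ := Nat.find_spec hex
  have hk2 : ∀ i < k, σ ^ i * γ < 1 / 4 := fun i hi => not_le.1 (Nat.find_min hex hi)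
  have hk3 : σ ^ k * γ ≤ σ := by
    rcases Nat.eq_zero_or_pos k with h0 | h0
    · rw [h0]; linarith
    · have h1 := hk2 (k - 1) (by omega)
      have h2 : σ ^ k = σ * σ ^ (k - 1) := by rw [← pow_succ']; congr 1; omega
      rw [h2]; nlinarith
  have hit := iterate_gain H (le_refl 1) k fun i hi =>
    h' (σ ^ i * γ) (by positivity) (hk2 i hi).le
  have hκ := one_le_kap hσ (le_refl 1) k
  have hκ' := kap_le hσ (le_refl 1) k
  rw [← ha, mul_one] at hκ'
  set c := iterConst σ P 1 γ with hc
  set M := ((5 + 4 * a) ^ 2 * a ^ 2 * (2 + σ)) ^ a with hM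
  have hM1 : 1 ≤ M := by
    refine Real.one_le_rpow ?_ ha0.le
    have h1 : 1 ≤ (5 + 4 * a) ^ 2 := one_le_pow₀ (by linarith)
    have h2 : 1 ≤ a ^ 2 := one_le_pow₀ ha1
    exact one_le_mul_of_one_le_of_one_le (one_le_mul_of_one_le_of_one_le h1 h2) (by linarith)
  have hc1 : 1 ≤ c := one_le_iterConst hσ H.one_le le_rfl γ
  -- The `k`-dependence of the second constant is `kap² ≤ a² (σ²)^k` inside a power `a`, which
  -- `(σ³)^(ak)` covers; only the fixed factor `M` remains.
  have hD : iterConst σ P ((5 + 4 * a) * kap σ 1 k) (1 + σ ^ k * γ) ≤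
      M * (c * (σ ^ 3) ^ (a * (k : ℝ))) := by
    have e : M * (c * (σ ^ 3) ^ (a * (k : ℝ))) =
        ((5 + 4 * a) ^ 2 * a ^ 2 * (2 + σ) * (P * ((a * 1) ^ 2 * (1 + |γ|))) * (σ ^ 3) ^ k) ^ a *
          (σ ^ 3) ^ (a / (σ - 1)) := by
      rw [Real.mul_rpow (by positivity) (by positivity), Real.mul_rpow (by positivity)
        (by positivity), hM, hc, iterConst, ← ha, mul_comm a (k : ℝ), Real.rpow_mul (by positivity),
        Real.rpow_natCast]
      ring
    rw [e, iterConst, ← ha]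
    refine mul_le_mul_of_nonneg_right ?_ (by positivity)
    refine Real.rpow_le_rpow (by positivity) ?_ ha0.le
    have h1 : 1 + |1 + σ ^ k * γ| ≤ 2 + σ := by
      rw [abs_of_nonneg (by positivity)]; linarith
    have h2 : (1 : ℝ) ≤ 1 + |γ| := by linarith [abs_nonneg γ]
    have h3 : kap σ 1 k ^ 2 ≤ a ^ 2 * (σ ^ 3) ^ k := by
      calc kap σ 1 k ^ 2 ≤ (σ ^ k * a) ^ 2 := by gcongr
        _ = a ^ 2 * (σ ^ 2) ^ k := by ring
        _ ≤ a ^ 2 * (σ ^ 3) ^ k := by gcongr <;> [exact hσ.le; norm_num]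
    calc P * ((a * ((5 + 4 * a) * kap σ 1 k)) ^ 2 * (1 + |1 + σ ^ k * γ|))
        = P * (a ^ 2 * (5 + 4 * a) ^ 2) * (kap σ 1 k ^ 2 * (1 + |1 + σ ^ k * γ|)) := by ring
      _ ≤ P * (a ^ 2 * (5 + 4 * a) ^ 2) * ((a ^ 2 * (σ ^ 3) ^ k) * (2 + σ)) := by gcongr
      _ ≤ P * (a ^ 2 * (5 + 4 * a) ^ 2) * ((a ^ 2 * (σ ^ 3) ^ k) * (2 + σ)) * (1 + |γ|) :=
          le_mul_of_one_le_right (by positivity) h2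
      _ = _ := by ring
  have hMc : M * c ≤ moserConst σ P := by
    have e : M * c = ((5 + 4 * a) ^ 2 * a ^ 2 * (2 + σ) * (P * ((a * 1) ^ 2 * (1 + |γ|)))) ^ a *
          (σ ^ 3) ^ (a / (σ - 1)) := by
      rw [Real.mul_rpow (by positivity) (by positivity), hM, hc, iterConst, ← ha]
      ring
    rw [e, moserConst, iterConst, ← ha]
    refine mul_le_mul_of_nonneg_right ?_ (by positivity)
    refine Real.rpow_le_rpow (by positivity) ?_ ha0.le
    have h1 : 1 + |γ| ≤ 2 := by rw [abs_of_pos hγ0]; linarith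
    calc (5 + 4 * a) ^ 2 * a ^ 2 * (2 + σ) * (P * ((a * 1) ^ 2 * (1 + |γ|)))
        = P * (a * ((5 + 4 * a) * a)) ^ 2 * ((2 + σ) * (1 + |γ|)) := by ring
      _ ≤ P * (a * ((5 + 4 * a) * a)) ^ 2 * (1 + |5 + 3 * σ|) := by
          gcongr
          rw [abs_of_nonneg (a := 5 + 3 * σ) (by positivity)]
          nlinarith
      _ = _ := by ring
  filter_upwards [ae_le_of_gain_of_quarter_le H hκ hk1 h, H.pos] with x hx hv hψ
  have hσk : (1 : ℝ) ≤ σ ^ k := one_le_pow₀ hσ.le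
  have hσk0 : (0 : ℝ) < σ ^ k := by positivity
  have key : ENNReal.ofReal (v x ^ (2 * γ)) ^ (σ ^ k) ≤
      (ENNReal.ofReal (M * c) * wint μ ψ v 1 γ) ^ (σ ^ k) := by
    calc ENNReal.ofReal (v x ^ (2 * γ)) ^ (σ ^ k) = ENNReal.ofReal (v x ^ (2 * (σ ^ k * γ))) := by
          rw [ENNReal.ofReal_rpow_of_nonneg (by positivity) hσk0.le, ← Real.rpow_mul hv.le]
          congr 2; ring
      _ ≤ ENNReal.ofReal (M * (c * (σ ^ 3) ^ (a * (k : ℝ)))) *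
          wint μ ψ v (kap σ 1 k) (σ ^ k * γ) := (hx hψ).trans (by gcongr)
      _ ≤ ENNReal.ofReal M * (ENNReal.ofReal c * wint μ ψ v 1 γ) ^ (σ ^ k) := by
          rw [ENNReal.ofReal_mul (by positivity), mul_assoc]
          gcongr
      -- Since `M ≥ 1` it may be raised to the power `σ^k`, so that the root restores `M`.
      _ ≤ ENNReal.ofReal M ^ (σ ^ k) * (ENNReal.ofReal c * wint μ ψ v 1 γ) ^ (σ ^ k) := by
          gcongr
          calc ENNReal.ofReal M = ENNReal.ofReal M ^ (1 : ℝ) := (ENNReal.rpow_one _).symm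
            _ ≤ _ := ENNReal.rpow_le_rpow_of_exponent_le (ENNReal.one_le_ofReal.2 hM1) hσk
      _ = _ := by
          rw [← ENNReal.mul_rpow_of_nonneg _ _ hσk0.le, ← mul_assoc,
            ← ENNReal.ofReal_mul (by positivity)]
  refine ((ENNReal.rpow_le_rpow_iff hσk0).1 key).trans ?_
  gcongr

theorem ae_le_moserConst_mul (H : IterData μ σ P ψ v) {γ : ℝ} (hγ0 : γ ≠ 0) (hγ2 : |γ| ≤ 2)
    (h : ∀ β, 1 ≤ β → GainAt μ σ P ψ v β)
    (h' : 1 / 4 ≤ γ ∨ ∀ β, β ≠ 0 → β ≤ 1 / 4 → GainAt μ σ P ψ v β) :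
    ∀ᵐ x ∂μ, ψ x = 1 → ENNReal.ofReal (v x ^ (2 * γ)) ≤
      ENNReal.ofReal (moserConst σ P) *
        ((μ univ)⁻¹ * ∫⁻ x, ENNReal.ofReal (v x ^ (2 * γ)) ∂μ) := by
  have hσ := H.one_lt
  have hσ1 : 0 < σ - 1 := by linarith
  have ha1 : 1 ≤ σ / (σ - 1) := by rw [one_le_div hσ1]; linarith
  have hP : 0 ≤ P := by linarith [H.one_le]
  have hw : wint μ ψ v 1 γ = (μ univ)⁻¹ * ∫⁻ x, ENNReal.ofReal (v x ^ (2 * γ)) ∂μ := by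
    simp [wint]
  rw [← hw]
  rcases le_or_gt (1 / 4) γ with hγ | hγ
  · filter_upwards [ae_le_of_gain_of_quarter_le H le_rfl hγ h] with x hx hψ
    refine (hx hψ).trans ?_
    gcongr
    refine iterConst_mono hσ hP (by positivity) (by gcongr) ?_
    rw [abs_of_nonneg (by positivity), abs_of_nonneg (by positivity)]
    linarith [le_abs_self γ]
  have h' := h'.resolve_left hγ.not_ge
  rcases lt_or_gt_of_ne hγ0 with hγn | hγp
  · filter_upwards [ae_le_of_gain H le_rfl fun i => h' (σ ^ i * γ) (by positivity) (by
      have : 0 < σ ^ i := by positivity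
      nlinarith)] with x hx hψ
    rw [hψ, Real.one_rpow, one_mul] at hx
    refine hx.trans ?_
    gcongr
    refine iterConst_mono hσ hP zero_le_one ?_ ?_
    · nlinarith
    · rw [abs_of_nonneg (a := 5 + 3 * σ) (by positivity)]; linarith
  · exact ae_le_of_gain_of_pos_of_lt_quarter H hγp hγ h fun β hβ hβ' => h' β hβ.ne' hβ'

end Degenerate

namespace Degenerate

/-! ### The gain of integrability on a metric ball -/

theorem const_mul_lintegral_le_of_tendsto {α : Type*} [MeasurableSpace α] {μ : Measure α}
    {F : ℕ → α → ℝ≥0∞} {F' : α → ℝ≥0∞} {c D : ℝ≥0∞} (hF : ∀ j, AEMeasurable (F j) μ)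
    (hlim : ∀ᵐ x ∂μ, Tendsto (fun j => F j x) atTop (𝓝 (F' x)))
    (h : ∀ j, c * ∫⁻ x, F j x ∂μ ≤ D) : c * ∫⁻ x, F' x ∂μ ≤ D := by
  simp only [← smul_eq_mul, ← lintegral_smul_measure] at h ⊢
  calc ∫⁻ x, F' x ∂(c • μ) = ∫⁻ x, liminf (fun j => F j x) atTop ∂(c • μ) :=
        lintegral_congr_ae (Measure.ae_smul_measure
          (hlim.mono fun x hx => hx.liminf_eq.symm) c)
    _ ≤ liminf (fun j => ∫⁻ x, F j x ∂(c • μ)) atTop :=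
        lintegral_liminf_le' fun j => (hF j).smul_measure c
    _ ≤ D := liminf_le_of_frequently_le' (Frequently.of_forall h)

variable {n : ℕ} {Q : E n → Mat n} {Ω : Set (E n)} {B : Set (E n)} {ψ : E n → ℝ} {Γ κ : ℝ}

theorem lipschitzOnWith_rpow (hκ : 1 ≤ κ) :
    LipschitzOnWith ⟨κ, by linarith⟩ (fun t : ℝ => t ^ κ) (Icc 0 1) := by
  refine (convex_Icc 0 1).lipschitzOnWith_of_nnnorm_hasDerivWithin_le
    (fun t _ => (Real.hasDerivAt_rpow_const (Or.inr hκ)).hasDerivWithinAt) fun t ht => ?_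
  change ‖κ * t ^ (κ - 1)‖ ≤ κ
  rw [Real.norm_of_nonneg]
  · exact mul_le_of_le_one_right (by linarith) (Real.rpow_le_one ht.1 ht.2 (by linarith))
  · have := Real.rpow_nonneg ht.1 (κ - 1)
    have : 0 ≤ κ := by linarith
    positivity

/-- The chain rule gives `∇ψ^κ = κ ψ^(κ-1) ∇ψ`, whence the factor `κ²` and the weight `ψ^(2κ-2)`. -/
theorem isCutoff_rpow (hB : IsOpen B) (hψ : ψ ∈ LipC B) (hψ0 : ∀ x, 0 ≤ ψ x) (hψ1 : ∀ x, ψ x ≤ 1)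
    (hΓ : 0 ≤ Γ) (hgrad : ∀ᵐ x ∂volume.restrict B, quad (Q x) (gradient ψ x) ≤ Γ) (hκ : 1 ≤ κ) :
    IsCutoff Q B (fun x => ψ x ^ κ) (fun x => ψ x ^ (2 * κ - 2)) (κ ^ 2 * Γ) := by
  obtain ⟨⟨L, hL⟩, hs, hsB⟩ := hψ
  have hsupp : Function.support (fun x => ψ x ^ κ) ⊆ Function.support ψ := by
    intro x hx h0
    rw [Function.mem_support] at hx
    exact hx (by rw [h0, Real.zero_rpow (by linarith)])
  refine ⟨⟨⟨⟨κ, by linarith⟩ * L, ?_⟩, ?_, ?_⟩, fun x => Real.rpow_nonneg (hψ0 x) _,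
    fun x => Real.rpow_le_one (hψ0 x) (hψ1 x) (by linarith), ?_, fun x => ?_, fun x =>
    Real.rpow_le_one (hψ0 x) (hψ1 x) (by linarith), by positivity⟩
  · rw [← lipschitzOnWith_univ] at hL ⊢
    exact (lipschitzOnWith_rpow hκ).comp hL fun x _ => ⟨hψ0 x, hψ1 x⟩
  · exact hs.mono hsupp
  · exact (closure_mono hsupp).trans hsB
  · filter_upwards [ae_hasGradientAt hB (hL.lipschitzOnWith (s := B)), hgrad] with x hx hq
    have h1 : HasGradientAt (fun x => ψ x ^ κ) ((κ * ψ x ^ (κ - 1)) • gradient ψ x) x :=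
      hasGradientAt_comp (F := fun t => t ^ κ) (Real.hasDerivAt_rpow_const (Or.inr hκ)) hx
    have h2 : (ψ x ^ (κ - 1)) ^ 2 = ψ x ^ (2 * κ - 2) := by
      rw [← Real.rpow_natCast, ← Real.rpow_mul (hψ0 x)]; congr 1; push_cast; ring
    rw [h1.gradient, quad_smul, mul_pow, h2]
    have h3 := Real.rpow_nonneg (hψ0 x) (2 * κ - 2)
    calc κ ^ 2 * ψ x ^ (2 * κ - 2) * quad (Q x) (gradient ψ x)
        ≤ κ ^ 2 * ψ x ^ (2 * κ - 2) * Γ := by gcongr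
      _ = _ := by ring
  · rw [← Real.rpow_natCast, ← Real.rpow_mul (hψ0 x)]
    refine Real.rpow_le_rpow_of_exponent_ge' (hψ0 x) (hψ1 x) (by linarith) ?_
    push_cast; linarith

variable {σ k K C η r m P β : ℝ} {d : E n → E n → ℝ} {y : E n} {M : E n → Mat n} {f v : E n → ℝ}
  {G : E n → E n}

theorem step_const_le (hk : 0 < k) (hP : 16 * C ^ 2 * ((2 + 8 * (K / k)) * (r ^ 2 * Γ) + 4 / k + 1) ≤ P)
    (hK : 0 ≤ K) (hΓ : 0 ≤ Γ) (hκ : 1 ≤ κ) :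
    16 * C ^ 2 * ((2 + 8 * (K / k)) * (r ^ 2 * (κ ^ 2 * Γ)) + 4 * (|β| / k) + 1) ≤
      P * κ ^ 2 * (1 + |β|) := by
  have h0 := abs_nonneg β
  have h1 : 1 ≤ κ ^ 2 := one_le_pow₀ hκ
  have h2 : 1 ≤ κ ^ 2 * (1 + |β|) := one_le_mul_of_one_le_of_one_le h1 (by linarith)
  have h3 : |β| ≤ κ ^ 2 * (1 + |β|) := by nlinarith
  have h4 : κ ^ 2 ≤ κ ^ 2 * (1 + |β|) := le_mul_of_one_le_right (by positivity) (by linarith)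
  calc _ = 16 * C ^ 2 * ((2 + 8 * (K / k)) * (r ^ 2 * Γ) * κ ^ 2 + 4 / k * |β| + 1) := by ring
    _ ≤ 16 * C ^ 2 * ((2 + 8 * (K / k)) * (r ^ 2 * Γ) * (κ ^ 2 * (1 + |β|)) +
        4 / k * (κ ^ 2 * (1 + |β|)) + κ ^ 2 * (1 + |β|)) := by gcongr
    _ = 16 * C ^ 2 * ((2 + 8 * (K / k)) * (r ^ 2 * Γ) + 4 / k + 1) * (κ ^ 2 * (1 + |β|)) := by ring
    _ ≤ P * (κ ^ 2 * (1 + |β|)) := by gcongr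
    _ = _ := by ring

theorem ofReal_rpow_mul_rpow {s t σ κ β : ℝ} (hs : 0 ≤ s) (ht : 0 < t) (hσ : 0 ≤ σ) :
    ENNReal.ofReal (s ^ κ * t ^ β) ^ (2 * σ) =
      ENNReal.ofReal (s ^ (2 * (σ * κ + 1) - 2) * t ^ (2 * (σ * β))) := by
  rw [ENNReal.ofReal_rpow_of_nonneg (by positivity) (by positivity),
    Real.mul_rpow (by positivity) (by positivity), ← Real.rpow_mul hs, ← Real.rpow_mul ht.le]
  congr 3 <;> ring

/-- The profile is `h(t) = t^β` itself; on `[m, ∞)` its derivative is bounded as `β < 1`. -/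
theorem LocalData.gainAt_of_le_quarter (H : LocalData σ k K C η d Ω Q y r M f v G m)
    (hψ : ψ ∈ LipC (dball d Ω y r)) (hψ0 : ∀ x, 0 ≤ ψ x) (hψ1 : ∀ x, ψ x ≤ 1) (hΓ : 0 ≤ Γ)
    (hgrad : ∀ᵐ x ∂volume.restrict (dball d Ω y r), quad (Q x) (gradient ψ x) ≤ Γ)
    (hP : 16 * C ^ 2 * ((2 + 8 * (K / k)) * (r ^ 2 * Γ) + 4 / k + 1) ≤ P)
    (hE : SuperEnergy Q Ω (dball d Ω y r) M f v G) (hβ : β ≤ 1 / 4) (hβ0 : β ≠ 0) :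
    GainAt (volume.restrict (dball d Ω y r)) σ P ψ v β := by
  intro κ hκ
  have hσ0 : 0 < σ := by linarith [H.one_lt]
  have hm := H.m_pos
  have hpos : ∀ t, m ≤ t → 0 < t := fun t ht => hm.trans_le ht
  have hχ := isCutoff_rpow H.isOpen_ball hψ hψ0 hψ1 hΓ hgrad hκ
  have h12 : 0 < 1 - 2 * β := by linarith
  have habs : 0 < |β| := abs_pos.2 hβ0
  have hst := H.step hχ (h := fun t => t ^ β) (h' := fun t => β * t ^ (β - 1))
    (Λ := |β| * m ^ (β - 1)) (b := |β|) (s := -1)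
    (Φ := fun t => β ^ 2 / (1 - 2 * β) * t ^ (2 * β - 1)) (Φ' := fun t => -(β ^ 2 * t ^ (2 * β - 2)))
    (fun t ht => Real.hasDerivAt_rpow_const (Or.inl (hpos t ht).ne'))
    (fun t ht => ((Real.continuousAt_rpow_const _ _
      (Or.inl (hpos t ht).ne')).const_mul β).continuousWithinAt)
    (fun t ht => by
      have := Real.rpow_nonneg (hpos t ht).le (β - 1)
      rw [abs_mul, abs_of_nonneg this]
      exact mul_le_mul_of_nonneg_left (Real.rpow_le_rpow_of_nonpos hm ht (by linarith)) habs.le)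
    (fun t ht => Real.rpow_nonneg (hpos t ht).le _) (by simp)
    (fun t ht => by
      have := Real.rpow_nonneg (hpos t ht).le (2 * β - 1)
      positivity)
    (fun t ht => by
      have h1 := Real.rpow_nonneg (hpos t ht).le (β - 1)
      have h2 : t ^ β * t ^ (β - 1) = t ^ (2 * β - 1) := by
        rw [← Real.rpow_add (hpos t ht)]; congr 1; ring
      -- This amounts to `|β| ≤ 1 - 2β`, which is where `β ≤ 1/4` keeps the test away from the
      -- degenerate exponent `1/2`.
      have h3 : β ^ 2 / (1 - 2 * β) ≤ |β| := by
        rw [div_le_iff₀ h12, ← sq_abs, sq]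
        refine mul_le_mul_of_nonneg_left ?_ habs.le
        rw [abs_le]; constructor <;> linarith
      rw [abs_mul, abs_of_nonneg h1, mul_left_comm, h2]
      exact mul_le_mul_of_nonneg_right h3 (Real.rpow_nonneg (hpos t ht).le _))
    (fun t ht => le_of_eq (by
      have h2 : (t ^ (β - 1)) ^ 2 = t ^ (2 * β - 2) := by
        rw [← Real.rpow_natCast, ← Real.rpow_mul (hpos t ht).le]; congr 1; push_cast; ring
      rw [mul_pow, h2]; ring)) habs.le
    (fun t ht => le_of_eq (by
      have h1 := Real.rpow_nonneg (hpos t ht).le (β - 1)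
      have h2 : t * t ^ (β - 1) = t ^ β := by
        rw [Real.rpow_sub_one (hpos t ht).ne']; field_simp [(hpos t ht).ne']
      rw [abs_mul, abs_of_nonneg h1, mul_left_comm, h2]))
    (hE _ _ _ hχ β hβ hβ0)
  have hv : ∀ᵐ x ∂volume.restrict (dball d Ω y r), m ≤ v x := ae_mono H.restrict_le H.le_v
  unfold wint
  rw [Measure.restrict_apply_univ]
  have e1 : ∫⁻ x in dball d Ω y r, ENNReal.ofReal (ψ x ^ κ * v x ^ β) ^ (2 * σ) =
      ∫⁻ x in dball d Ω y r,
        ENNReal.ofReal (ψ x ^ (2 * (σ * κ + 1) - 2) * v x ^ (2 * (σ * β))) :=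
    lintegral_congr_ae (hv.mono fun x hx => ofReal_rpow_mul_rpow (hψ0 x) (hpos _ hx) hσ0.le)
  have e2 : ∫⁻ x in dball d Ω y r, ENNReal.ofReal (ψ x ^ (2 * κ - 2) * (v x ^ β) ^ 2) =
      ∫⁻ x in dball d Ω y r, ENNReal.ofReal (ψ x ^ (2 * κ - 2) * v x ^ (2 * β)) := by
    refine lintegral_congr_ae (hv.mono fun x hx => ?_)
    have h2 : (v x ^ β) ^ 2 = v x ^ (2 * β) := by
      rw [← Real.rpow_natCast (v x ^ β), ← Real.rpow_mul (hpos _ hx).le, mul_comm β]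
      norm_num
    simp only [h2]
  rw [e1, e2] at hst
  rw [← ENNReal.rpow_inv_le_iff hσ0, ← one_div σ]
  exact hst.trans (mul_le_mul_left (ENNReal.ofReal_le_ofReal
    (step_const_le H.k_pos hP H.K_nonneg hΓ hκ)) _)

/-- The step is applied to truncated powers, which increase to `t^β` as `ε → 0`. Its constant does
not depend on `ε` and the right side is dominated by the untruncated integral, so Fatou's lemma
passes to the limit even if that integral is infinite. -/
theorem LocalData.gainAt_of_one_le (H : LocalData σ k K C η d Ω Q y r M f v G m)
    (hψ : ψ ∈ LipC (dball d Ω y r)) (hψ0 : ∀ x, 0 ≤ ψ x) (hψ1 : ∀ x, ψ x ≤ 1) (hΓ : 0 ≤ Γ)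
    (hgrad : ∀ᵐ x ∂volume.restrict (dball d Ω y r), quad (Q x) (gradient ψ x) ≤ Γ)
    (hP : 16 * C ^ 2 * ((2 + 8 * (K / k)) * (r ^ 2 * Γ) + 4 / k + 1) ≤ P)
    (hE : SubEnergy Q Ω (dball d Ω y r) M f v G) (hβ : 1 ≤ β) :
    GainAt (volume.restrict (dball d Ω y r)) σ P ψ v β := by
  intro κ hκ
  have hσ0 : 0 < σ := by linarith [H.one_lt]
  have hm := H.m_pos
  have hpos : ∀ t, m ≤ t → 0 < t := fun t ht => hm.trans_le ht
  have hχ := isCutoff_rpow H.isOpen_ball hψ hψ0 hψ1 hΓ hgrad hκ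
  have hv : ∀ᵐ x ∂volume.restrict (dball d Ω y r), m ≤ v x := ae_mono H.restrict_le H.le_v
  have hvm : AEMeasurable v (volume.restrict (dball d Ω y r)) :=
    (H.memW.1.mono_measure H.restrict_le).aemeasurable
  have hψm : Measurable ψ := by
    obtain ⟨⟨L, hL⟩, -⟩ := hψ; exact hL.continuous.measurable
  set ε : ℕ → ℝ := fun j => 1 / ((j : ℝ) + 1) with hε
  have hε0 : ∀ j, 0 < ε j := fun j => by positivity
  have hst : ∀ j, _ := fun j => H.step hχ (h := tpow β (ε j)) (h' := tpow' β (ε j))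
    (Λ := β * (1 / ε j) ^ (β - 1)) (b := β) (s := 1)
    (Φ := fun t => tpow β (ε j) t * tpow' β (ε j) t)
    (Φ' := fun t => tpow' β (ε j) t ^ 2 + tpow β (ε j) t * tpow'' β (ε j) t)
    (fun t ht => hasDerivAt_tpow (hε0 j).le (hpos t ht))
    (fun t ht => (hasDerivAt_tpow' (hε0 j).le (hpos t ht)).continuousAt.continuousWithinAt)
    (fun t ht => by
      rw [abs_of_nonneg (tpow'_nonneg hβ (hε0 j).le (hpos t ht))]
      exact tpow'_le hβ (hε0 j) (hpos t ht))
    (fun t ht => (tpow_pos (hε0 j).le (hpos t ht)).le) (by simp)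
    (fun t ht => mul_nonneg (tpow_pos (hε0 j).le (hpos t ht)).le
      (tpow'_nonneg hβ (hε0 j).le (hpos t ht)))
    (fun t ht => mul_le_mul_of_nonneg_left (le_abs_self _) (tpow_pos (hε0 j).le (hpos t ht)).le)
    (fun t ht => by
      rw [one_mul]
      exact le_add_of_nonneg_right (mul_nonneg (tpow_pos (hε0 j).le (hpos t ht)).le
        (tpow''_nonneg hβ (hε0 j).le (hpos t ht))))
    (by linarith)
    (fun t ht => by
      rw [abs_of_nonneg (tpow'_nonneg hβ (hε0 j).le (hpos t ht))]
      exact mul_tpow'_le hβ (hε0 j).le (hpos t ht))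
    (hE _ _ _ hχ β (ε j) hβ (hε0 j))
  unfold wint
  rw [Measure.restrict_apply_univ]
  have e1 : ∫⁻ x in dball d Ω y r, ENNReal.ofReal (ψ x ^ κ * v x ^ β) ^ (2 * σ) =
      ∫⁻ x in dball d Ω y r,
        ENNReal.ofReal (ψ x ^ (2 * (σ * κ + 1) - 2) * v x ^ (2 * (σ * β))) :=
    lintegral_congr_ae (hv.mono fun x hx => ofReal_rpow_mul_rpow (hψ0 x) (hpos _ hx) hσ0.le)
  have e2 : ∀ j, ∫⁻ x in dball d Ω y r,
      ENNReal.ofReal (ψ x ^ (2 * κ - 2) * tpow β (ε j) (v x) ^ 2) ≤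
      ∫⁻ x in dball d Ω y r, ENNReal.ofReal (ψ x ^ (2 * κ - 2) * v x ^ (2 * β)) := fun j => by
    refine lintegral_mono_ae (hv.mono fun x hx => ENNReal.ofReal_le_ofReal ?_)
    have h1 := tpow_le_rpow hβ (hε0 j).le (hpos _ hx)
    have h2 := (tpow_pos (β := β) (hε0 j).le (hpos _ hx)).le
    have h3 : v x ^ (2 * β) = (v x ^ β) ^ 2 := by
      rw [← Real.rpow_natCast (v x ^ β), ← Real.rpow_mul (hpos _ hx).le, mul_comm β]
      norm_num
    rw [h3]
    exact mul_le_mul_of_nonneg_left (by gcongr) (Real.rpow_nonneg (hψ0 x) _)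
  rw [← e1]
  refine const_mul_lintegral_le_of_tendsto
    (F := fun j x => ENNReal.ofReal (ψ x ^ κ * tpow β (ε j) (v x)) ^ (2 * σ)) (fun j => ?_)
    (Eventually.of_forall fun x => ?_) fun j => ?_
  · have : Measurable (tpow β (ε j)) := by unfold tpow; fun_prop
    have := this.comp_aemeasurable hvm
    have h2 := (hψm.pow_const κ).aemeasurable (μ := volume.restrict (dball d Ω y r))
    exact (h2.mul this).ennreal_ofReal.pow_const _
  · exact (ENNReal.continuous_rpow_const.tendsto _).comp
      (ENNReal.tendsto_ofReal ((tendsto_tpow β (v x)).const_mul _))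
  · rw [← ENNReal.rpow_inv_le_iff hσ0, ← one_div σ]
    refine (hst j).trans (mul_le_mul' (ENNReal.ofReal_le_ofReal ?_) (mul_le_mul_right (e2 j) _))
    have := step_const_le (β := β) H.k_pos hP H.K_nonneg hΓ hκ
    rwa [abs_of_nonneg (by linarith : 0 ≤ β)] at this ⊢

end Degenerate

namespace Degenerate

/-! ### Removing the shift -/

theorem ofReal_add_one_rpow_le {p : ℝ} (hp : 0 < p) (t : ℝ) :
    ENNReal.ofReal (t + 1) ^ p ≤ 2 ^ p * (ENNReal.ofReal t ^ p + 1) := by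
  have h1 : ENNReal.ofReal (t + 1) ≤ 2 * max (ENNReal.ofReal t) 1 := by
    refine ENNReal.ofReal_add_le.trans ?_
    rw [ENNReal.ofReal_one, two_mul]
    exact add_le_add (le_max_left _ _) (le_max_right _ _)
  refine (ENNReal.rpow_le_rpow h1 hp.le).trans ?_
  rw [ENNReal.mul_rpow_of_nonneg _ _ hp.le]
  refine mul_le_mul_right ?_ _
  rcases le_total (ENNReal.ofReal t) 1 with h | h
  · rw [max_eq_right h, ENNReal.one_rpow]; exact le_add_self
  · rw [max_eq_left h]; exact le_self_add

theorem tendsto_ofReal_add_one_div (t : ℝ) :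
    Tendsto (fun j : ℕ => ENNReal.ofReal (t + 1 / ((j : ℝ) + 1))) atTop (𝓝 (ENNReal.ofReal t)) := by
  have := (tendsto_one_div_add_atTop_nhds_zero_nat (𝕜 := ℝ)).const_add t
  rw [add_zero] at this
  exact ENNReal.tendsto_ofReal this

theorem rpow_le_rpow_of_neg {a b : ℝ≥0∞} (hab : a ≤ b) {p : ℝ} (hp : p < 0) : b ^ p ≤ a ^ p := by
  rw [← neg_neg p, ENNReal.rpow_neg, ENNReal.rpow_neg a, ENNReal.inv_le_inv]
  exact ENNReal.rpow_le_rpow hab (by linarith)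

/-- The left side is continuous in the shift, values at `0` included. For `γ < 0` the shifted
integrals lie below the limiting one. For `γ > 0` that integral may be assumed finite, and then
dominated convergence applies. -/
theorem ae_rpow_le_of_shift {α : Type*} [MeasurableSpace α] {μ μ' : Measure α} [IsFiniteMeasure μ]
    {w : α → ℝ} (hw : AEMeasurable w μ) {γ : ℝ} (hγ : γ ≠ 0) {c D : ℝ≥0∞} (hc0 : c ≠ 0)
    (hc : c ≠ ∞) (hD0 : D ≠ 0) (hD : D ≠ ∞)
    (h : ∀ j : ℕ, ∀ᵐ x ∂μ', ENNReal.ofReal (w x + 1 / ((j : ℝ) + 1)) ^ γ ≤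
      D * (c * ∫⁻ x, ENNReal.ofReal (w x + 1 / ((j : ℝ) + 1)) ^ (2 * γ) ∂μ) ^ (1 / 2 : ℝ)) :
    ∀ᵐ x ∂μ', ENNReal.ofReal (w x) ^ γ ≤
      D * (c * ∫⁻ x, ENNReal.ofReal (w x) ^ (2 * γ) ∂μ) ^ (1 / 2 : ℝ) := by
  have hle : ∀ (j : ℕ) x, ENNReal.ofReal (w x) ≤ ENNReal.ofReal (w x + 1 / ((j : ℝ) + 1)) :=
    fun j x => ENNReal.ofReal_le_ofReal (le_add_of_nonneg_right (by positivity))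
  rcases lt_or_gt_of_ne hγ with hγ | hγ
  · filter_upwards [ae_all_iff.2 h] with x hx
    refine le_of_tendsto' ((ENNReal.continuous_rpow_const.tendsto _).comp
      (tendsto_ofReal_add_one_div (w x))) fun j => (hx j).trans ?_
    gcongr D * (c * ?_) ^ _
    exact lintegral_mono fun x => rpow_le_rpow_of_neg (hle j x) (by linarith)
  · have h2 : 0 < 2 * γ := by linarith
    by_cases hI : ∫⁻ x, ENNReal.ofReal (w x) ^ (2 * γ) ∂μ = ∞
    · refine Eventually.of_forall fun x => ?_
      rw [hI, ENNReal.mul_top hc0, ENNReal.top_rpow_of_pos (by norm_num), ENNReal.mul_top hD0]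
      exact le_top
    have hlim : Tendsto (fun j : ℕ => ∫⁻ x, ENNReal.ofReal (w x + 1 / ((j : ℝ) + 1)) ^ (2 * γ) ∂μ)
        atTop (𝓝 (∫⁻ x, ENNReal.ofReal (w x) ^ (2 * γ) ∂μ)) := by
      refine tendsto_lintegral_of_dominated_convergence'
        (fun x => 2 ^ (2 * γ) * (ENNReal.ofReal (w x) ^ (2 * γ) + 1))
        (fun j => ((hw.add_const _).ennreal_ofReal.pow_const _))
        (fun j => Eventually.of_forall fun x => ?_) ?_
        (Eventually.of_forall fun x => (ENNReal.continuous_rpow_const.tendsto _).comp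
          (tendsto_ofReal_add_one_div (w x)))
      · refine le_trans (ENNReal.rpow_le_rpow (ENNReal.ofReal_le_ofReal ?_) h2.le)
          (ofReal_add_one_rpow_le h2 (w x))
        have : 1 / ((j : ℝ) + 1) ≤ 1 := by
          rw [div_le_one (by positivity)]
          have : (0 : ℝ) ≤ j := by positivity
          linarith
        linarith
      · have h3 : (2 : ℝ≥0∞) ^ (2 * γ) ≠ ∞ := ENNReal.rpow_ne_top_of_nonneg h2.le (by simp)
        rw [lintegral_const_mul' _ _ h3,
          lintegral_add_right _ measurable_const, lintegral_const, one_mul]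
        exact ENNReal.mul_ne_top h3 (ENNReal.add_ne_top.2 ⟨hI, measure_ne_top _ _⟩)
    filter_upwards [ae_all_iff.2 h] with x hx
    refine ge_of_tendsto' (ENNReal.Tendsto.const_mul ((ENNReal.continuous_rpow_const.tendsto _).comp
      (ENNReal.Tendsto.const_mul hlim (Or.inr hc))) (Or.inr hD)) fun j => ?_
    exact (ENNReal.rpow_le_rpow (hle j x) hγ.le).trans (hx j)

/-! ### The estimate on a metric ball -/

variable {n : ℕ} {Q : E n → Mat n} {Ω : Set (E n)} {ψ : E n → ℝ} {Γ : ℝ}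
  {σ k K C η r m P γ : ℝ} {d : E n → E n → ℝ} {y : E n} {M : E n → Mat n} {f v : E n → ℝ}
  {G : E n → E n}

theorem LocalData.iterData (H : LocalData σ k K C η d Ω Q y r M f v G m)
    (hψ : ψ ∈ LipC (dball d Ω y r)) (hψ0 : ∀ x, 0 ≤ ψ x) (hψ1 : ∀ x, ψ x ≤ 1) (hP : 1 ≤ P) :
    IterData (volume.restrict (dball d Ω y r)) σ P ψ v := by
  obtain ⟨⟨L, hL⟩, -⟩ := hψ
  have hv : ∀ᵐ x ∂volume.restrict (dball d Ω y r), m ≤ v x := ae_mono H.restrict_le H.le_v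
  refine ⟨H.one_lt, hP, ?_, ?_, hL.continuous.measurable.aemeasurable,
    (H.memW.1.mono_measure H.restrict_le).aemeasurable, hψ0, hψ1,
    hv.mono fun x hx => H.m_pos.trans_le hx, ?_⟩
  · rw [Measure.restrict_apply_univ]
    exact (H.isOpen_ball.measure_pos volume
      ⟨y, self_mem_dball H.metric H.admits.1 H.admits.2.1⟩).ne'
  · rw [Measure.restrict_apply_univ]
    exact (H.bounded.subset dball_subset).measure_lt_top.ne
  · exact (lintegral_mono' H.restrict_le le_rfl).trans_lt
      (H.memW.lintegral_sq_lt_top H.isOpen H.psdQ)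

theorem ofReal_rpow_eq {t : ℝ} (ht : 0 < t) (p : ℝ) :
    ENNReal.ofReal (t ^ p) = ENNReal.ofReal t ^ p := (ENNReal.ofReal_rpow_of_pos ht).symm

theorem one_le_moserConst (hσ : 1 < σ) (hP : 1 ≤ P) : 1 ≤ moserConst σ P := by
  have h0 : 0 < σ - 1 := by linarith
  have h1 : 1 ≤ σ / (σ - 1) := by rw [one_le_div h0]; linarith
  exact one_le_iterConst hσ hP (by nlinarith) _

theorem LocalData.ae_rpow_le (H : LocalData σ k K C η d Ω Q y r M f v G m)
    (hψ : ψ ∈ LipC (dball d Ω y r)) (hψ0 : ∀ x, 0 ≤ ψ x) (hψ1 : ∀ x, ψ x ≤ 1) (hΓ : 0 ≤ Γ)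
    (hgrad : ∀ᵐ x ∂volume.restrict (dball d Ω y r), quad (Q x) (gradient ψ x) ≤ Γ)
    (hP1 : 1 ≤ P) (hP : 16 * C ^ 2 * ((2 + 8 * (K / k)) * (r ^ 2 * Γ) + 4 / k + 1) ≤ P)
    (hE : SubEnergy Q Ω (dball d Ω y r) M f v G)
    (hE' : 1 / 4 ≤ γ ∨ SuperEnergy Q Ω (dball d Ω y r) M f v G) (hγ : γ ≠ 0) (hγ2 : |γ| ≤ 2) :
    ∀ᵐ x ∂volume.restrict (dball d Ω y r), ψ x = 1 → ENNReal.ofReal (v x) ^ γ ≤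
      ENNReal.ofReal √(moserConst σ P) * ((volume (dball d Ω y r))⁻¹ *
        ∫⁻ x in dball d Ω y r, ENNReal.ofReal (v x) ^ (2 * γ)) ^ (1 / 2 : ℝ) := by
  have hI := H.iterData hψ hψ0 hψ1 hP1
  have h1 := ae_le_moserConst_mul hI hγ hγ2
    (fun β hβ => H.gainAt_of_one_le hψ hψ0 hψ1 hΓ hgrad hP hE hβ)
    (hE'.imp_right fun h β hβ0 hβ => H.gainAt_of_le_quarter hψ hψ0 hψ1 hΓ hgrad hP h hβ hβ0)
  rw [Measure.restrict_apply_univ, lintegral_congr_ae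
    (hI.pos.mono fun x hx => ofReal_rpow_eq hx (2 * γ))] at h1
  filter_upwards [h1, hI.pos] with x hx hv hψx
  have h2 := ENNReal.rpow_le_rpow (hx hψx) (by norm_num : (0 : ℝ) ≤ 1 / 2)
  rw [ofReal_rpow_eq hv, ← ENNReal.rpow_mul, show 2 * γ * (1 / 2) = γ by ring,
    ENNReal.mul_rpow_of_nonneg _ _ (by norm_num),
    ENNReal.ofReal_rpow_of_nonneg (x := moserConst σ P)
      (by linarith [one_le_moserConst H.one_lt hP1]) (by norm_num), ← Real.sqrt_eq_rpow] at h2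
  exact h2

end Degenerate

/-! ### The cutoff, the constants and the conclusion. -/

namespace Degenerate

variable {n : ℕ} {Q : E n → Mat n} {Ω : Set (E n)} {A : E n → ℝ → Mat n}
  {σ k K θ C C' η ν r γ : ℝ} {d : E n → E n → ℝ} {y : E n} {f u : E n → ℝ}
  {g : E n → E n} {δ : E n → ℝ → ℝ}

/-- The constant in the gain of integrability, without the geometric factor. -/
noncomputable def gainConst (k K θ C C' : ℝ) : ℝ :=
  max 1 (16 * C ^ 2 * ((2 + 8 * (K / k)) * (C' / (1 - θ)) ^ 2 + 4 / k + 1))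

/-- The function `ψ 1` suffices. From `δ ≤ θ ν r` one gets `1 - δ/r ≥ 1 - θ`, so the accumulating
factor in its gradient bound costs only a constant depending on `θ`. -/
theorem Cutoffs.exists_cutoff (h : Cutoffs d Ω Q δ ν η C') (hC' : 0 < C') (hθ1 : θ < 1)
    (hν : 0 < ν) (hν1 : ν < 1) (hΩ : Bornology.IsBounded Ω)
    (hy : Admits Ω η y r) (hδ0 : 0 < δ y (ν * r)) (hδ : δ y (ν * r) ≤ θ * (ν * r)) :
    ∃ ψ ∈ LipC (dball d Ω y r), (∀ x, 0 ≤ ψ x) ∧ (∀ x, ψ x ≤ 1) ∧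
      dball d Ω y (ν * r) ⊆ {x | ψ x = 1} ∧
      ∀ᵐ x ∂volume.restrict (dball d Ω y r), quad (Q x) (gradient ψ x) ≤
        (C' / (1 - θ) / ((1 - ν) * δ y (ν * r))) ^ 2 := by
  obtain ⟨ψ, hsupp, hψ⟩ := h y r hy
  obtain ⟨hL, h01, h1, -, -, hgrad⟩ := hψ 1 le_rfl
  have hr := hy.2.1
  refine ⟨ψ 1, ⟨hL, ?_, hsupp⟩, fun x => (h01 x).1, fun x => (h01 x).2, h1, ?_⟩
  · exact Metric.isCompact_of_isClosed_isBounded (isClosed_tsupport _)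
      (hΩ.subset (hsupp.trans dball_subset))
  · have h1ν : 0 < 1 - ν := by linarith
    have h1θ : 0 < 1 - θ := by linarith
    have h3 : 1 - θ ≤ 1 - δ y (ν * r) / r := by
      have : δ y (ν * r) / r ≤ θ := by
        rw [div_le_iff₀ hr]
        have hθ : 0 < θ := by
          by_contra hθ
          have : θ * (ν * r) ≤ 0 := mul_nonpos_of_nonpos_of_nonneg (by linarith) (by positivity)
          linarith
        nlinarith [mul_pos hθ hr]
      linarith
    have h4 : 0 < 1 - δ y (ν * r) / r := by linarith
    filter_upwards [hgrad] with x hx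
    rw [pow_one, Real.sqrt_le_left (by positivity)] at hx
    refine hx.trans ?_
    rw [div_div, mul_comm (1 - θ)]
    gcongr

/-- As `D ≤ r`, the terms without a gradient are absorbed into the factor `(r/D)²`. -/
theorem gainConst_ge (hk : 0 < k) (hr : 0 < r) {D : ℝ} (hD : 0 < D) (hDr : D ≤ r) :
    16 * C ^ 2 * ((2 + 8 * (K / k)) * (r ^ 2 * (C' / (1 - θ) / D) ^ 2) + 4 / k + 1) ≤
      gainConst k K θ C C' * (r / D) ^ 2 := by
  have hX : 1 ≤ (r / D) ^ 2 := one_le_pow₀ (by rwa [one_le_div hD])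
  calc _ = 16 * C ^ 2 * ((2 + 8 * (K / k)) * (C' / (1 - θ)) ^ 2 * (r / D) ^ 2 + 4 / k * 1 + 1) := by
        ring
    _ ≤ 16 * C ^ 2 * ((2 + 8 * (K / k)) * (C' / (1 - θ)) ^ 2 * (r / D) ^ 2 +
        4 / k * (r / D) ^ 2 + (r / D) ^ 2) := by gcongr
    _ = 16 * C ^ 2 * ((2 + 8 * (K / k)) * (C' / (1 - θ)) ^ 2 + 4 / k + 1) * (r / D) ^ 2 := by ring
    _ ≤ _ := by
        gcongr
        exact le_max_right _ _

/-- The argument produces the power `σ/(σ-1)` of `1 - ν` as well; as `0 < 1 - ν < 1`, any larger `τ`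
only weakens the bound. -/
theorem sqrt_moserConst_le (hσ : 1 < σ) {c δ' τ : ℝ} (hc : 1 ≤ c) (hν1 : ν < 1) (hν : 0 < ν)
    (hr : 0 < r) (hδ : 0 < δ') (hτ : σ / (σ - 1) ≤ τ) :
    √(moserConst σ (c * (r / ((1 - ν) * δ')) ^ 2)) ≤
      √(moserConst σ c) / ((1 - ν) ^ τ * (δ' / r) ^ (σ / (σ - 1))) := by
  have h1ν : 0 < 1 - ν := by linarith
  have hσ1 : 0 < σ - 1 := by linarith
  set a := σ / (σ - 1) with ha
  have ha0 : 0 < a := by positivity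
  have hR : 0 < r / ((1 - ν) * δ') := by positivity
  have h1 : moserConst σ (c * (r / ((1 - ν) * δ')) ^ 2) =
      moserConst σ c * ((r / ((1 - ν) * δ')) ^ a) ^ 2 := by
    rw [moserConst_eq hσ (by positivity), moserConst_eq hσ (by linarith : 0 ≤ c), ← ha,
      Real.mul_rpow (by positivity) (by positivity), ← Real.rpow_natCast, ← Real.rpow_natCast,
      ← Real.rpow_mul hR.le, ← Real.rpow_mul hR.le, mul_comm a]
    ring
  rw [h1, Real.sqrt_mul' _ (by positivity), Real.sqrt_sq (by positivity), div_eq_mul_inv (√_)]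
  refine mul_le_mul_of_nonneg_left ?_ (Real.sqrt_nonneg _)
  have h2 : r / ((1 - ν) * δ') = ((1 - ν) * (δ' / r))⁻¹ := by field_simp
  rw [h2, Real.inv_rpow (by positivity), Real.mul_rpow (by positivity) (by positivity)]
  gcongr ?_⁻¹
  refine mul_le_mul_of_nonneg_right ?_ (by positivity)
  exact Real.rpow_le_rpow_of_exponent_ge h1ν (by linarith) hτ

theorem MemW.add_const (h : MemW Q Ω u g) (hΩ : IsOpen Ω) (hfin : volume Ω < ∞)
    (hQ : ∀ i j, AEMeasurable (fun x => Q x i j) (volume.restrict Ω))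
    (hp : ∀ᵐ x ∂volume.restrict Ω, (Q x).PosSemidef) (c : ℝ) :
    MemW Q Ω (fun x => u x + c) g := by
  have := h.comp hΩ hfin hQ hp (F := fun t => t + c) (F' := fun _ => 1) (C := 1)
    (fun t => (hasDerivAt_id t).add_const c) continuous_const (fun _ => by simp)
  simpa using this

theorem ae_abs_le_toReal_eLpNorm (hf : MemLp f ∞ (volume.restrict Ω)) :
    ∀ᵐ x ∂volume.restrict Ω, |f x| ≤ (eLpNorm f ∞ (volume.restrict Ω)).toReal := by
  have h := ae_le_eLpNormEssSup (f := f) (μ := volume.restrict Ω)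
  rw [← eLpNorm_exponent_top] at h
  filter_upwards [h] with x hx
  have := ENNReal.toReal_mono hf.2.ne hx
  simpa using this

/-- The local boundedness estimate for a shifted solution or subsolution. -/
theorem ae_rpow_le_of_admits (hσ : 1 < σ) (hk : 0 < k) (hkK : k ≤ K) (hC : 0 < C) (hC' : 0 < C')
    (hθ1 : θ < 1) (hν : 0 < ν) (hν1 : ν < 1)
    (hΩ : IsOpen Ω) (hΩb : Bornology.IsBounded Ω) (hd : IsMetricOn d Ω) (hc : Containment d Ω)
    (hδ : NonDoublingOrder d Ω η θ δ) (hA : Structural Ω Q A k K)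
    (hf : MemLp f ∞ (volume.restrict Ω)) (hS : Sobolev d Ω Q σ η C)
    (hcut : Cutoffs d Ω Q δ ν η C') (hγ : γ ≠ 0) (hγ2 : |γ| ≤ 2) (hu : MemW Q Ω u g)
    (h : ((∀ᵐ x ∂volume.restrict Ω, 0 ≤ u x) ∧ IsWeakSolution Q Ω A f u g) ∨
      (1 / 2 < γ ∧ ∀ m : ℝ, 0 < m → (∀ᵐ x ∂volume.restrict Ω, 0 < u x + m) ∧
        IsAWeakSubsolution Q Ω A f (fun x => u x + m) g))
    (hy : Admits Ω η y r) {τ : ℝ} (hτ : σ / (σ - 1) ≤ τ) {m : ℝ} (hm : 0 < m) :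
    ∀ᵐ x ∂volume.restrict (dball d Ω y (ν * r)), ENNReal.ofReal
        (u x + r ^ 2 * (eLpNorm f ∞ (volume.restrict Ω)).toReal + m) ^ γ ≤
      ENNReal.ofReal (√(moserConst σ (gainConst k K θ C C')) /
        ((1 - ν) ^ τ * (δ y (ν * r) / r) ^ (σ / (σ - 1)))) *
        ((volume (dball d Ω y r))⁻¹ * ∫⁻ x in dball d Ω y r, ENNReal.ofReal
          (u x + r ^ 2 * (eLpNorm f ∞ (volume.restrict Ω)).toReal + m) ^ (2 * γ)) ^
            (1 / 2 : ℝ) := by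
  have hr := hy.2.1
  have hK : 0 ≤ K := by linarith
  have hfin : volume Ω < ∞ := hΩb.measure_lt_top
  have hQm : ∀ i j, AEMeasurable (fun x => Q x i j) (volume.restrict Ω) := hA.aemeasurable_Q
  have hBo := isOpen_dball hd hc hy.1 r
  have hyν : Admits Ω η y (ν * r) := ⟨hy.1, by positivity, lt_of_le_of_lt (by nlinarith) hy.2.2⟩
  obtain ⟨_, -, hδ'⟩ := hδ y hy.1
  obtain ⟨hδ0, hδ1, -, -⟩ := hδ' _ hyν
  obtain ⟨ψ, hψ, hψ0, hψ1, hψB, hgrad⟩ := hcut.exists_cutoff hC' hθ1 hν hν1 hΩb hy hδ0 hδ1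
  set N := (eLpNorm f ∞ (volume.restrict Ω)).toReal with hN
  have hN0 : 0 ≤ N := ENNReal.toReal_nonneg
  set D := (1 - ν) * δ y (ν * r) with hD
  have h1ν : 0 < 1 - ν := by linarith
  have hD0 : 0 < D := by positivity
  have hDr : D ≤ r := by
    have h1 : δ y (ν * r) ≤ r := by
      have h2 : θ * (ν * r) ≤ 1 * (ν * r) := by gcongr
      nlinarith
    calc D ≤ 1 * r := mul_le_mul (by linarith) h1 hδ0.le zero_le_one
      _ = r := one_mul r
  have hu0 : ∀ᵐ x ∂volume.restrict Ω, 0 ≤ u x := by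
    rcases h with h | h
    · exact h.1
    -- Nonnegativity of `u` follows by letting the shift tend to zero along a sequence.
    · have : ∀ j : ℕ, ∀ᵐ x ∂volume.restrict Ω, 0 < u x + 1 / ((j : ℝ) + 1) := fun j =>
        (h.2 _ (by positivity)).1
      filter_upwards [ae_all_iff.2 this] with x hx
      have hlim := (tendsto_one_div_add_atTop_nhds_zero_nat (𝕜 := ℝ)).const_add (u x)
      rw [add_zero] at hlim
      exact ge_of_tendsto' hlim fun j => (hx j).le
  have hm' : 0 < r ^ 2 * N + m := by positivity
  set v : E n → ℝ := fun x => u x + (r ^ 2 * N + m) with hv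
  have hle : ∀ᵐ x ∂volume.restrict Ω, r ^ 2 * N + m ≤ v x := by
    filter_upwards [hu0] with x hx
    simp only [hv]; linarith
  have hfv : ∀ᵐ x ∂volume.restrict Ω, |f x| ≤ v x / r ^ 2 := by
    filter_upwards [hu0, ae_abs_le_toReal_eLpNorm hf] with x hx hfx
    refine hfx.trans ?_
    rw [le_div_iff₀ (by positivity)]
    simp only [hv]; nlinarith
  -- A solution keeps its gradient and the matrix frozen at `u`, and has both families of tests. A
  -- subsolution uses the regularized gradient and the matrix at `v`, the shift being `r²‖f‖ + m`;
  -- as `γ > 1/2`, exponents below `1/4` are not needed.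
  obtain ⟨M, G, hH, hE, hE'⟩ : ∃ M G, LocalData σ k K C η d Ω Q y r M f v G (r ^ 2 * N + m) ∧
      SubEnergy Q Ω (dball d Ω y r) M f v G ∧
      (1 / 4 ≤ γ ∨ SuperEnergy Q Ω (dball d Ω y r) M f v G) := by
    rcases h with ⟨-, -, hsol⟩ | ⟨hγ', hsub⟩
    · have hmem := hu.add_const hΩ hfin hQm hA.psdQ (r ^ 2 * N + m)
      exact ⟨fun x => A x (u x), g, ⟨hσ, hk, hK, hC.le, hΩ, hΩb, hd, hc, hA.locInt, hA.psdQ, hS, hy,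
        hA.psdA.mono fun x hx => hx _, hA.bounds.mono fun x hx => hx _, hmem, hm', hle, hfv⟩,
        hsol.subEnergy hΩ hfin hQm hA.psdQ hBo.measurableSet dball_subset hmem hm' hle,
        Or.inr (hsol.superEnergy hΩ hfin hQm hA.psdQ hBo.measurableSet dball_subset hmem hm' hle)⟩
    · obtain ⟨hmem, hsub⟩ := (hsub _ hm').2
      exact ⟨fun x => A x (v x), regGrad Ω v g, ⟨hσ, hk, hK, hC.le, hΩ, hΩb, hd, hc, hA.locInt,
        hA.psdQ, hS, hy, hA.psdA.mono fun x hx => hx _, hA.bounds.mono fun x hx => hx _,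
        hmem.regGrad hΩ hfin hQm hA.psdQ, hm', hle, hfv⟩,
        hsub.subEnergy dball_subset hm' hle, Or.inl (by linarith)⟩
  have hgc : 1 ≤ gainConst k K θ C C' := le_max_left _ _
  have hP1 : 1 ≤ gainConst k K θ C C' * (r / D) ^ 2 :=
    one_le_mul_of_one_le_of_one_le hgc (one_le_pow₀ (by rwa [one_le_div hD0]))
  have key := hH.ae_rpow_le hψ hψ0 hψ1 (by positivity) hgrad hP1 (gainConst_ge hk hr hD0 hDr)
    hE hE' hγ hγ2
  have hsubset : dball d Ω y (ν * r) ⊆ dball d Ω y r := fun x hx =>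
    ⟨hx.1, hx.2.trans_le (by nlinarith)⟩
  filter_upwards [ae_mono (Measure.restrict_mono hsubset le_rfl) key,
    ae_restrict_mem (isOpen_dball hd hc hy.1 (ν * r)).measurableSet] with x hx hxB
  have hx := hx (hψB hxB)
  simp only [hv, ← add_assoc] at hx
  refine hx.trans (mul_le_mul_left (ENNReal.ofReal_le_ofReal ?_) _)
  exact sqrt_moserConst_le hσ hgc hν1 hν hr hδ0 hτ

end Degenerate

theorem mainTheorem6 (σ k K θ Csob Ccut : ℝ) (hσ : 1 < σ) (hk : 0 < k) (hkK : k ≤ K)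
    (hθ : 0 < θ) (hθ1 : θ < 1) (hCsob : 0 < Csob) (hCcut : 0 < Ccut) :
    ∃ Cσ : ℝ, 0 < Cσ ∧
      ∀ (n : ℕ) (Ω : Set (Degenerate.E n)) (d : Degenerate.E n → Degenerate.E n → ℝ)
        (Q : Degenerate.E n → Degenerate.Mat n) (A : Degenerate.E n → ℝ → Degenerate.Mat n)
        (f : Degenerate.E n → ℝ) (δ : Degenerate.E n → ℝ → ℝ) (ν η : ℝ),
        IsOpen Ω → Bornology.IsBounded Ω → 0 < ν → ν < 1 → 0 < η →
        Degenerate.IsMetricOn d Ω → Degenerate.Containment d Ω →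
        Degenerate.NonDoublingOrder d Ω η θ δ →
        Degenerate.Structural Ω Q A k K →
        MemLp f ∞ (volume.restrict Ω) →
        Degenerate.Sobolev d Ω Q σ η Csob →
        Degenerate.Cutoffs d Ω Q δ ν η Ccut →
        ∀ (γ : ℝ) (u : Degenerate.E n → ℝ) (g : Degenerate.E n → Degenerate.E n),
          |γ| ≤ 2 →
          Degenerate.MemW Q Ω u g →
          (((∀ᵐ x ∂volume.restrict Ω, 0 ≤ u x) ∧ Degenerate.IsWeakSolution Q Ω A f u g) ∨
            (1 / 2 < γ ∧ ∀ m : ℝ, 0 < m →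
              (∀ᵐ x ∂volume.restrict Ω, 0 < u x + m) ∧
              Degenerate.IsAWeakSubsolution Q Ω A f (fun x => u x + m) g)) →
          ∀ (y : Degenerate.E n) (r : ℝ), Degenerate.Admits Ω η y r →
            essSup (fun x => ENNReal.ofReal
                (u x + r ^ 2 * (eLpNorm f ∞ (volume.restrict Ω)).toReal) ^ γ)
                (volume.restrict (Degenerate.dball d Ω y (ν * r))) ≤
              ENNReal.ofReal (Cσ /
                ((1 - ν) ^ max (1 / (σ - 1) ^ 2 + 1) (σ / (σ - 1)) *
                  (δ y (ν * r) / r) ^ (σ / (σ - 1)))) *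
              ((volume (Degenerate.dball d Ω y r))⁻¹ *
                ∫⁻ x in Degenerate.dball d Ω y r, ENNReal.ofReal
                  (u x + r ^ 2 * (eLpNorm f ∞ (volume.restrict Ω)).toReal) ^ (2 * γ)) ^
                (1 / 2 : ℝ) := by
  have hc1 : 1 ≤ √(Degenerate.moserConst σ (Degenerate.gainConst k K θ Csob Ccut)) :=
    Real.one_le_sqrt.2 (Degenerate.one_le_moserConst hσ (le_max_left _ _))
  refine ⟨√(Degenerate.moserConst σ (Degenerate.gainConst k K θ Csob Ccut)), by linarith, ?_⟩
  intro n Ω d Q A f δ ν η hΩ hΩb hν hν1 _ hd hc hδ hA hf hS hcut γ u g hγ2 hu h y r hy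
  have hr := hy.2.1
  have hσ1 : 0 < σ - 1 := by linarith
  have h1ν : 0 < 1 - ν := by linarith
  have hyν : Degenerate.Admits Ω η y (ν * r) := ⟨hy.1, by positivity, lt_of_le_of_lt (by nlinarith) hy.2.2⟩
  obtain ⟨_, -, hδ'⟩ := hδ y hy.1
  obtain ⟨hδ0, hδ1, -, -⟩ := hδ' _ hyν
  have hτ : σ / (σ - 1) ≤ max (1 / (σ - 1) ^ 2 + 1) (σ / (σ - 1)) := le_max_right _ _
  have ha0 : 0 < σ / (σ - 1) := by positivity
  set τ := max (1 / (σ - 1) ^ 2 + 1) (σ / (σ - 1))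
  have hV0 : volume (Degenerate.dball d Ω y r) ≠ 0 :=
    ((Degenerate.isOpen_dball hd hc hy.1 r).measure_pos volume ⟨y, Degenerate.self_mem_dball hd hy.1 hr⟩).ne'
  have hVtop : volume (Degenerate.dball d Ω y r) ≠ ∞ := (hΩb.subset Degenerate.dball_subset).measure_lt_top.ne
  have hden0 : 0 < (1 - ν) ^ τ * (δ y (ν * r) / r) ^ (σ / (σ - 1)) := by positivity
  refine essSup_le_of_ae_le _ ?_
  rcases eq_or_ne γ 0 with rfl | hγ
  -- For `γ = 0` the left side and the average are both `1`, so it is enough that the constant is at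
  -- least `1` and the denominator at most `1`.
  · have hden1 : (1 - ν) ^ τ * (δ y (ν * r) / r) ^ (σ / (σ - 1)) ≤ 1 := by
      have h1 : δ y (ν * r) / r ≤ 1 := by
        rw [div_le_one hr]
        have h2 : θ * (ν * r) ≤ 1 * (ν * r) := by gcongr
        nlinarith
      exact mul_le_one₀ (Real.rpow_le_one h1ν.le (by linarith) (ha0.le.trans hτ)) (by positivity)
        (Real.rpow_le_one (by positivity) h1 ha0.le)
    refine Eventually.of_forall fun x => ?_
    simp only [mul_zero, ENNReal.rpow_zero, lintegral_const, one_mul,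
      Measure.restrict_apply_univ, ENNReal.inv_mul_cancel hV0 hVtop, ENNReal.one_rpow, mul_one]
    rw [ENNReal.one_le_ofReal, one_le_div hden0]
    linarith
  · have : IsFiniteMeasure (volume.restrict (Degenerate.dball d Ω y r)) :=
      ⟨by rw [Measure.restrict_apply_univ]; exact hVtop.lt_top⟩
    refine Degenerate.ae_rpow_le_of_shift
      (((hu.1.mono_measure (Measure.restrict_mono Degenerate.dball_subset le_rfl)).aemeasurable).add_const _)
      hγ (ENNReal.inv_ne_zero.2 hVtop) (ENNReal.inv_ne_top.2 hV0)
      (ENNReal.ofReal_pos.2 (by positivity)).ne' ENNReal.ofReal_ne_top fun j => ?_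
    exact Degenerate.ae_rpow_le_of_admits hσ hk hkK hCsob hCcut hθ1 hν hν1 hΩ hΩb hd hc hδ hA hf hS hcut hγ
      hγ2 hu h hy hτ (by positivity)
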